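/- A KT structure on a smooth manifold is a Hermitian structure $(I,g)$ (an endomorphism field $I$ of the tangent bundle with $I^2=-1$ and vanishing Nijenhuis tensor, and a Riemannian metric $g$ with $g(I\cdot,I\cdot)=g$) together with a connection $\nabla$ such that $\nabla g=0$, $\nabla I=0$ and the torsion $(X,Y,Z)\mapsto g(T(X,Y),Z)$ is a 3-form. **Theorem (KT reduction).** Let $(M,I,g)$ be a KT manifold and let $G$ be a compact Lie group, with Lie algebra $\mathfrak g$, acting smoothly on $M$ by holomorphic isometries. For $X\in\mathfrak g$ let $X_M$ denote the vector field on $M$ generated by $X$. Let $\nu:M\to\mathfrak g^*$ be a $G$-moment map, i.e. a smooth map which is equivariant for the coadjoint action and transversal: for all $0\ne X\in\mathfrak g$, the $\mathfrak g^*$-valued function $d\nu(IX_M)$ vanishes nowhere on $M$. Let $\zeta\in\mathfrak g^*$ be such that the level set $P=\nu^{-1}(\zeta)$ is $G$-invariant and $G$ acts freely on $P$. Then $P$ is an embedded submanifold of $M$ of dimension $\dim M-\dim G$, and the orbit space $N=P/G$, which is Hausdorff and second countable in the quotient topology, carries a smooth structure of dimension $\dim M-2\dim G$ for which $\pi:P\to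 N$ is a submersion. Put $\mathcal U_p=\{t\in T_pM: d\nu(t)=0,\ d\nu(It)=0\}\subset T_pP$ for $p\in P$. Every $\hat A\in T_{\pi(p)}N$ has a unique horizontal lift $A^u\in\mathcal U_p$, that is, a unique vector in $\mathcal U_p$ with $d\pi(A^u)=\hat A$. Moreover, there is exactly one KT structure $(\hat I,\hat g,\hat\nabla)$ on $N$ such that, for all $p\in P$ and all $\hat A,\hat B\in T_{\pi(p)}N$, $$(\hat I\hat A)^u=I A^u,\qquad \hat g(\hat A,\hat B)=g(A^u,B^u).$$ -/

import Mathlib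

open Bundle
open scoped Manifold ContDiff

noncomputable section

namespace KT

/-! ## Complex, Hermitian and KT structures on a real smooth manifold -/

section Structures

variable (E : Type*) [NormedAddCommGroup E] [NormedSpace ℝ E] [FiniteDimensional ℝ E]
  (M : Type*) [TopologicalSpace M] [ChartedSpace E M] [IsManifold 𝓘(ℝ, E) ∞ M]

/-- A complex structure on a smooth manifold: a smooth field `J` of endomorphisms of the tangent
spaces with `J² = -1` whose Nijenhuis tensor
`[JX, JY] - [X, Y] - J ([JX, Y] + [X, JY])` vanishes. -/
structure ComplexStructure where
  /-- The endomorphism of each tangent space. -/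
  J (x : M) : TangentSpace 𝓘(ℝ, E) x →L[ℝ] TangentSpace 𝓘(ℝ, E) x
  contMDiff_J : ContMDiff 𝓘(ℝ, E) (𝓘(ℝ, E).prod 𝓘(ℝ, E →L[ℝ] E)) ∞
    (fun x ↦ TotalSpace.mk' (E →L[ℝ] E)
      (E := fun x : M ↦ TangentSpace 𝓘(ℝ, E) x →L[ℝ] TangentSpace 𝓘(ℝ, E) x) x (J x))
  J_J (x : M) (v : TangentSpace 𝓘(ℝ, E) x) : J x (J x v) = -v
  integrable (X Y : Π x : M, TangentSpace 𝓘(ℝ, E) x) (x : M)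
    (hX : MDiffAt (T% X) x) (hY : MDiffAt (T% Y) x) :
    VectorField.mlieBracket 𝓘(ℝ, E) (fun y ↦ J y (X y)) (fun y ↦ J y (Y y)) x
      - VectorField.mlieBracket 𝓘(ℝ, E) X Y x
      - J x (VectorField.mlieBracket 𝓘(ℝ, E) (fun y ↦ J y (X y)) Y x
          + VectorField.mlieBracket 𝓘(ℝ, E) X (fun y ↦ J y (Y y)) x) = 0

/-- A Hermitian structure: a complex structure and a smooth Riemannian metric `g` with
`g(Jv, Jw) = g(v, w)`. -/
structure HermitianStructure extends ComplexStructure E M where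
  /-- The Riemannian metric. -/
  metric : ContMDiffRiemannianMetric 𝓘(ℝ, E) ∞ E (TangentSpace 𝓘(ℝ, E) : M → Type _)
  hermitian (x : M) (v w : TangentSpace 𝓘(ℝ, E) x) :
    metric.inner x (J x v) (J x w) = metric.inner x v w

variable {E M}

/-- A smooth connection `∇` on the tangent bundle of a Hermitian manifold is a KT connection if
`∇g = 0`, `∇J = 0` and the torsion `(u, v, w) ↦ g(T(u, v), w)` is a 3-form. In Mathlib's
convention `cov Y x u` is `(∇_u Y)(x)`. -/
structure IsKTConnection (h : HermitianStructure E M)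
    (cov : CovariantDerivative 𝓘(ℝ, E) E (TangentSpace 𝓘(ℝ, E) : M → Type _)) : Prop where
  smooth : CovariantDerivative.ContMDiffCovariantDerivative cov ∞
  metric_parallel (Y Z : Π x : M, TangentSpace 𝓘(ℝ, E) x) (x : M)
    (hY : MDiffAt (T% Y) x) (hZ : MDiffAt (T% Z) x) (u : TangentSpace 𝓘(ℝ, E) x) :
    (mfderiv 𝓘(ℝ, E) 𝓘(ℝ, ℝ) (fun y ↦ h.metric.inner y (Y y) (Z y)) x u : ℝ)
      = h.metric.inner x (cov Y x u) (Z x) + h.metric.inner x (Y x) (cov Z x u)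
  complex_parallel (Y : Π x : M, TangentSpace 𝓘(ℝ, E) x) (x : M)
    (hY : MDiffAt (T% Y) x) (u : TangentSpace 𝓘(ℝ, E) x) :
    cov (fun y ↦ h.J y (Y y)) x u = h.J x (cov Y x u)
  torsion_skew_left (x : M) (u v w : TangentSpace 𝓘(ℝ, E) x) :
    haveI : CompleteSpace E := FiniteDimensional.complete ℝ E
    h.metric.inner x (cov.torsion x u v) w = -h.metric.inner x (cov.torsion x v u) w
  torsion_skew_right (x : M) (u v w : TangentSpace 𝓘(ℝ, E) x) :
    haveI : CompleteSpace E := FiniteDimensional.complete ℝ E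
    h.metric.inner x (cov.torsion x u v) w = -h.metric.inner x (cov.torsion x u w) v

/-- Two connections are the same: they agree at every point on all vector fields that are
differentiable there (a `CovariantDerivative` also has meaningless values on other fields). -/
def SameConnection
    (cov cov' : CovariantDerivative 𝓘(ℝ, E) E (TangentSpace 𝓘(ℝ, E) : M → Type _)) : Prop :=
  ∀ (Y : Π x : M, TangentSpace 𝓘(ℝ, E) x) (x : M), MDiffAt (T% Y) x → cov Y x = cov' Y x

variable (E M)

/-- A KT structure: a Hermitian structure together with a Hermitian connection whose torsion is
a 3-form. -/
structure KTStructure extends HermitianStructure E M where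
  /-- The KT connection. -/
  conn : CovariantDerivative 𝓘(ℝ, E) E (TangentSpace 𝓘(ℝ, E) : M → Type _)
  isKTConnection : IsKTConnection toHermitianStructure conn

end Structures

/-! ## Group actions, moment maps and the reduced space -/

section Reduction

variable {E : Type*} [NormedAddCommGroup E] [NormedSpace ℝ E] [FiniteDimensional ℝ E]
  {M : Type*} [TopologicalSpace M] [ChartedSpace E M] [IsManifold 𝓘(ℝ, E) ∞ M]
  {EG : Type*} [NormedAddCommGroup EG] [NormedSpace ℝ EG]
  {G : Type*} [Group G] [TopologicalSpace G] [ChartedSpace EG G]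

/-- Every element of `G` acts as a holomorphic isometry of the Hermitian manifold `M`. -/
structure ActsByComplexIsometries (G : Type*) [Group G] [MulAction G M]
    (h : HermitianStructure E M) : Prop where
  isometry (a : G) (x : M) (v w : TangentSpace 𝓘(ℝ, E) x) :
    h.metric.inner (a • x) (mfderiv 𝓘(ℝ, E) 𝓘(ℝ, E) (fun y : M ↦ a • y) x v)
      (mfderiv 𝓘(ℝ, E) 𝓘(ℝ, E) (fun y : M ↦ a • y) x w) = h.metric.inner x v w
  holomorphic (a : G) (x : M) (v : TangentSpace 𝓘(ℝ, E) x) :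
    mfderiv 𝓘(ℝ, E) 𝓘(ℝ, E) (fun y : M ↦ a • y) x (h.J x v)
      = h.J (a • x) (mfderiv 𝓘(ℝ, E) 𝓘(ℝ, E) (fun y : M ↦ a • y) x v)

/-- The vector field on `M` generated by `ξ` in the Lie algebra of `G`: at `x` it is the image of
`ξ` under the differential at `1` of `a ↦ a • x`. (The tangent spaces at `1 • x` and at `x` are the
same, since `1 • x = x`.) -/
def fundamentalField [MulAction G M] (ξ : GroupLieAlgebra 𝓘(ℝ, EG) G) (x : M) :
    TangentSpace 𝓘(ℝ, E) x :=
  mfderiv 𝓘(ℝ, EG) 𝓘(ℝ, E) (fun a : G ↦ a • x) (1 : G) ξ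

/-- The adjoint action of `a : G` on the Lie algebra: the differential at `1` of
`b ↦ a * b * a⁻¹`. -/
def adjoint (a : G) (ξ : GroupLieAlgebra 𝓘(ℝ, EG) G) : GroupLieAlgebra 𝓘(ℝ, EG) G :=
  mfderiv 𝓘(ℝ, EG) 𝓘(ℝ, EG) (fun b : G ↦ a * b * a⁻¹) (1 : G) ξ

/-- `ν : M → 𝔤*` is a `G`-moment map on the complex manifold `(M, J)`: it is smooth, equivariant
for the coadjoint action, `ν(a • x) = ν(x) ∘ Ad(a⁻¹)`, and transversal, i.e. for every nonzero
`ξ ∈ 𝔤` the function `(J dν)(ξ_M) = dν(J ξ_M)` vanishes nowhere on `M`.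

The Lie algebra `GroupLieAlgebra 𝓘(ℝ, EG) G`, the tangent space of `G` at `1`, is by definition
the model space `EG`, so `𝔤*` is written `EG →L[ℝ] ℝ`. -/
structure IsGMomentMap (G : Type*) [Group G] [TopologicalSpace G] [ChartedSpace EG G]
    [MulAction G M] (c : ComplexStructure E M) (ν : M → (EG →L[ℝ] ℝ)) : Prop where
  smooth : ContMDiff 𝓘(ℝ, E) 𝓘(ℝ, EG →L[ℝ] ℝ) ∞ ν
  equivariant (a : G) (x : M) (ξ : GroupLieAlgebra 𝓘(ℝ, EG) G) :
    ν (a • x) ξ = ν x (adjoint a⁻¹ ξ)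
  transversal (x : M) (ξ : GroupLieAlgebra 𝓘(ℝ, EG) G) (hξ : ξ ≠ 0) :
    mfderiv 𝓘(ℝ, E) 𝓘(ℝ, EG →L[ℝ] ℝ) ν x (c.J x (fundamentalField ξ x)) ≠ 0

/-- An invariant level set `P = ν⁻¹(ζ)`, with the induced action of `G`. -/
def level (G : Type*) [Group G] [MulAction G M] (ν : M → (EG →L[ℝ] ℝ)) (ζ : EG →L[ℝ] ℝ)
    (hinv : ∀ (a : G) (x : M), ν x = ζ → ν (a • x) = ζ) : SubMulAction G M where
  carrier := {x | ν x = ζ}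
  smul_mem' a _ hx := hinv a _ hx

/-- The quotient map `π : P → P / G` onto the orbit space of an invariant subset. -/
def proj [MulAction G M] (P : SubMulAction G M) : P → MulAction.orbitRel.Quotient G P :=
  Quotient.mk (MulAction.orbitRel G P)

/-- The reduced space `N = ν⁻¹(ζ) / G`, with the quotient topology. -/
abbrev ReducedSpace (G : Type*) [Group G] [MulAction G M] (ν : M → (EG →L[ℝ] ℝ))
    (ζ : EG →L[ℝ] ℝ) (hinv : ∀ (a : G) (x : M), ν x = ζ → ν (a • x) = ζ) : Type _ :=
  MulAction.orbitRel.Quotient G (level G ν ζ hinv)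

/-- The model space of the level sets, of dimension `dim M - dim G`. -/
abbrev LevelModel (E EG : Type*) [NormedAddCommGroup E] [NormedSpace ℝ E]
    [NormedAddCommGroup EG] [NormedSpace ℝ EG] : Type :=
  EuclideanSpace ℝ (Fin (Module.finrank ℝ E - Module.finrank ℝ EG))

/-- The model space of the reduced space, of dimension `dim M - 2 dim G`. -/
abbrev ReducedModel (E EG : Type*) [NormedAddCommGroup E] [NormedSpace ℝ E]
    [NormedAddCommGroup EG] [NormedSpace ℝ EG] : Type :=
  EuclideanSpace ℝ (Fin (Module.finrank ℝ E - 2 * Module.finrank ℝ EG))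

/-- `t ∈ T_x M` is horizontal: it is tangent to the level set of `ν`, and `J dν` vanishes
on it. -/
def IsHorizontal (c : ComplexStructure E M) (ν : M → (EG →L[ℝ] ℝ)) (x : M)
    (t : TangentSpace 𝓘(ℝ, E) x) : Prop :=
  mfderiv 𝓘(ℝ, E) 𝓘(ℝ, EG →L[ℝ] ℝ) ν x t = 0 ∧
    mfderiv 𝓘(ℝ, E) 𝓘(ℝ, EG →L[ℝ] ℝ) ν x (c.J x t) = 0

variable [MulAction G M]
  {EP : Type*} [NormedAddCommGroup EP] [NormedSpace ℝ EP]
  {EN : Type*} [NormedAddCommGroup EN] [NormedSpace ℝ EN]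

/-- For `p ∈ P`, the vector `t ∈ T_p M` is a horizontal lift of the tangent vector `A` of `P / G`
at `π p`: it is horizontal, and it is the image under the inclusion `P → M` of a vector tangent
to `P` that `dπ` maps to `A`. -/
def IsHorizontalLift (c : ComplexStructure E M) (ν : M → (EG →L[ℝ] ℝ)) (P : SubMulAction G M)
    [ChartedSpace EP P] [ChartedSpace EN (MulAction.orbitRel.Quotient G P)] (p : P)
    (A : TangentSpace 𝓘(ℝ, EN) (proj P p)) (t : TangentSpace 𝓘(ℝ, E) (p : M)) : Prop :=
  IsHorizontal c ν (p : M) t ∧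
    ∃ u : TangentSpace 𝓘(ℝ, EP) p,
      mfderiv 𝓘(ℝ, EP) 𝓘(ℝ, E) (fun q : P ↦ (q : M)) p u = t ∧
      mfderiv 𝓘(ℝ, EP) 𝓘(ℝ, EN) (proj P) p u = A

/-- The Hermitian structure `k` on `P / G` is induced by the Hermitian structure `h` on `M`:
for horizontal lifts `A^u`, `B^u` at any `p ∈ P` of tangent vectors `A`, `B` at `π p`, one has
`(J A)^u = J A^u` and `k(A, B) = h(A^u, B^u)`. -/
structure IsInduced [FiniteDimensional ℝ EN] (h : HermitianStructure E M)
    (ν : M → (EG →L[ℝ] ℝ)) (P : SubMulAction G M)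
    [ChartedSpace EP P] [ChartedSpace EN (MulAction.orbitRel.Quotient G P)]
    [IsManifold 𝓘(ℝ, EN) ∞ (MulAction.orbitRel.Quotient G P)]
    (k : HermitianStructure EN (MulAction.orbitRel.Quotient G P)) : Prop where
  complex (p : P) (A : TangentSpace 𝓘(ℝ, EN) (proj P p)) (s : TangentSpace 𝓘(ℝ, E) (p : M))
    (hA : IsHorizontalLift (EP := EP) h.toComplexStructure ν P p A s) :
    IsHorizontalLift (EP := EP) h.toComplexStructure ν P p (k.J (proj P p) A) (h.J (p : M) s)
  metric (p : P) (A B : TangentSpace 𝓘(ℝ, EN) (proj P p)) (s t : TangentSpace 𝓘(ℝ, E) (p : M))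
    (hA : IsHorizontalLift (EP := EP) h.toComplexStructure ν P p A s)
    (hB : IsHorizontalLift (EP := EP) h.toComplexStructure ν P p B t) :
    k.metric.inner (proj P p) A B = h.metric.inner (p : M) s t

end Reduction

end KT

end

/-! The connection and the Hermitian structure can be treated separately. A Hermitian manifold has
exactly one KT connection, the Bismut connection, so reduction only has to produce the induced
Hermitian structure on `N`.

The KT connection. With ω = g(J·,·), take T(X,Y,Z) = dω(JX,JY,JZ) as torsion and define ∇ by the
Koszul formula. Antisymmetry of T gives ∇g = 0 and the torsion T; the vanishing of the Nijenhuis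
tensor gives ∇J = 0 (`koszul_jField`). For uniqueness, the difference of two KT connections is a
tensor a(u,v,w) that is totally skew, and J can be moved between two slots at the cost of a sign.
Moving it once around the three slots gives a = -a (`sameConnection_of_isKTConnection`).

The manifolds. Transversality makes ξ ↦ dν(Jξ_M) an isomorphism from 𝔤 to 𝔤*, so dν is onto and the
infinitesimal action is injective; invariance of `P` gives dν(ξ_M) = 0 on `P`. The inverse function
theorem yields a chart with first coordinate ν - ζ. Flowing a slice out by `G` straightens the
orbits, and compactness and freeness ensure that a small slice in `P` meets each orbit at most once.
The resulting adapted charts (`exists_isAdaptedChart`) give the atlases of `P` and `P/G`;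
`IsReduction` records what is needed of them afterwards.

Horizontal lifts. By dimension, T_pP is the kernel of dν and the kernel of dπ is the space of
fundamental vectors. A tangent vector v of `P` becomes horizontal after subtracting the unique ξ_M
with dν(Jξ_M) = dν(Jv), which is `horProj`; hence lifts exist, are unique and vary smoothly. J
preserves the horizontal space because it exchanges its two defining equations up to sign. `G` maps
lifts to lifts, by equivariance of ν and holomorphy. So J and g on horizontal vectors descend to
`N`.

Integrability. Let X, Y be horizontal lifts of A, B. Brackets of related fields are related, so D =
[JX,Y] + [X,JY] and C = [JX,JY] - [X,Y] are tangent to `P` and project to their counterparts on `N`.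
Integrability on `M` says C = JD. Hence dν(D) = dν(JD) = 0, D is horizontal, and JD is the
horizontal lift of Ĵ applied to the image of D. Comparing with the image of C gives the identity on
`N` (`integrable_reducedJ`). -/

open scoped Topology
set_option linter.unusedSectionVars false
set_option linter.style.haveILetI false

namespace KT

/-! ### The Koszul expression of the Bismut connection -/

section Bismut

open VectorField

variable {E : Type*} [NormedAddCommGroup E] [NormedSpace ℝ E] [FiniteDimensional ℝ E]
  {M : Type*} [TopologicalSpace M] [ChartedSpace E M] [IsManifold 𝓘(ℝ, E) ∞ M]

/-- The field lives along a map `b`, and not just on `M`, because smoothness on the orbit space is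
checked on lifts along local sections of `P → N`. -/
lemma ComplexStructure.contMDiffAt_J (c : ComplexStructure E M)
    {E' : Type*} [NormedAddCommGroup E'] [NormedSpace ℝ E']
    {H' : Type*} [TopologicalSpace H'] {I' : ModelWithCorners ℝ E' H'}
    {M' : Type*} [TopologicalSpace M'] [ChartedSpace H' M']
    {b : M' → M} {X : Π x : M', TangentSpace 𝓘(ℝ, E) (b x)} {x : M'}
    {n : ℕ∞ω} (hn : n ≤ ∞)
    (hX : ContMDiffAt I' 𝓘(ℝ, E).tangent n (fun y ↦ TotalSpace.mk' E (b y) (X y)) x) :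
    ContMDiffAt I' 𝓘(ℝ, E).tangent n (fun y ↦ TotalSpace.mk' E (b y) (c.J (b y) (X y))) x := by
  have hb : ContMDiffAt I' 𝓘(ℝ, E) n b x := by
    simp only [contMDiffAt_totalSpace] at hX
    exact hX.1
  exact ContMDiffAt.clm_bundle_apply (F₁ := E) (F₂ := E)
    (((c.contMDiff_J (b x)).of_le hn).comp x hb) hX

lemma ComplexStructure.mdifferentiableAt_J (c : ComplexStructure E M)
    {E' : Type*} [NormedAddCommGroup E'] [NormedSpace ℝ E']
    {H' : Type*} [TopologicalSpace H'] {I' : ModelWithCorners ℝ E' H'}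
    {M' : Type*} [TopologicalSpace M'] [ChartedSpace H' M']
    {b : M' → M} {X : Π x : M', TangentSpace 𝓘(ℝ, E) (b x)} {x : M'}
    (hX : MDifferentiableAt I' 𝓘(ℝ, E).tangent (fun y ↦ TotalSpace.mk' E (b y) (X y)) x) :
    MDifferentiableAt I' 𝓘(ℝ, E).tangent (fun y ↦ TotalSpace.mk' E (b y) (c.J (b y) (X y))) x := by
  have hb : MDifferentiableAt I' 𝓘(ℝ, E) b x := by
    simp only [mdifferentiableAt_totalSpace] at hX
    exact hX.1
  exact MDifferentiableAt.clm_bundle_apply (F₁ := E) (F₂ := E)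
    (((c.contMDiff_J (b x)).mdifferentiableAt (by simp)).comp x hb) hX

lemma HermitianStructure.contMDiffAt_inner (h : HermitianStructure E M)
    {E' : Type*} [NormedAddCommGroup E'] [NormedSpace ℝ E']
    {H' : Type*} [TopologicalSpace H'] {I' : ModelWithCorners ℝ E' H'}
    {M' : Type*} [TopologicalSpace M'] [ChartedSpace H' M']
    {b : M' → M} {X Y : Π x : M', TangentSpace 𝓘(ℝ, E) (b x)} {x : M'}
    {n : ℕ∞ω} (hn : n ≤ ∞)
    (hX : ContMDiffAt I' 𝓘(ℝ, E).tangent n (fun y ↦ TotalSpace.mk' E (b y) (X y)) x)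
    (hY : ContMDiffAt I' 𝓘(ℝ, E).tangent n (fun y ↦ TotalSpace.mk' E (b y) (Y y)) x) :
    ContMDiffAt I' 𝓘(ℝ, ℝ) n (fun y ↦ (h.metric.inner (b y) (X y) (Y y) : ℝ)) x := by
  have hb : ContMDiffAt I' 𝓘(ℝ, E) n b x := by
    simp only [contMDiffAt_totalSpace] at hX
    exact hX.1
  have : ContMDiffAt I' (𝓘(ℝ, E).prod 𝓘(ℝ)) n (fun m ↦ TotalSpace.mk' ℝ
      (E := Bundle.Trivial M ℝ) (b m) (h.metric.inner (b m) (X m) (Y m))) x :=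
    ContMDiffAt.clm_bundle_apply₂ (F₁ := E) (F₂ := E)
      (((h.metric.contMDiff (b x)).of_le hn).comp x hb) hX hY
  simp only [contMDiffAt_totalSpace] at this
  exact this.2

lemma HermitianStructure.mdifferentiableAt_inner (h : HermitianStructure E M)
    {E' : Type*} [NormedAddCommGroup E'] [NormedSpace ℝ E']
    {H' : Type*} [TopologicalSpace H'] {I' : ModelWithCorners ℝ E' H'}
    {M' : Type*} [TopologicalSpace M'] [ChartedSpace H' M']
    {b : M' → M} {X Y : Π x : M', TangentSpace 𝓘(ℝ, E) (b x)} {x : M'}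
    (hX : MDifferentiableAt I' 𝓘(ℝ, E).tangent (fun y ↦ TotalSpace.mk' E (b y) (X y)) x)
    (hY : MDifferentiableAt I' 𝓘(ℝ, E).tangent (fun y ↦ TotalSpace.mk' E (b y) (Y y)) x) :
    MDifferentiableAt I' 𝓘(ℝ, ℝ) (fun y ↦ (h.metric.inner (b y) (X y) (Y y) : ℝ)) x := by
  have hb : MDifferentiableAt I' 𝓘(ℝ, E) b x := by
    simp only [mdifferentiableAt_totalSpace] at hX
    exact hX.1
  have : MDifferentiableAt I' (𝓘(ℝ, E).prod 𝓘(ℝ)) (fun m ↦ TotalSpace.mk' ℝ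
      (E := Bundle.Trivial M ℝ) (b m) (h.metric.inner (b m) (X m) (Y m))) x :=
    MDifferentiableAt.clm_bundle_apply₂ (F₁ := E) (F₂ := E)
      (((h.metric.contMDiff (b x)).mdifferentiableAt (by simp)).comp x hb) hX hY
  simp only [mdifferentiableAt_totalSpace] at this
  exact this.2

namespace HermitianStructure

variable (h : HermitianStructure E M)

/-- The derivative of `g(Y, Z)` in the direction `X`. -/
noncomputable def derivInner (X Y Z : Π x : M, TangentSpace 𝓘(ℝ, E) x) (x : M) : ℝ :=
  mvfderiv 𝓘(ℝ, E) (fun y ↦ (h.metric.inner y (Y y) (Z y) : ℝ)) x (X x)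

/-- The function `g([X, Y], Z)`. -/
noncomputable def bracketInner (X Y Z : Π x : M, TangentSpace 𝓘(ℝ, E) x) (x : M) : ℝ :=
  h.metric.inner x (mlieBracket 𝓘(ℝ, E) X Y x) (Z x)

/-- The vector field `J X`. -/
noncomputable def jField (X : Π x : M, TangentSpace 𝓘(ℝ, E) x) (x : M) : TangentSpace 𝓘(ℝ, E) x :=
  h.J x (X x)

variable {h} {X X' Y Y' Z Z' : Π x : M, TangentSpace 𝓘(ℝ, E) x} {f : M → ℝ} {x : M}

lemma mdiffAt_jField (hX : MDiffAt (T% X) x) : MDiffAt (T% (h.jField X)) x :=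
  h.mdifferentiableAt_J (b := id) hX

lemma jField_add : h.jField (X + X') = h.jField X + h.jField X' := by
  ext x; simp [jField]

lemma jField_smul : h.jField (f • X) = f • h.jField X := by
  ext x; simp [jField]

lemma jField_jField : h.jField (h.jField X) = -X := by
  ext x; simp [jField, h.J_J]

lemma mdiffAt_inner (hX : MDiffAt (T% X) x) (hY : MDiffAt (T% Y) x) :
    MDifferentiableAt 𝓘(ℝ, E) 𝓘(ℝ, ℝ) (fun y ↦ (h.metric.inner y (X y) (Y y) : ℝ)) x :=
  h.mdifferentiableAt_inner (b := id) hX hY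

lemma derivInner_symm : h.derivInner X Y Z x = h.derivInner X Z Y x := by
  unfold derivInner
  rw [show (fun y ↦ (h.metric.inner y (Y y) (Z y) : ℝ)) = fun y ↦ h.metric.inner y (Z y) (Y y) from
    funext fun y ↦ h.metric.symm y _ _]

lemma derivInner_add_left : h.derivInner (X + X') Y Z x
    = h.derivInner X Y Z x + h.derivInner X' Y Z x := by
  simp [derivInner]

lemma derivInner_smul_left : h.derivInner (f • X) Y Z x = f x * h.derivInner X Y Z x := by
  simp [derivInner]

lemma derivInner_add_mid (hY : MDiffAt (T% Y) x) (hY' : MDiffAt (T% Y') x)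
    (hZ : MDiffAt (T% Z) x) : h.derivInner X (Y + Y') Z x
    = h.derivInner X Y Z x + h.derivInner X Y' Z x := by
  unfold derivInner
  have := mvfderiv_add (mdiffAt_inner (h := h) hY hZ) (mdiffAt_inner (h := h) hY' hZ)
  have h2 : (fun y ↦ (h.metric.inner y ((Y + Y') y) (Z y) : ℝ)) =
      (fun y ↦ (h.metric.inner y (Y y) (Z y) : ℝ)) + fun y ↦ h.metric.inner y (Y' y) (Z y) := by
    ext y; simp
  rw [h2, this]; rfl

lemma derivInner_smul_mid (hf : MDiffAt f x) (hY : MDiffAt (T% Y) x)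
    (hZ : MDiffAt (T% Z) x) : h.derivInner X (f • Y) Z x
    = f x * h.derivInner X Y Z x + mvfderiv 𝓘(ℝ, E) f x (X x) * h.metric.inner x (Y x) (Z x) := by
  unfold derivInner
  have := mvfderiv_mul hf (mdiffAt_inner (h := h) hY hZ)
  have h2 : (fun y ↦ (h.metric.inner y ((f • Y) y) (Z y) : ℝ)) =
      f * (fun y ↦ (h.metric.inner y (Y y) (Z y) : ℝ)) := by
    ext y; simp
  rw [h2, this]
  simp [mul_comm]

lemma derivInner_jField_jField :
    h.derivInner X (h.jField Y) (h.jField Z) x = h.derivInner X Y Z x := by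
  unfold derivInner
  rw [show (fun y ↦ (h.metric.inner y (h.jField Y y) (h.jField Z y) : ℝ)) =
    fun y ↦ h.metric.inner y (Y y) (Z y) from funext fun y ↦ h.hermitian y _ _]

lemma inner_J_left (v w : TangentSpace 𝓘(ℝ, E) x) :
    h.metric.inner x (h.J x v) w = - h.metric.inner x v (h.J x w) := by
  rw [← h.hermitian x v, h.J_J]; simp

lemma derivInner_neg_mid : h.derivInner X (-Y) Z x = - h.derivInner X Y Z x := by
  unfold derivInner
  have h2 : (fun y ↦ (h.metric.inner y ((-Y) y) (Z y) : ℝ)) =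
      - (fun y ↦ (h.metric.inner y (Y y) (Z y) : ℝ)) := by
    ext y; simp
  rw [h2, mvfderiv_neg]; rfl

lemma derivInner_neg_left : h.derivInner (-X) Y Z x = - h.derivInner X Y Z x := by
  simp [derivInner]

lemma derivInner_jField_mid :
    h.derivInner X (h.jField Y) Z x = - h.derivInner X Y (h.jField Z) x := by
  rw [← derivInner_jField_jField (Y := h.jField Y), jField_jField, derivInner_neg_mid]

lemma bracketInner_swap : h.bracketInner X Y Z x = - h.bracketInner Y X Z x := by
  rw [bracketInner, mlieBracket_swap]; simp [bracketInner]

lemma bracketInner_add_left (hX : MDiffAt (T% X) x) (hX' : MDiffAt (T% X') x) :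
    h.bracketInner (X + X') Y Z x = h.bracketInner X Y Z x + h.bracketInner X' Y Z x := by
  haveI : CompleteSpace E := FiniteDimensional.complete ℝ E
  simp [bracketInner, mlieBracket_add_left hX hX']

lemma bracketInner_smul_left (hf : MDiffAt f x) (hX : MDiffAt (T% X) x) :
    h.bracketInner (f • X) Y Z x = f x * h.bracketInner X Y Z x
      - mvfderiv 𝓘(ℝ, E) f x (Y x) * h.metric.inner x (X x) (Z x) := by
  haveI : CompleteSpace E := FiniteDimensional.complete ℝ E
  simp [bracketInner, mlieBracket_smul_left hf hX]
  ring

lemma bracketInner_add_mid (hX : MDiffAt (T% Y) x) (hX' : MDiffAt (T% Y') x) :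
    h.bracketInner X (Y + Y') Z x = h.bracketInner X Y Z x + h.bracketInner X Y' Z x := by
  rw [bracketInner_swap, bracketInner_add_left hX hX', bracketInner_swap (X := X),
    bracketInner_swap (X := X)]
  ring

lemma bracketInner_smul_mid (hf : MDiffAt f x) (hY : MDiffAt (T% Y) x) :
    h.bracketInner X (f • Y) Z x = f x * h.bracketInner X Y Z x
      + mvfderiv 𝓘(ℝ, E) f x (X x) * h.metric.inner x (Y x) (Z x) := by
  rw [bracketInner_swap, bracketInner_smul_left hf hY, bracketInner_swap (X := X)]
  ring

lemma bracketInner_add_right :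
    h.bracketInner X Y (Z + Z') x = h.bracketInner X Y Z x + h.bracketInner X Y Z' x := by
  simp [bracketInner]

lemma bracketInner_smul_right :
    h.bracketInner X Y (f • Z) x = f x * h.bracketInner X Y Z x := by
  simp [bracketInner]

lemma bracketInner_neg_left (hX : MDiffAt (T% X) x) :
    h.bracketInner (-X) Y Z x = - h.bracketInner X Y Z x := by
  haveI : CompleteSpace E := FiniteDimensional.complete ℝ E
  have : -X = (-1 : ℝ) • X := by simp
  rw [this, bracketInner, mlieBracket_const_smul_left hX]
  simp [bracketInner]

lemma bracketInner_neg_mid (hY : MDiffAt (T% Y) x) :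
    h.bracketInner X (-Y) Z x = - h.bracketInner X Y Z x := by
  rw [bracketInner_swap, bracketInner_neg_left hY, bracketInner_swap (X := X)]

lemma derivInner_add_right (hZ : MDiffAt (T% Z) x) (hZ' : MDiffAt (T% Z') x)
    (hY : MDiffAt (T% Y) x) : h.derivInner X Y (Z + Z') x
    = h.derivInner X Y Z x + h.derivInner X Y Z' x := by
  rw [derivInner_symm, derivInner_add_mid hZ hZ' hY, derivInner_symm (Y := Y),
    derivInner_symm (Y := Y)]

lemma derivInner_smul_right (hf : MDiffAt f x) (hZ : MDiffAt (T% Z) x)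
    (hY : MDiffAt (T% Y) x) : h.derivInner X Y (f • Z) x
    = f x * h.derivInner X Y Z x
      + mvfderiv 𝓘(ℝ, E) f x (X x) * h.metric.inner x (Y x) (Z x) := by
  rw [derivInner_symm, derivInner_smul_mid hf hZ hY, derivInner_symm (Y := Y), h.metric.symm]

lemma derivInner_neg_right : h.derivInner X Y (-Z) x = - h.derivInner X Y Z x := by
  rw [derivInner_symm, derivInner_neg_mid, derivInner_symm]

variable (h) in
/-- The 3-form `dω(J X, J Y, J Z)`, where `ω(X, Y) = g(J X, Y)`. -/
noncomputable def bismutForm (X Y Z : Π x : M, TangentSpace 𝓘(ℝ, E) x) (x : M) : ℝ :=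
  - h.derivInner (h.jField X) Y (h.jField Z) x + h.derivInner (h.jField Y) X (h.jField Z) x
    - h.derivInner (h.jField Z) X (h.jField Y) x
    - h.bracketInner (h.jField X) (h.jField Y) Z x + h.bracketInner (h.jField X) (h.jField Z) Y x
    - h.bracketInner (h.jField Y) (h.jField Z) X x

variable (h) in
/-- Twice `g(∇_X Y, Z)` for the Bismut connection `∇`, by the Koszul formula. -/
noncomputable def koszul (Y X Z : Π x : M, TangentSpace 𝓘(ℝ, E) x) (x : M) : ℝ :=
  h.derivInner X Y Z x + h.derivInner Y X Z x - h.derivInner Z X Y x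
    + h.bracketInner X Y Z x - h.bracketInner X Z Y x - h.bracketInner Y Z X x
    + h.bismutForm X Y Z x

/-- The derivatives of f along Y and Z cancel between the metric and the bracket terms. Those along
JY and JZ cancel inside `bismutForm`, because J is skew for g. -/
lemma koszul_tensorial_left (hY : MDiffAt (T% Y) x) (hZ : MDiffAt (T% Z) x) :
    TensorialAt 𝓘(ℝ, E) E (V := (TangentSpace 𝓘(ℝ, E) : M → Type _)) (h.koszul Y · Z x) x where
  smul {f X} hf hX := by
    have hJY := mdiffAt_jField (h := h) hY
    have hJZ := mdiffAt_jField (h := h) hZ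
    have hJX := mdiffAt_jField (h := h) hX
    simp only [koszul, bismutForm, jField_smul, derivInner_smul_left, derivInner_smul_mid hf hX hZ,
      derivInner_smul_mid hf hX hY, derivInner_smul_mid hf hX hJZ, derivInner_smul_mid hf hX hJY,
      bracketInner_smul_left hf hX, bracketInner_smul_left hf hJX, bracketInner_smul_right,
      smul_eq_mul]
    simp only [jField, inner_J_left]
    ring
  add {X X'} hX hX' := by
    have hJY := mdiffAt_jField (h := h) hY
    have hJZ := mdiffAt_jField (h := h) hZ
    have hJX := mdiffAt_jField (h := h) hX
    have hJX' := mdiffAt_jField (h := h) hX'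
    simp only [koszul, bismutForm, jField_add, derivInner_add_left, derivInner_add_mid hX hX' hZ,
      derivInner_add_mid hX hX' hY, derivInner_add_mid hX hX' hJZ, derivInner_add_mid hX hX' hJY,
      bracketInner_add_left hX hX', bracketInner_add_left hJX hJX', bracketInner_add_right]
    ring

lemma koszul_tensorial_right (hX : MDiffAt (T% X) x) (hY : MDiffAt (T% Y) x) :
    TensorialAt 𝓘(ℝ, E) E (V := (TangentSpace 𝓘(ℝ, E) : M → Type _)) (h.koszul Y X · x) x where
  smul {f Z} hf hZ := by
    have hJY := mdiffAt_jField (h := h) hY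
    have hJZ := mdiffAt_jField (h := h) hZ
    have hJX := mdiffAt_jField (h := h) hX
    simp only [koszul, bismutForm, jField_smul, derivInner_smul_left,
      derivInner_smul_right hf hZ hX,
      derivInner_smul_right hf hZ hY, derivInner_smul_right hf hJZ hX,
      derivInner_smul_right hf hJZ hY,
      bracketInner_smul_mid hf hZ, bracketInner_smul_mid hf hJZ, bracketInner_smul_right,
      smul_eq_mul]
    simp only [jField]
    rw [h.metric.symm x (h.J x (Z x)) (Y x), h.metric.symm x (h.J x (Z x)) (X x),
      h.metric.symm x (Z x) (Y x), h.metric.symm x (Z x) (X x)]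
    ring
  add {Z Z'} hZ hZ' := by
    have hJY := mdiffAt_jField (h := h) hY
    have hJZ := mdiffAt_jField (h := h) hZ
    have hJX := mdiffAt_jField (h := h) hX
    have hJZ' := mdiffAt_jField (h := h) hZ'
    simp only [koszul, bismutForm, jField_add, derivInner_add_left, derivInner_add_right hZ hZ' hX,
      derivInner_add_right hZ hZ' hY, derivInner_add_right hJZ hJZ' hX,
      derivInner_add_right hJZ hJZ' hY,
      bracketInner_add_mid hZ hZ', bracketInner_add_mid hJZ hJZ', bracketInner_add_right]
    ring

lemma koszul_add (hX : MDiffAt (T% X) x) (hY : MDiffAt (T% Y) x) (hY' : MDiffAt (T% Y') x)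
    (hZ : MDiffAt (T% Z) x) :
    h.koszul (Y + Y') X Z x = h.koszul Y X Z x + h.koszul Y' X Z x := by
  have hJY := mdiffAt_jField (h := h) hY
  have hJZ := mdiffAt_jField (h := h) hZ
  have hJX := mdiffAt_jField (h := h) hX
  have hJY' := mdiffAt_jField (h := h) hY'
  simp only [koszul, bismutForm, jField_add, derivInner_add_left, derivInner_add_right hY hY' hX,
    derivInner_add_mid hY hY' hZ, derivInner_add_right hJY hJY' hX,
    derivInner_add_mid hY hY' hJZ, bracketInner_add_left hY hY', bracketInner_add_left hJY hJY',
    bracketInner_add_mid hY hY', bracketInner_add_mid hJY hJY', bracketInner_add_right]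
  ring

/-- The derivatives of f along Z, JX and JZ cancel. The derivative along X survives twice, from X
g(Y,Z) and from g([X,Y],Z); this is the Leibniz rule in the normalization 2 g(∇_X Y, Z). -/
lemma koszul_smul (hf : MDiffAt f x) (hX : MDiffAt (T% X) x) (hY : MDiffAt (T% Y) x)
    (hZ : MDiffAt (T% Z) x) :
    h.koszul (f • Y) X Z x = f x * h.koszul Y X Z x
      + 2 * (mvfderiv 𝓘(ℝ, E) f x (X x) * h.metric.inner x (Y x) (Z x)) := by
  have hJY := mdiffAt_jField (h := h) hY
  have hJZ := mdiffAt_jField (h := h) hZ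
  have hJX := mdiffAt_jField (h := h) hX
  simp only [koszul, bismutForm, jField_smul, derivInner_smul_left, derivInner_smul_right hf hY hX,
    derivInner_smul_mid hf hY hZ, derivInner_smul_right hf hJY hX,
    derivInner_smul_mid hf hY hJZ, bracketInner_smul_left hf hY, bracketInner_smul_left hf hJY,
    bracketInner_smul_mid hf hY, bracketInner_smul_mid hf hJY, bracketInner_smul_right]
  simp only [jField, inner_J_left]
  rw [h.metric.symm x (Y x) (X x), h.metric.symm x (X x) (h.J x (Y x)), inner_J_left]
  ring

/-- Metric compatibility of the connection: the torsion term is skew in Y and Z and disappears from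
the symmetrization. -/
lemma koszul_metric :
    h.koszul Y X Z x + h.koszul Z X Y x = 2 * h.derivInner X Y Z x := by
  simp only [koszul, bismutForm]
  rw [derivInner_symm (X := h.jField X) (Y := Z), derivInner_jField_mid, bracketInner_swap (X := Z),
    derivInner_symm (X := X) (Y := Z), bracketInner_swap (X := h.jField Z),
    derivInner_symm (X := Y), derivInner_symm (X := Z)]
  rw [derivInner_symm (X := Y) (Y := Z), derivInner_symm (X := Z) (Y := Y)]
  ring

lemma koszul_torsion :
    h.koszul Y X Z x - h.koszul X Y Z x - 2 * h.bracketInner X Y Z x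
      = 2 * h.bismutForm X Y Z x := by
  simp only [koszul, bismutForm]
  rw [derivInner_symm (X := Z) (Y := Y), bracketInner_swap (X := Y) (Y := X),
    bracketInner_swap (X := h.jField Y) (Y := h.jField X),
    derivInner_symm (X := h.jField Z) (Y := Y),
    derivInner_jField_mid]
  ring

lemma bismutForm_swap_right : h.bismutForm X Y Z x = - h.bismutForm X Z Y x := by
  simp only [bismutForm]
  rw [bracketInner_swap (X := h.jField Z) (Y := h.jField Y),
    derivInner_symm (X := h.jField X) (Y := Z), derivInner_jField_mid]
  ring

/-- The integrability identity paired with JZ; since g is J-invariant, the term J(…) is then paired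
with Z itself. -/
lemma nijenhuis_inner (hX : MDiffAt (T% X) x) (hY : MDiffAt (T% Y) x) :
    h.bracketInner (h.jField X) (h.jField Y) (h.jField Z) x - h.bracketInner X Y (h.jField Z) x
      - h.bracketInner (h.jField X) Y Z x - h.bracketInner X (h.jField Y) Z x = 0 := by
  have := congrArg (fun v ↦ h.metric.inner x v (h.J x (Z x))) (h.integrable X Y x hX hY)
  simp only [map_sub, map_zero, sub_apply, zero_apply,
    h.hermitian, map_add, add_apply] at this
  simp only [bracketInner, jField]
  simp only [← sub_sub] at this
  exact this

/-- This is ∇J = 0, since J is skew. The derivatives of the metric cancel by J-invariance; the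
brackets cancel by the Nijenhuis identities for (X,Y) against Z and for (X,Z) against Y. Only here
does the connection need integrability. -/
lemma koszul_jField (hX : MDiffAt (T% X) x) (hY : MDiffAt (T% Y) x) (hZ : MDiffAt (T% Z) x) :
    h.koszul (h.jField Y) X Z x + h.koszul Y X (h.jField Z) x = 0 := by
  have hJY := mdiffAt_jField (h := h) hY
  have hJZ := mdiffAt_jField (h := h) hZ
  have n1 := nijenhuis_inner (h := h) (Z := Z) hX hY
  have n2 := nijenhuis_inner (h := h) (Z := Y) hX hZ
  simp only [koszul, bismutForm, jField_jField, derivInner_neg_left, derivInner_neg_right,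
    bracketInner_neg_mid hY, bracketInner_neg_mid hZ, bracketInner_neg_left hY,
    derivInner_jField_mid (Y := Y)]
  linarith

end HermitianStructure

end Bismut

/-! ### Smoothness of bundle maps and of derivatives of families -/

section Smoothness

variable {EB : Type*} [NormedAddCommGroup EB] [NormedSpace ℝ EB]
  {HB : Type*} [TopologicalSpace HB] {IB : ModelWithCorners ℝ EB HB}
  {B : Type*} [TopologicalSpace B] [ChartedSpace HB B]
  {F : Type*} [NormedAddCommGroup F] [NormedSpace ℝ F]
  {F' : Type*} [NormedAddCommGroup F'] [NormedSpace ℝ F'] {n : ℕ∞ω}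

lemma contMDiffAt_clm_of_apply [FiniteDimensional ℝ F] {f : B → F →L[ℝ] F'} {x : B}
    (hf : ∀ v, ContMDiffAt IB 𝓘(ℝ, F') n (fun y ↦ f y v) x) :
    ContMDiffAt IB 𝓘(ℝ, F →L[ℝ] F') n f x := by
  let b := Module.finBasis ℝ F
  have key : f = fun y ↦ ∑ i, (ContinuousLinearMap.smulRightL ℝ F F'
      (LinearMap.toContinuousLinearMap (b.coord i))) (f y (b i)) := by
    ext y v
    conv_lhs => rw [← b.sum_repr v, map_sum]
    simp
  rw [key]
  refine contMDiffAt_finsetSum fun i _ ↦ ?_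
  exact (ContinuousLinearMap.contMDiff _).contMDiffAt.comp x (hf (b i))

lemma contMDiffAt_symm_trivializationAt {V : B → Type*} [TopologicalSpace (TotalSpace F V)]
    [∀ x, TopologicalSpace (V x)] [∀ x, AddCommGroup (V x)] [∀ x, Module ℝ (V x)]
    [FiberBundle F V] [VectorBundle ℝ F V] [ContMDiffVectorBundle n F V IB] (x : B) (w : F) :
    ContMDiffAt IB (IB.prod 𝓘(ℝ, F)) n
      (fun y ↦ TotalSpace.mk' F y ((trivializationAt F V x).symm y w)) x := by
  have := FiberBundle.contMDiffAt_extend (I := IB) (k := n) F ((trivializationAt F V x).symm x w)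
  simpa [FiberBundle.extend, FiberBundle.mem_baseSet_trivializationAt' x] using this

/-- The test sections are constant in the trivialization at `x`, so the hypothesis says that the
coordinate expression of `A` is smooth when evaluated at each vector; in finite dimension this
suffices. -/
lemma contMDiffAt_hom_of_apply {V V' : B → Type*} [TopologicalSpace (TotalSpace F V)]
    [∀ x, TopologicalSpace (V x)] [∀ x, AddCommGroup (V x)] [∀ x, Module ℝ (V x)]
    [FiberBundle F V] [VectorBundle ℝ F V]
    [TopologicalSpace (TotalSpace F' V')]
    [∀ x, TopologicalSpace (V' x)] [∀ x, AddCommGroup (V' x)] [∀ x, Module ℝ (V' x)]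
    [∀ x, IsTopologicalAddGroup (V' x)] [∀ x, ContinuousSMul ℝ (V' x)]
    [FiberBundle F' V'] [VectorBundle ℝ F' V'] [FiniteDimensional ℝ F]
    {A : Π x, V x →L[ℝ] V' x} {x : B}
    (hA : ∀ w : F, ContMDiffAt IB (IB.prod 𝓘(ℝ, F')) n
      (fun y ↦ TotalSpace.mk' F' y (A y ((trivializationAt F V x).symm y w))) x) :
    ContMDiffAt IB (IB.prod 𝓘(ℝ, F →L[ℝ] F')) n
      (fun y ↦ TotalSpace.mk' (F →L[ℝ] F') (E := fun y ↦ V y →L[ℝ] V' y) y (A y)) x := by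
  rw [contMDiffAt_hom_bundle]
  refine ⟨contMDiffAt_id, contMDiffAt_clm_of_apply fun w ↦ ?_⟩
  have h1 := (contMDiffAt_section x).1 (hA w)
  refine h1.congr_of_eventuallyEq ?_
  filter_upwards [(trivializationAt F V x).open_baseSet.mem_nhds
      (FiberBundle.mem_baseSet_trivializationAt' x),
    (trivializationAt F' V' x).open_baseSet.mem_nhds
      (FiberBundle.mem_baseSet_trivializationAt' x)] with y hy hy'
  rw [ContinuousLinearMap.inCoordinates_eq hy hy']
  simp

variable [IsManifold IB 1 B] {E : Type*} [NormedAddCommGroup E] [NormedSpace ℝ E]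
  {M : Type*} [TopologicalSpace M] [ChartedSpace E M] [IsManifold 𝓘(ℝ, E) ∞ M]
  {E' : Type*} [NormedAddCommGroup E'] [NormedSpace ℝ E']
  {M' : Type*} [TopologicalSpace M'] [ChartedSpace E' M'] [IsManifold 𝓘(ℝ, E') ∞ M']

/-- The derivative of a family of maps along a section is smooth. -/
lemma contMDiffAt_mfderiv_family {b : B → M} {f : B → M → M'} {x : B}
    {X : Π y, TangentSpace 𝓘(ℝ, E) (b y)}
    (hf : ContMDiffAt (IB.prod 𝓘(ℝ, E)) 𝓘(ℝ, E') ∞ (Function.uncurry f) (x, b x))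
    (hX : ContMDiffAt IB 𝓘(ℝ, E).tangent ∞ (fun y ↦ TotalSpace.mk' E (b y) (X y)) x) :
    ContMDiffAt IB 𝓘(ℝ, E').tangent ∞ (fun y ↦ TotalSpace.mk' E' (f y (b y))
      (mfderiv 𝓘(ℝ, E) 𝓘(ℝ, E') (f y) (b y) (X y))) x := by
  have hb : ContMDiffAt IB 𝓘(ℝ, E) ∞ b x := by
    simp only [contMDiffAt_totalSpace] at hX
    exact hX.1
  have h1 := ContMDiffAt.mfderiv (m := ∞) f b hf hb (by simp)
  refine ContMDiffAt.clm_apply_of_inCoordinates (b₂ := fun y ↦ f y (b y)) h1 hX ?_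
  exact hf.comp x (contMDiffAt_id.prodMk hb)

lemma contMDiffAt_mfderiv_apply {b : B → M} {f : M → M'} {x : B}
    {X : Π y, TangentSpace 𝓘(ℝ, E) (b y)}
    (hf : ContMDiffAt 𝓘(ℝ, E) 𝓘(ℝ, E') ∞ f (b x))
    (hX : ContMDiffAt IB 𝓘(ℝ, E).tangent ∞ (fun y ↦ TotalSpace.mk' E (b y) (X y)) x) :
    ContMDiffAt IB 𝓘(ℝ, E').tangent ∞ (fun y ↦ TotalSpace.mk' E' (f (b y))
      (mfderiv 𝓘(ℝ, E) 𝓘(ℝ, E') f (b y) (X y))) x :=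
  contMDiffAt_mfderiv_family (f := fun _ ↦ f) (hf.comp (x, b x) contMDiffAt_snd) hX

lemma contMDiffAt_snd_of_tangent {b : B → F} {X : B → F} {x : B}
    (hX : ContMDiffAt IB 𝓘(ℝ, F).tangent n (fun y ↦ (TotalSpace.mk' F (b y) (X y) :
      TangentBundle 𝓘(ℝ, F) F)) x) :
    ContMDiffAt IB 𝓘(ℝ, F) n X x := by
  simp only [contMDiffAt_totalSpace] at hX
  simpa using hX.2

lemma contMDiffAt_mvfderiv_apply {b : B → M} {f : M → F} {x : B}
    {X : Π y, TangentSpace 𝓘(ℝ, E) (b y)}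
    (hf : ContMDiffAt 𝓘(ℝ, E) 𝓘(ℝ, F) ∞ f (b x))
    (hX : ContMDiffAt IB 𝓘(ℝ, E).tangent ∞ (fun y ↦ TotalSpace.mk' E (b y) (X y)) x) :
    ContMDiffAt IB 𝓘(ℝ, F) ∞ (fun y ↦ mvfderiv 𝓘(ℝ, E) f (b y) (X y)) x :=
  contMDiffAt_snd_of_tangent (contMDiffAt_mfderiv_apply hf hX)

end Smoothness

/-! ### Existence and uniqueness of the KT connection -/

section BismutConnection

open VectorField

variable {E : Type*} [NormedAddCommGroup E] [NormedSpace ℝ E] [FiniteDimensional ℝ E]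
  {M : Type*} [TopologicalSpace M] [ChartedSpace E M] [IsManifold 𝓘(ℝ, E) ∞ M]

namespace HermitianStructure

variable (h : HermitianStructure E M)

lemma inner_injective (x : M) : Function.Injective (h.metric.inner x) := by
  refine (injective_iff_map_eq_zero _).2 fun v hv ↦ ?_
  by_contra hne
  have := h.metric.pos x v hne
  rw [hv] at this
  simp at this

/-- The isomorphism `T_x M → T_x^* M` given by the metric. -/
noncomputable def flat (x : M) :
    TangentSpace 𝓘(ℝ, E) x ≃L[ℝ] (TangentSpace 𝓘(ℝ, E) x →L[ℝ] ℝ) :=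
  haveI : FiniteDimensional ℝ (TangentSpace 𝓘(ℝ, E) x) := inferInstanceAs (FiniteDimensional ℝ E)
  haveI : T2Space (TangentSpace 𝓘(ℝ, E) x) := inferInstanceAs (T2Space E)
  LinearEquiv.toContinuousLinearEquiv (LinearMap.linearEquivOfInjective
    (h.metric.inner x : TangentSpace 𝓘(ℝ, E) x →ₗ[ℝ] (TangentSpace 𝓘(ℝ, E) x →L[ℝ] ℝ))
    (h.inner_injective x)
    (by
      exact (Subspace.dual_finrank_eq (K := ℝ) (V := E)).symm.trans
        (LinearMap.toContinuousLinearMap (𝕜 := ℝ) (E := E) (F' := ℝ)).finrank_eq))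

lemma inner_flat_symm (x : M) (φ : TangentSpace 𝓘(ℝ, E) x →L[ℝ] ℝ) (w : TangentSpace 𝓘(ℝ, E) x) :
    h.metric.inner x ((h.flat x).symm φ) w = φ w := by
  have : h.flat x ((h.flat x).symm φ) = φ := (h.flat x).apply_symm_apply φ
  conv_rhs => rw [← this]
  rfl

variable {h} in
lemma eq_of_inner_eq {x : M} {v v' : TangentSpace 𝓘(ℝ, E) x}
    (H : ∀ w, h.metric.inner x v w = h.metric.inner x v' w) : v = v' :=
  h.inner_injective x (ContinuousLinearMap.ext H)

/-- A vector field is smooth if its inner products with smooth fields are. -/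
lemma contMDiffAt_of_inner {V : Π x : M, TangentSpace 𝓘(ℝ, E) x} {x : M}
    (hV : ∀ w : E, ContMDiffAt 𝓘(ℝ, E) 𝓘(ℝ, ℝ) ∞ (fun y ↦ (h.metric.inner y (V y)
      ((trivializationAt E (TangentSpace 𝓘(ℝ, E)) x).symm y w) : ℝ)) x) :
    CMDiffAt ∞ (T% V) x := by
  haveI : CompleteSpace E := FiniteDimensional.complete ℝ E
  let e := trivializationAt E (TangentSpace 𝓘(ℝ, E) : M → Type _) x
  have hx : x ∈ e.baseSet := FiberBundle.mem_baseSet_trivializationAt' x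
  -- The Gram operator of the metric in the trivialization at `x`. In coordinates `V` is the inverse
  -- of `G` applied to the functional `φ` below, and inversion is smooth at an invertible operator.
  let G : M → E →L[ℝ] (E →L[ℝ] ℝ) := fun y ↦
    ((ContinuousLinearMap.precomp ℝ (e.symmL ℝ y)) ∘L (h.metric.inner y)) ∘L (e.symmL ℝ y)
  have hG : ContMDiffAt 𝓘(ℝ, E) 𝓘(ℝ, E →L[ℝ] (E →L[ℝ] ℝ)) ∞ G x := by
    refine contMDiffAt_clm_of_apply fun v ↦ contMDiffAt_clm_of_apply fun w ↦ ?_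
    refine (h.contMDiffAt_inner (b := id) le_rfl (contMDiffAt_symm_trivializationAt x v)
      (contMDiffAt_symm_trivializationAt x w)).congr_of_eventuallyEq ?_
    filter_upwards [e.open_baseSet.mem_nhds hx] with y hy
    simp [G, e, e.symmL_apply hy]
  let φ : M → E →L[ℝ] ℝ := fun y ↦ h.metric.inner y (V y) ∘L (e.symmL ℝ y)
  have hφ : ContMDiffAt 𝓘(ℝ, E) 𝓘(ℝ, E →L[ℝ] ℝ) ∞ φ x :=
    contMDiffAt_clm_of_apply fun w ↦ (hV w).congr_of_eventuallyEq (by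
      filter_upwards [e.open_baseSet.mem_nhds hx] with y hy
      simp [φ, e, e.symmL_apply hy])
  have hinv : ∀ y ∈ e.baseSet, ∃ G' : E ≃L[ℝ] (E →L[ℝ] ℝ), (G' : E →L[ℝ] (E →L[ℝ] ℝ)) = G y := by
    intro y hy
    have hinj : Function.Injective (G y) := by
      refine (injective_iff_map_eq_zero _).2 fun v hv ↦ ?_
      have h1 : e.symmL ℝ y v = 0 := by
        by_contra hne
        have := h.metric.pos y _ hne
        have h2 := congrArg (fun ψ : E →L[ℝ] ℝ ↦ ψ v) hv
        exact this.ne' h2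
      have := congrArg (e.continuousLinearMapAt ℝ y) h1
      rwa [Trivialization.continuousLinearMapAt_symmL (R := ℝ) e hy, map_zero] at this
    refine ⟨LinearEquiv.toContinuousLinearEquiv (LinearMap.linearEquivOfInjective
      (G y : E →ₗ[ℝ] (E →L[ℝ] ℝ)) hinj ?_), by ext; rfl⟩
    rw [← (LinearMap.toContinuousLinearMap (𝕜 := ℝ) (E := E) (F' := ℝ)).finrank_eq]
    exact (Subspace.dual_finrank_eq (K := ℝ) (V := E)).symm
  refine (contMDiffAt_section x).2 ?_
  have hGi : ContMDiffAt 𝓘(ℝ, E) 𝓘(ℝ, (E →L[ℝ] ℝ) →L[ℝ] E) ∞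
      (fun y ↦ ContinuousLinearMap.inverse (G y)) x := by
    obtain ⟨G', hG'⟩ := hinv x hx
    have h1 := contDiffAt_map_inverse (n := ∞) G'
    rw [hG'] at h1
    exact h1.contMDiffAt.comp x hG
  refine (hGi.clm_apply hφ).congr_of_eventuallyEq ?_
  filter_upwards [e.open_baseSet.mem_nhds hx] with y hy
  obtain ⟨G', hG'⟩ := hinv y hy
  rw [← hG', ContinuousLinearMap.inverse_equiv]
  refine (G'.symm_apply_eq.2 ?_).symm
  ext w
  have h2 : G' (e ⟨y, V y⟩).2 = G y (e ⟨y, V y⟩).2 := by rw [← hG']; rfl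
  rw [h2]
  have h3 : e.symmL ℝ y (e ⟨y, V y⟩).2 = V y := by
    have := Trivialization.symmL_continuousLinearMapAt (R := ℝ) e hy (V y)
    rwa [Trivialization.continuousLinearMapAt_apply_of_mem (R := ℝ) e hy] at this
  change h.metric.inner y (V y) _ = h.metric.inner y (e.symmL ℝ y (e ⟨y, V y⟩).2) _
  rw [h3]

/-- The vector fields extending a tangent vector are differentiable. -/
lemma mdiffAt_extend {x : M} (v : TangentSpace 𝓘(ℝ, E) x) :
    MDiffAt (T% (FiberBundle.extend E v)) x :=
  FiberBundle.mdifferentiableAt_extend ..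

open Classical in
/-- The bilinear form `(X, Z) ↦ 2 g(∇_X Y, Z)` for the Bismut connection `∇`. -/
noncomputable def koszulForm (Y : Π x : M, TangentSpace 𝓘(ℝ, E) x) (x : M) :
    TangentSpace 𝓘(ℝ, E) x →L[ℝ] TangentSpace 𝓘(ℝ, E) x →L[ℝ] ℝ :=
  if hY : MDiffAt (T% Y) x then
    TensorialAt.mkHom₂ (fun X Z ↦ h.koszul Y X Z x) x
      (fun _ hZ ↦ koszul_tensorial_left hY hZ) (fun _ hX ↦ koszul_tensorial_right hX hY)
  -- A conventional value: the laws of a connection are only required at points where the field is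
  -- differentiable.
  else 0

variable {h} {X Y Y' Z : Π x : M, TangentSpace 𝓘(ℝ, E) x} {f : M → ℝ} {x : M}

lemma koszulForm_apply (hX : MDiffAt (T% X) x) (hY : MDiffAt (T% Y) x) (hZ : MDiffAt (T% Z) x) :
    h.koszulForm Y x (X x) (Z x) = h.koszul Y X Z x := by
  rw [koszulForm, dif_pos hY]
  exact TensorialAt.mkHom₂_apply (Φ := fun X Z ↦ h.koszul Y X Z x)
    (fun _ hZ ↦ koszul_tensorial_left hY hZ) (fun _ hX ↦ koszul_tensorial_right hX hY) hX hZ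

variable (h) in
/-- The Bismut connection of a Hermitian manifold, as a function on vector fields. -/
noncomputable def bismutFun (Y : Π x : M, TangentSpace 𝓘(ℝ, E) x) (x : M) :
    TangentSpace 𝓘(ℝ, E) x →L[ℝ] TangentSpace 𝓘(ℝ, E) x :=
  (2⁻¹ : ℝ) • ((h.flat x).symm : _ →L[ℝ] _) ∘L (h.koszulForm Y x)

lemma two_mul_inner_bismutFun_apply (u w : TangentSpace 𝓘(ℝ, E) x) :
    2 * h.metric.inner x (h.bismutFun Y x u) w = h.koszulForm Y x u w := by
  simp only [bismutFun, smul_apply, map_smul, ContinuousLinearMap.comp_apply, smul_eq_mul]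
  erw [h.inner_flat_symm]
  ring

lemma two_mul_inner_bismutFun (hX : MDiffAt (T% X) x) (hY : MDiffAt (T% Y) x)
    (hZ : MDiffAt (T% Z) x) :
    2 * h.metric.inner x (h.bismutFun Y x (X x)) (Z x) = h.koszul Y X Z x := by
  rw [two_mul_inner_bismutFun_apply, koszulForm_apply hX hY hZ]

lemma eq_of_two_mul_inner_eq {v v' : TangentSpace 𝓘(ℝ, E) x}
    (H : ∀ Z : Π x : M, TangentSpace 𝓘(ℝ, E) x, MDiffAt (T% Z) x →
      2 * h.metric.inner x v (Z x) = 2 * h.metric.inner x v' (Z x)) : v = v' := by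
  refine eq_of_inner_eq (h := h) fun w ↦ ?_
  have := H _ (mdiffAt_extend w)
  rw [FiberBundle.extend_apply_self] at this
  linarith

variable (h) in
/-- The Bismut connection of a Hermitian manifold. -/
noncomputable def bismut :
    CovariantDerivative 𝓘(ℝ, E) E (TangentSpace 𝓘(ℝ, E) : M → Type _) where
  toFun := h.bismutFun
  isCovariantDerivativeOnUniv := {
    add := fun {Y Y' x} hY hY' _ ↦ by
      ext u
      refine eq_of_two_mul_inner_eq (h := h) fun Z hZ ↦ ?_
      obtain ⟨X, hX, rfl⟩ : ∃ X : Π x : M, TangentSpace 𝓘(ℝ, E) x, MDiffAt (T% X) x ∧ X x = u :=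
        ⟨_, mdiffAt_extend u, FiberBundle.extend_apply_self ..⟩
      simp only [add_apply, map_add, mul_add]
      rw [two_mul_inner_bismutFun hX hY hZ, two_mul_inner_bismutFun hX hY' hZ,
        two_mul_inner_bismutFun hX (mdifferentiableAt_add_section hY hY') hZ,
        koszul_add hX hY hY' hZ]
    leibniz := fun {Y f x} hY hf _ ↦ by
      ext u
      refine eq_of_two_mul_inner_eq (h := h) fun Z hZ ↦ ?_
      obtain ⟨X, hX, rfl⟩ : ∃ X : Π x : M, TangentSpace 𝓘(ℝ, E) x, MDiffAt (T% X) x ∧ X x = u :=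
        ⟨_, mdiffAt_extend u, FiberBundle.extend_apply_self ..⟩
      rw [two_mul_inner_bismutFun hX (hf.smul_section hY) hZ, koszul_smul hf hX hY hZ]
      simp only [add_apply, map_add, mul_add, smul_apply, map_smul,
        ContinuousLinearMap.smulRight_apply, smul_eq_mul]
      rw [← two_mul_inner_bismutFun hX hY hZ]
      ring }

lemma two_mul_inner_bismut (hX : MDiffAt (T% X) x) (hY : MDiffAt (T% Y) x)
    (hZ : MDiffAt (T% Z) x) :
    2 * h.metric.inner x (h.bismut Y x (X x)) (Z x) = h.koszul Y X Z x :=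
  two_mul_inner_bismutFun hX hY hZ

lemma two_mul_inner_torsion_bismut [CompleteSpace E] (hX : MDiffAt (T% X) x)
    (hY : MDiffAt (T% Y) x) (hZ : MDiffAt (T% Z) x) :
    h.metric.inner x (h.bismut.torsion x (X x) (Y x)) (Z x) = h.bismutForm X Y Z x := by
  rw [CovariantDerivative.torsion_apply _ hX hY]
  have h1 := two_mul_inner_bismut (h := h) hX hY hZ
  have h2 := two_mul_inner_bismut (h := h) hY hX hZ
  have h3 := koszul_torsion (h := h) (X := X) (Y := Y) (Z := Z) (x := x)
  simp only [map_sub, sub_apply]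
  rw [bracketInner] at h3
  linarith

lemma contMDiffAt_derivInner (hX : CMDiffAt ∞ (T% X) x) (hY : CMDiffAt ∞ (T% Y) x)
    (hZ : CMDiffAt ∞ (T% Z) x) :
    ContMDiffAt 𝓘(ℝ, E) 𝓘(ℝ, ℝ) ∞ (h.derivInner X Y Z) x :=
  contMDiffAt_mvfderiv_apply (b := id) (h.contMDiffAt_inner (b := id) le_rfl hY hZ) hX

lemma contMDiffAt_bracketInner (hX : CMDiffAt ∞ (T% X) x) (hY : CMDiffAt ∞ (T% Y) x)
    (hZ : CMDiffAt ∞ (T% Z) x) :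
    ContMDiffAt 𝓘(ℝ, E) 𝓘(ℝ, ℝ) ∞ (h.bracketInner X Y Z) x := by
  haveI : CompleteSpace E := FiniteDimensional.complete ℝ E
  haveI : IsManifold 𝓘(ℝ, E) (((⊤ : ℕ∞) : ℕ∞ω) + 1) M := by simpa using ‹IsManifold 𝓘(ℝ, E) ∞ M›
  haveI : IsManifold 𝓘(ℝ, E) (minSmoothness ℝ 2) M := by simp; infer_instance
  exact h.contMDiffAt_inner (b := id) le_rfl
    (ContMDiffAt.mlieBracket_vectorField (m := ⊤) (n := ⊤) hX hY (by simp)) hZ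

lemma contMDiffAt_koszul (hX : CMDiffAt ∞ (T% X) x) (hY : CMDiffAt ∞ (T% Y) x)
    (hZ : CMDiffAt ∞ (T% Z) x) :
    ContMDiffAt 𝓘(ℝ, E) 𝓘(ℝ, ℝ) ∞ (h.koszul Y X Z) x := by
  have hJX : CMDiffAt ∞ (T% (h.jField X)) x := h.contMDiffAt_J (b := id) le_rfl hX
  have hJY : CMDiffAt ∞ (T% (h.jField Y)) x := h.contMDiffAt_J (b := id) le_rfl hY
  have hJZ : CMDiffAt ∞ (T% (h.jField Z)) x := h.contMDiffAt_J (b := id) le_rfl hZ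
  exact ((((((contMDiffAt_derivInner hX hY hZ).add (contMDiffAt_derivInner hY hX hZ)).sub
    (contMDiffAt_derivInner hZ hX hY)).add (contMDiffAt_bracketInner hX hY hZ)).sub
    (contMDiffAt_bracketInner hX hZ hY)).sub (contMDiffAt_bracketInner hY hZ hX)).add
    ((((((contMDiffAt_derivInner hJX hY hJZ).neg.add (contMDiffAt_derivInner hJY hX hJZ)).sub
    (contMDiffAt_derivInner hJZ hX hJY)).sub (contMDiffAt_bracketInner hJX hJY hZ)).add
    (contMDiffAt_bracketInner hJX hJZ hY)).sub (contMDiffAt_bracketInner hJY hJZ hX))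

lemma contMDiffAt_bismut (hY : ∀ᶠ y in 𝓝 x, CMDiffAt ∞ (T% Y) y) :
    ContMDiffAt 𝓘(ℝ, E) (𝓘(ℝ, E).prod 𝓘(ℝ, E →L[ℝ] E)) ∞ (fun y ↦ TotalSpace.mk' (E →L[ℝ] E)
      (E := fun y : M ↦ TangentSpace 𝓘(ℝ, E) y →L[ℝ] TangentSpace 𝓘(ℝ, E) y) y
      (h.bismut Y y)) x := by
  have hs : ∀ w : E, ∀ᶠ y in 𝓝 x, MDiffAt (T% (fun y ↦ (trivializationAt E
      (TangentSpace 𝓘(ℝ, E) : M → Type _) x).symm y w)) y := fun w ↦ by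
    have h1 : CMDiffAt 1 (T% (fun y ↦ (trivializationAt E
      (TangentSpace 𝓘(ℝ, E) : M → Type _) x).symm y w)) x := contMDiffAt_symm_trivializationAt x w
    filter_upwards [(contMDiffAt_iff_contMDiffAt_nhds (by simp)).1 h1] with y hy
    exact hy.mdifferentiableAt (by simp)
  refine contMDiffAt_hom_of_apply fun v ↦ h.contMDiffAt_of_inner fun w ↦ ?_
  refine ((contMDiffAt_const (c := (2⁻¹ : ℝ))).mul (contMDiffAt_koszul (h := h)
    (contMDiffAt_symm_trivializationAt x v) hY.self_of_nhds
    (contMDiffAt_symm_trivializationAt x w))).congr_of_eventuallyEq ?_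
  filter_upwards [hs v, hs w, hY] with y hv hw hy
  change _ = (2⁻¹ : ℝ) * h.koszul Y _ _ y
  rw [← two_mul_inner_bismut hv (hy.mdifferentiableAt (by simp)) hw]
  simp

variable (h) in
/-- The Bismut connection is a KT connection. -/
theorem isKTConnection_bismut : IsKTConnection h h.bismut where
  smooth := ⟨⟨fun {Y} hY x _ ↦ (contMDiffAt_bismut (Filter.Eventually.of_forall fun y ↦
    (by simpa using! (hY y (Set.mem_univ y)).contMDiffAt Filter.univ_mem))).contMDiffWithinAt⟩⟩
  metric_parallel Y Z x hY hZ u := by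
    obtain ⟨X, hX, rfl⟩ : ∃ X : Π x : M, TangentSpace 𝓘(ℝ, E) x, MDiffAt (T% X) x ∧ X x = u :=
      ⟨_, mdiffAt_extend u, FiberBundle.extend_apply_self ..⟩
    have h1 := koszul_metric (h := h) (X := X) (Y := Y) (Z := Z) (x := x)
    rw [← two_mul_inner_bismut hX hY hZ, ← two_mul_inner_bismut hX hZ hY] at h1
    refine Eq.trans ?_ (congrArg _ (h.metric.symm x _ _))
    change h.derivInner X Y Z x = (h.metric.inner x (h.bismut Y x (X x)) (Z x) : ℝ)
      + (h.metric.inner x (h.bismut Z x (X x)) (Y x) : ℝ)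
    linarith
  complex_parallel Y x hY u := by
    obtain ⟨X, hX, rfl⟩ : ∃ X : Π x : M, TangentSpace 𝓘(ℝ, E) x, MDiffAt (T% X) x ∧ X x = u :=
      ⟨_, mdiffAt_extend u, FiberBundle.extend_apply_self ..⟩
    refine eq_of_two_mul_inner_eq (h := h) fun Z hZ ↦ ?_
    have h1 := koszul_jField (h := h) hX hY hZ
    rw [← two_mul_inner_bismut hX (mdiffAt_jField hY) hZ,
      ← two_mul_inner_bismut hX hY (mdiffAt_jField hZ)] at h1
    rw [inner_J_left]
    change 2 * h.metric.inner x (h.bismut (h.jField Y) x (X x)) (Z x) =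
      2 * -(h.metric.inner x (h.bismut Y x (X x)) (h.jField Z x))
    linarith
  torsion_skew_left x u v w := by
    haveI : CompleteSpace E := FiniteDimensional.complete ℝ E
    rw [CovariantDerivative.torsion_antisymm]; simp
  torsion_skew_right x u v w := by
    haveI : CompleteSpace E := FiniteDimensional.complete ℝ E
    have h1 := two_mul_inner_torsion_bismut (h := h) (mdiffAt_extend u) (mdiffAt_extend v)
      (mdiffAt_extend w)
    have h2 := two_mul_inner_torsion_bismut (h := h) (mdiffAt_extend u) (mdiffAt_extend w)
      (mdiffAt_extend v)
    simp only [FiberBundle.extend_apply_self] at h1 h2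
    rw [h1, h2, bismutForm_swap_right]

/-- Two KT connections of the same Hermitian structure agree. -/
theorem sameConnection_of_isKTConnection
    {cov cov' : CovariantDerivative 𝓘(ℝ, E) E (TangentSpace 𝓘(ℝ, E) : M → Type _)}
    (hc : IsKTConnection h cov) (hc' : IsKTConnection h cov') : SameConnection cov cov' := by
  intro Y x hY
  haveI : CompleteSpace E := FiniteDimensional.complete ℝ E
  -- The difference tensor, with the direction of differentiation as its first argument.
  let A : TangentSpace 𝓘(ℝ, E) x → TangentSpace 𝓘(ℝ, E) x → TangentSpace 𝓘(ℝ, E) x :=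
    fun u v ↦ cov.difference cov' x v u
  have hA : ∀ (Y : Π x : M, TangentSpace 𝓘(ℝ, E) x) (u : TangentSpace 𝓘(ℝ, E) x),
      MDiffAt (T% Y) x → A u (Y x) = cov Y x u - cov' Y x u := by
    intro Y u hY
    change cov.isCovariantDerivativeOnUniv.difference cov'.isCovariantDerivativeOnUniv x (Y x) u = _
    rw [IsCovariantDerivativeOn.difference_apply _ _ (Set.mem_univ x) hY]
    rfl
  let a : TangentSpace 𝓘(ℝ, E) x → TangentSpace 𝓘(ℝ, E) x → TangentSpace 𝓘(ℝ, E) x → ℝ :=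
    fun u v w ↦ h.metric.inner x (A u v) w
  have ext : ∀ u : TangentSpace 𝓘(ℝ, E) x, ∃ X : Π x : M, TangentSpace 𝓘(ℝ, E) x,
      MDiffAt (T% X) x ∧ X x = u := fun u ↦
    ⟨_, mdiffAt_extend u, FiberBundle.extend_apply_self ..⟩
  have a23 : ∀ u v w, a u v w = - a u w v := by
    intro u v w
    obtain ⟨Y, hY, rfl⟩ := ext v
    obtain ⟨Z, hZ, rfl⟩ := ext w
    have h1 : mvfderiv 𝓘(ℝ, E) (fun y ↦ (h.metric.inner y (Y y) (Z y) : ℝ)) x u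
        = h.metric.inner x (cov Y x u) (Z x) + h.metric.inner x (Y x) (cov Z x u) :=
      hc.metric_parallel Y Z x hY hZ u
    have h2 : mvfderiv 𝓘(ℝ, E) (fun y ↦ (h.metric.inner y (Y y) (Z y) : ℝ)) x u
        = h.metric.inner x (cov' Y x u) (Z x) + h.metric.inner x (Y x) (cov' Z x u) :=
      hc'.metric_parallel Y Z x hY hZ u
    simp only [a]
    rw [hA Y u hY, hA Z u hZ, map_sub, map_sub, sub_apply, sub_apply,
      h.metric.symm x (cov Z x u), h.metric.symm x (cov' Z x u)]
    have h3 := h1.symm.trans h2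
    linarith
  have aJ : ∀ u v w, a u (h.J x v) w = - a u v (h.J x w) := by
    intro u v w
    obtain ⟨Y, hY, rfl⟩ := ext v
    have h1 := hc.complex_parallel Y x hY u
    have h2 := hc'.complex_parallel Y x hY u
    have h3 := hA (h.jField Y) u (mdiffAt_jField hY)
    have h4 : A u (h.J x (Y x)) = h.J x (A u (Y x)) := by
      rw [hA Y u hY, map_sub, ← h1, ← h2]
      exact h3
    simp only [a]
    rw [h4, inner_J_left]
  have tor : ∀ u v, A u v - A v u = cov.torsion x u v - cov'.torsion x u v := by
    intro u v
    obtain ⟨X, hX, rfl⟩ := ext u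
    obtain ⟨Y, hY, rfl⟩ := ext v
    rw [CovariantDerivative.torsion_apply _ hX hY, CovariantDerivative.torsion_apply _ hX hY,
      hA Y _ hY, hA X _ hX]
    abel
  -- The left side is the difference of the two torsions, hence skew in its last two arguments.
  have t23 : ∀ u v w, a u v w - a v u w = - (a u w v - a w u v) := by
    intro u v w
    simp only [a]
    rw [← sub_apply, ← map_sub, ← sub_apply, ← map_sub, tor, tor, map_sub, map_sub, sub_apply,
      sub_apply, hc.torsion_skew_right, hc'.torsion_skew_right]
    ring
  -- Two of the four terms of `t23` cancel by `a23`. Skewness in (1,3) and (2,3) makes `a` totally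
  -- skew.
  have a13 : ∀ u v w, a u v w = - a w v u := by
    intro u v w
    have := t23 v u w
    have h2 := a23 v u w
    linarith
  have a12 : ∀ u v w, a u v w = - a v u w := by
    intro u v w
    linarith [a13 u v w, a23 w v u, a13 v u w]
  -- J moves from the second slot to the third, then to the first, then back to the second. Each
  -- move changes the sign, and three sign changes give a = -a.
  have key : ∀ u v w, a u (h.J x v) w = 0 := by
    intro u v w
    have e1 := aJ u v w
    have e2 : a u v (h.J x w) = - a (h.J x u) v w := by
      have := aJ v u w
      have h2 := a12 v (h.J x u) w
      have h3 := a12 v u (h.J x w)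
      linarith
    have e3 : a (h.J x u) v w = - a u (h.J x v) w := by
      have := aJ w u v
      have h2 := a13 (h.J x u) v w
      have h3 := a23 w v (h.J x u)
      have h4 := a23 w (h.J x v) u
      have h5 := a13 u (h.J x v) w
      linarith
    linarith
  ext u
  have : A u (Y x) = 0 := by
    refine eq_of_inner_eq (h := h) fun w ↦ ?_
    have := key u (-(h.J x (Y x))) w
    rw [map_neg, h.J_J, neg_neg] at this
    simpa using this
  rw [hA Y u hY] at this
  exact sub_eq_zero.1 this

end HermitianStructure
end BismutConnection

/-! ### Brackets of related vector fields -/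

section Related

variable {E : Type*} [NormedAddCommGroup E] [NormedSpace ℝ E]
  {E' : Type*} [NormedAddCommGroup E'] [NormedSpace ℝ E']

/-- The relation Dg(W) = Y ∘ g differentiated in the direction V. The term D²g(V, W) is symmetric,
so it drops out of the commutator; `g` need not be locally invertible. -/
lemma fderiv_apply_of_related {g : E → E'} {V W : E → E} {X Y : E' → E'} {x : E}
    (hg : ContDiffAt ℝ 2 g x) (hW : DifferentiableAt ℝ W x) (hY : DifferentiableAt ℝ Y (g x))
    (hVX : fderiv ℝ g x (V x) = X (g x))
    (hWY : ∀ᶠ y in 𝓝 x, fderiv ℝ g y (W y) = Y (g y)) :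
    fderiv ℝ (fderiv ℝ g) x (V x) (W x) + fderiv ℝ g x (fderiv ℝ W x (V x))
      = fderiv ℝ Y (g x) (X (g x)) := by
  have hg1 : DifferentiableAt ℝ (fderiv ℝ g) x :=
    (hg.fderiv_right (m := 1) (by norm_num)).differentiableAt (by simp)
  have hg0 : DifferentiableAt ℝ g x := hg.differentiableAt (by simp)
  have h1 := (hg1.hasFDerivAt.clm_apply hW.hasFDerivAt).fderiv
  have h2 : fderiv ℝ (fun y ↦ fderiv ℝ g y (W y)) x = fderiv ℝ (fun y ↦ Y (g y)) x :=
    Filter.EventuallyEq.fderiv_eq hWY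
  have h3 : fderiv ℝ (fun y ↦ Y (g y)) x = (fderiv ℝ Y (g x)).comp (fderiv ℝ g x) :=
    fderiv_comp x hY hg0
  have h4 := congrArg (fun A : E →L[ℝ] E' ↦ A (V x)) (h1.symm.trans (h2.trans h3))
  simp only [add_apply, ContinuousLinearMap.comp_apply, ContinuousLinearMap.flip_apply, hVX] at h4
  rw [← h4, add_comm]

lemma fderiv_lieBracket_of_related {g : E → E'} {V W : E → E} {X Y : E' → E'} {x : E}
    (hg : ContDiffAt ℝ 2 g x) (hV : DifferentiableAt ℝ V x) (hW : DifferentiableAt ℝ W x)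
    (hX : DifferentiableAt ℝ X (g x)) (hY : DifferentiableAt ℝ Y (g x))
    (hVX : ∀ᶠ y in 𝓝 x, fderiv ℝ g y (V y) = X (g y))
    (hWY : ∀ᶠ y in 𝓝 x, fderiv ℝ g y (W y) = Y (g y)) :
    fderiv ℝ g x (VectorField.lieBracket ℝ V W x) = VectorField.lieBracket ℝ X Y (g x) := by
  have h1 := fderiv_apply_of_related hg hW hY hVX.self_of_nhds hWY
  have h2 := fderiv_apply_of_related hg hV hX hWY.self_of_nhds hVX
  have hs : IsSymmSndFDerivAt ℝ g x := hg.isSymmSndFDerivAt (by simp)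
  simp only [VectorField.lieBracket_eq, map_sub]
  rw [← h1, ← h2, hs (W x) (V x)]
  abel

variable [CompleteSpace E] [CompleteSpace E']
  {M : Type*} [TopologicalSpace M] [ChartedSpace E M] [IsManifold 𝓘(ℝ, E) ∞ M]
  {M' : Type*} [TopologicalSpace M'] [ChartedSpace E' M'] [IsManifold 𝓘(ℝ, E') ∞ M']

/-- A vector field read in the extended chart at `x`. -/
noncomputable def chartField (x : M) (V : Π y : M, TangentSpace 𝓘(ℝ, E) y) (z : E) : E :=
  mfderiv 𝓘(ℝ, E) 𝓘(ℝ, E) (extChartAt 𝓘(ℝ, E) x) ((extChartAt 𝓘(ℝ, E) x).symm z)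
    (V ((extChartAt 𝓘(ℝ, E) x).symm z))

lemma chartField_eventuallyEq (x : M) (V : Π y : M, TangentSpace 𝓘(ℝ, E) y) :
    VectorField.mpullbackWithin 𝓘(ℝ, E) 𝓘(ℝ, E) (extChartAt 𝓘(ℝ, E) x).symm V
      (Set.range 𝓘(ℝ, E)) =ᶠ[𝓝 (extChartAt 𝓘(ℝ, E) x x)] chartField x V := by
  filter_upwards [extChartAt_target_mem_nhds x] with z hz
  rw [VectorField.mpullbackWithin_apply, chartField,
    ContinuousLinearMap.inverse_eq (mfderivWithin_extChartAt_symm_comp_mfderiv_extChartAt hz)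
      (mfderiv_extChartAt_comp_mfderivWithin_extChartAt_symm hz)]
  rfl

/-- The preferred chart at `x` has the identity as its derivative at `x`, so pulling the Euclidean
bracket back leaves no extra factor. -/
lemma mlieBracket_eq_lieBracket_chartField (V W : Π y : M, TangentSpace 𝓘(ℝ, E) y) (x : M) :
    VectorField.mlieBracket 𝓘(ℝ, E) V W x
      = VectorField.lieBracket ℝ (chartField x V) (chartField x W) (extChartAt 𝓘(ℝ, E) x x) := by
  have h0 := VectorField.mlieBracketWithin_apply (I := 𝓘(ℝ, E)) (V := V) (W := W)
    (s := Set.univ) (x₀ := x)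
  rw [mfderiv_extChartAt_self] at h0
  have hid : ∀ v : E, (ContinuousLinearMap.id ℝ E).inverse v = v := fun v ↦ by
    rw [ContinuousLinearMap.inverse_id]; rfl
  refine h0.trans ((hid _).trans ?_)
  have hs : (extChartAt 𝓘(ℝ, E) x).symm ⁻¹' Set.univ ∩ Set.range 𝓘(ℝ, E) = (Set.univ : Set E) := by
    simp
  rw [hs]
  refine Eq.trans (b := VectorField.lieBracket ℝ (V := (VectorField.mpullbackWithin 𝓘(ℝ, E) 𝓘(ℝ, E)
    (extChartAt 𝓘(ℝ, E) x).symm V (Set.range 𝓘(ℝ, E)) : E → E)) (W := (VectorField.mpullbackWithin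
    𝓘(ℝ, E) 𝓘(ℝ, E) (extChartAt 𝓘(ℝ, E) x).symm W (Set.range 𝓘(ℝ, E)) : E → E)) _)
    (congrFun (VectorField.lieBracketWithin_univ (𝕜 := ℝ) (E := E)) _) ?_
  exact Filter.EventuallyEq.lieBracket_vectorField_eq (chartField_eventuallyEq x V)
    (chartField_eventuallyEq x W)

lemma differentiableAt_chartField {V : Π y : M, TangentSpace 𝓘(ℝ, E) y} {x : M}
    (hV : MDiffAt (T% V) x) :
    DifferentiableAt ℝ (chartField x V) (extChartAt 𝓘(ℝ, E) x x) := by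
  have h := (mdifferentiableWithinAt_univ.2 hV).differentiableWithinAt_mpullbackWithin_vectorField
  have hs : (extChartAt 𝓘(ℝ, E) x).symm ⁻¹' Set.univ ∩ Set.range 𝓘(ℝ, E) = (Set.univ : Set E) := by
    simp
  rw [hs] at h
  exact (differentiableWithinAt_univ (f := chartField x V)).1
    (h.congr_of_eventuallyEq_of_mem (by simpa using (chartField_eventuallyEq x V).symm) trivial)

lemma fderiv_chartField_of_related {f : M → M'} {x : M} (hf : CMDiffAt 2 f x)
    {V : Π y : M, TangentSpace 𝓘(ℝ, E) y} {X : Π y : M', TangentSpace 𝓘(ℝ, E') y}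
    (h : ∀ᶠ y in 𝓝 x, mfderiv 𝓘(ℝ, E) 𝓘(ℝ, E') f y (V y) = X (f y)) :
    ∀ᶠ z in 𝓝 (extChartAt 𝓘(ℝ, E) x x),
      fderiv ℝ (writtenInExtChartAt 𝓘(ℝ, E) 𝓘(ℝ, E') x f) z (chartField x V z)
        = chartField (f x) X (writtenInExtChartAt 𝓘(ℝ, E) 𝓘(ℝ, E') x f z) := by
  have hev : ∀ᶠ y in 𝓝 x, CMDiffAt 2 f y ∧ y ∈ (extChartAt 𝓘(ℝ, E) x).source ∧
      f y ∈ (extChartAt 𝓘(ℝ, E') (f x)).source := by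
    filter_upwards [(contMDiffAt_iff_contMDiffAt_nhds (by simp)).1 hf,
      extChartAt_source_mem_nhds (I := 𝓘(ℝ, E)) x,
      hf.continuousAt (extChartAt_source_mem_nhds (I := 𝓘(ℝ, E')) (f x))] with y h1 h2 h3
    exact ⟨h1, h2, h3⟩
  have hc : Filter.Tendsto (extChartAt 𝓘(ℝ, E) x).symm (𝓝 (extChartAt 𝓘(ℝ, E) x x)) (𝓝 x) := by
    simpa [ContinuousAt] using continuousAt_extChartAt_symm (I := 𝓘(ℝ, E)) x
  filter_upwards [hc.eventually hev, hc.eventually h, extChartAt_target_mem_nhds x]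
    with z ⟨h1, h2, h3⟩ h4 h5
  have hs : MDifferentiableAt 𝓘(ℝ, E) 𝓘(ℝ, E) (extChartAt 𝓘(ℝ, E) x).symm z := by
    have := mdifferentiableWithinAt_extChartAt_symm (I := 𝓘(ℝ, E)) h5
    simpa [mdifferentiableWithinAt_univ] using this
  have ht : MDifferentiableAt 𝓘(ℝ, E') 𝓘(ℝ, E') (extChartAt 𝓘(ℝ, E') (f x))
      (f ((extChartAt 𝓘(ℝ, E) x).symm z)) :=
    mdifferentiableAt_extChartAt (by simpa using h3)
  have hm := h1.mdifferentiableAt (by simp)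
  have key : mfderiv 𝓘(ℝ, E) 𝓘(ℝ, E') (writtenInExtChartAt 𝓘(ℝ, E) 𝓘(ℝ, E') x f) z
      = (mfderiv 𝓘(ℝ, E') 𝓘(ℝ, E') (extChartAt 𝓘(ℝ, E') (f x))
        (f ((extChartAt 𝓘(ℝ, E) x).symm z))).comp
        ((mfderiv 𝓘(ℝ, E) 𝓘(ℝ, E') f ((extChartAt 𝓘(ℝ, E) x).symm z)).comp
          (mfderiv 𝓘(ℝ, E) 𝓘(ℝ, E) (extChartAt 𝓘(ℝ, E) x).symm z)) := by
    unfold writtenInExtChartAt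
    rw [mfderiv_comp z ht (hm.comp z hs), mfderiv_comp z hm hs]
    rfl
  have hid := mfderivWithin_extChartAt_symm_comp_mfderiv_extChartAt (I := 𝓘(ℝ, E)) h5
  rw [show (Set.range 𝓘(ℝ, E) : Set E) = Set.univ by simp, mfderivWithin_univ] at hid
  have hid' := congrArg (fun A ↦ A (V ((extChartAt 𝓘(ℝ, E) x).symm z))) hid
  rw [← mfderiv_eq_fderiv, key]
  have e : (extChartAt 𝓘(ℝ, E') (f x)).symm (writtenInExtChartAt 𝓘(ℝ, E) 𝓘(ℝ, E') x f z)
      = f ((extChartAt 𝓘(ℝ, E) x).symm z) := by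
    simpa [writtenInExtChartAt] using (extChartAt 𝓘(ℝ, E') (f x)).left_inv h3
  unfold chartField
  rw [e, ← h4]
  exact congrArg (fun v ↦ mfderiv 𝓘(ℝ, E') 𝓘(ℝ, E') (extChartAt 𝓘(ℝ, E') (f x))
    (f ((extChartAt 𝓘(ℝ, E) x).symm z))
    (mfderiv 𝓘(ℝ, E) 𝓘(ℝ, E') f ((extChartAt 𝓘(ℝ, E) x).symm z) v)) hid'

/-- Brackets of related vector fields are related. -/
theorem mfderiv_mlieBracket_of_related {f : M → M'} {x : M} (hf : CMDiffAt 2 f x)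
    {V W : Π y : M, TangentSpace 𝓘(ℝ, E) y} {X Y : Π y : M', TangentSpace 𝓘(ℝ, E') y}
    (hV : MDiffAt (T% V) x) (hW : MDiffAt (T% W) x)
    (hX : MDiffAt (T% X) (f x)) (hY : MDiffAt (T% Y) (f x))
    (hVX : ∀ᶠ y in 𝓝 x, mfderiv 𝓘(ℝ, E) 𝓘(ℝ, E') f y (V y) = X (f y))
    (hWY : ∀ᶠ y in 𝓝 x, mfderiv 𝓘(ℝ, E) 𝓘(ℝ, E') f y (W y) = Y (f y)) :
    mfderiv 𝓘(ℝ, E) 𝓘(ℝ, E') f x (VectorField.mlieBracket 𝓘(ℝ, E) V W x)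
      = VectorField.mlieBracket 𝓘(ℝ, E') X Y (f x) := by
  have hg : ContDiffAt ℝ 2 (writtenInExtChartAt 𝓘(ℝ, E) 𝓘(ℝ, E') x f)
      (extChartAt 𝓘(ℝ, E) x x) := by
    have := (contMDiffAt_iff.1 hf).2
    rw [← contDiffWithinAt_univ]
    simpa [writtenInExtChartAt] using this
  have e : writtenInExtChartAt 𝓘(ℝ, E) 𝓘(ℝ, E') x f (extChartAt 𝓘(ℝ, E) x x)
      = extChartAt 𝓘(ℝ, E') (f x) (f x) := by simp [writtenInExtChartAt]
  have key := fderiv_lieBracket_of_related hg (differentiableAt_chartField hV)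
    (differentiableAt_chartField hW) (by rw [e]; exact differentiableAt_chartField hX)
    (by rw [e]; exact differentiableAt_chartField hY)
    (fderiv_chartField_of_related hf hVX) (fderiv_chartField_of_related hf hWY)
  rw [e, ← mlieBracket_eq_lieBracket_chartField, ← mlieBracket_eq_lieBracket_chartField] at key
  rw [← key, (hf.mdifferentiableAt (by simp)).mfderiv]
  simp only [modelWithCornersSelf_coe, Set.range_id, fderivWithin_univ]
  rfl

end Related

/-! ### Smooth charts and the inverse function theorem -/

section SmoothChart

variable {E : Type*} [NormedAddCommGroup E] [NormedSpace ℝ E]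
  {M : Type*} [TopologicalSpace M] [ChartedSpace E M]
  {W : Type*} [NormedAddCommGroup W] [NormedSpace ℝ W]
  {W' : Type*} [NormedAddCommGroup W'] [NormedSpace ℝ W']

variable (E) in
/-- An open partial homeomorphism to a normed space that is smooth in both directions. -/
structure IsSmoothChart (Θ : OpenPartialHomeomorph M W) : Prop where
  contMDiffOn : ContMDiffOn 𝓘(ℝ, E) 𝓘(ℝ, W) ∞ Θ Θ.source
  contMDiffOn_symm : ContMDiffOn 𝓘(ℝ, W) 𝓘(ℝ, E) ∞ Θ.symm Θ.target

namespace IsSmoothChart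

variable {Θ : OpenPartialHomeomorph M W}

lemma contMDiffAt (h : IsSmoothChart E Θ) {x : M} (hx : x ∈ Θ.source) :
    ContMDiffAt 𝓘(ℝ, E) 𝓘(ℝ, W) ∞ Θ x :=
  h.contMDiffOn.contMDiffAt (Θ.open_source.mem_nhds hx)

lemma contMDiffAt_symm (h : IsSmoothChart E Θ) {w : W} (hw : w ∈ Θ.target) :
    ContMDiffAt 𝓘(ℝ, W) 𝓘(ℝ, E) ∞ Θ.symm w :=
  h.contMDiffOn_symm.contMDiffAt (Θ.open_target.mem_nhds hw)

lemma trans (h : IsSmoothChart E Θ) {Φ : OpenPartialHomeomorph W W'}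
    (h' : IsSmoothChart W Φ) : IsSmoothChart E (Θ.trans Φ) where
  contMDiffOn := fun x hx ↦ by
    rw [Θ.trans_source] at hx
    exact ((h'.contMDiffAt hx.2).comp x (h.contMDiffAt hx.1)).contMDiffWithinAt
  contMDiffOn_symm := fun w hw ↦ by
    rw [Θ.trans_target] at hw
    exact ((h.contMDiffAt_symm hw.2).comp w (h'.contMDiffAt_symm hw.1)).contMDiffWithinAt

lemma symm {Φ : OpenPartialHomeomorph W W'} (h : IsSmoothChart W Φ) : IsSmoothChart W' Φ.symm where
  contMDiffOn := h.contMDiffOn_symm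
  contMDiffOn_symm := by simpa using h.contMDiffOn

lemma restr (h : IsSmoothChart E Θ) (s : Set M) : IsSmoothChart E (Θ.restr s) where
  contMDiffOn := h.contMDiffOn.mono (by simp)
  contMDiffOn_symm := h.contMDiffOn_symm.mono (by simp [OpenPartialHomeomorph.restr])

end IsSmoothChart

lemma isSmoothChart_chartAt [IsManifold 𝓘(ℝ, E) ∞ M] (p : M) : IsSmoothChart E (chartAt E p) where
  contMDiffOn := contMDiffOn_chart
  contMDiffOn_symm := contMDiffOn_chart_symm

variable [CompleteSpace W]

lemma exists_isSmoothChart_of_contDiffOn {f : W → W'} {a : W} {S : Set W} (hS : IsOpen S)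
    (ha : a ∈ S) (hf : ContDiffOn ℝ ∞ f S) (f' : W ≃L[ℝ] W')
    (hf' : HasFDerivAt f (f' : W →L[ℝ] W') a) :
    ∃ Φ : OpenPartialHomeomorph W W', IsSmoothChart W Φ ∧ a ∈ Φ.source ∧ Φ.source ⊆ S ∧ ⇑Φ = f := by
  have hS' : ∀ x ∈ S, ContDiffAt ℝ ∞ f x := fun x hx ↦ hf.contDiffAt (hS.mem_nhds hx)
  have h1 : ContinuousAt (fderiv ℝ f) a :=
    ((hS' a ha).fderiv_right (m := 0) (by simp)).continuousAt
  -- Invertibility of the derivative is an open condition. Shrinking to a set where it holds makes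
  -- the inverse smooth on the whole target and not only at the image of `a`.
  have h2 : ∀ᶠ x in 𝓝 a, ∃ g : W ≃L[ℝ] W', (g : W →L[ℝ] W') = fderiv ℝ f x := by
    refine h1.eventually (p := fun A ↦ ∃ g : W ≃L[ℝ] W', (g : W →L[ℝ] W') = A) ?_
    rw [hf'.fderiv]
    exact ContinuousLinearEquiv.nhds f'
  obtain ⟨U, hU, hUo, haU⟩ := eventually_nhds_iff.1 h2
  let Φ := (hS' a ha).toOpenPartialHomeomorph f hf' (by simp)
  have hsource : (Φ.restr (S ∩ U)).source = Φ.source ∩ (S ∩ U) := by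
    rw [Φ.restr_source, (hS.inter hUo).interior_eq]
  refine ⟨Φ.restr (S ∩ U), ⟨?_, ?_⟩, ?_, ?_, rfl⟩
  · rw [contMDiffOn_iff_contDiffOn, hsource]
    exact hf.mono fun x hx ↦ hx.2.1
  · rw [contMDiffOn_iff_contDiffOn]
    intro w hw
    have hx := (Φ.restr (S ∩ U)).map_target hw
    rw [hsource] at hx
    obtain ⟨g, hg⟩ := hU _ hx.2.2
    refine ((Φ.restr (S ∩ U)).contDiffAt_symm (f₀' := g) hw ?_ (hS' _ hx.2.1)).contDiffWithinAt
    rw [hg]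
    exact ((hS' _ hx.2.1).differentiableAt (by simp)).hasFDerivAt
  · rw [hsource]
    exact ⟨ContDiffAt.mem_toOpenPartialHomeomorph_source .., ha, haU⟩
  · rw [hsource]
    exact fun x hx ↦ hx.2.1

/-- The inverse function theorem for a map from a manifold to a normed space. -/
theorem exists_isSmoothChart_of_contMDiff [CompleteSpace E] [IsManifold 𝓘(ℝ, E) ∞ M]
    {f : M → W'} {p : M} {S : Set M} (hS : IsOpen S) (hp : p ∈ S)
    (hf : ContMDiffOn 𝓘(ℝ, E) 𝓘(ℝ, W') ∞ f S) (f' : E ≃L[ℝ] W')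
    (hf' : mfderiv 𝓘(ℝ, E) 𝓘(ℝ, W') f p = (f' : E →L[ℝ] W')) :
    ∃ Φ : OpenPartialHomeomorph M W', IsSmoothChart E Φ ∧ p ∈ Φ.source ∧
      Φ.source ⊆ S ∧ ∀ x ∈ Φ.source, Φ x = f x := by
  let c := chartAt E p
  let g : E → W' := f ∘ c.symm
  let S' : Set E := c.target ∩ c.symm ⁻¹' S
  have hS' : IsOpen S' := c.isOpen_inter_preimage_symm hS
  have hpc : p ∈ c.source := mem_chart_source E p
  have hS'p : c p ∈ S' := ⟨c.map_source hpc, by simpa [c.left_inv hpc] using hp⟩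
  have hg : ContDiffOn ℝ ∞ g S' := by
    rw [← contMDiffOn_iff_contDiffOn]
    exact hf.comp ((isSmoothChart_chartAt (E := E) p).contMDiffOn_symm.mono Set.inter_subset_left)
      Set.inter_subset_right
  have hg' : HasFDerivAt g (f' : E →L[ℝ] W') (c p) := by
    have h1 : MDifferentiableAt 𝓘(ℝ, E) 𝓘(ℝ, W') f p :=
      (hf.contMDiffAt (hS.mem_nhds hp)).mdifferentiableAt (by simp)
    have h2 := h1.mfderiv
    rw [hf'] at h2
    have h3 : writtenInExtChartAt 𝓘(ℝ, E) 𝓘(ℝ, W') p f = g := by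
      ext; simp [writtenInExtChartAt, g, c, chartAt_self_eq]
    rw [h3] at h2
    simp only [modelWithCornersSelf_coe, Set.range_id, fderivWithin_univ] at h2
    have h4 : (extChartAt 𝓘(ℝ, E) p) p = c p := by simp [c]
    rw [h4] at h2
    rw [h2]
    exact ((hg.contDiffAt (hS'.mem_nhds hS'p)).differentiableAt (by simp)).hasFDerivAt
  obtain ⟨Φ, hΦ, hcp, hsub, hΦg⟩ := exists_isSmoothChart_of_contDiffOn hS' hS'p hg f' hg'
  refine ⟨c.trans Φ, (isSmoothChart_chartAt (E := E) p).trans hΦ, ?_, ?_, ?_⟩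
  · rw [c.trans_source]
    exact ⟨hpc, hcp⟩
  · intro x hx
    rw [c.trans_source] at hx
    have := (hsub hx.2).2
    simpa [c.left_inv hx.1] using this
  · intro x hx
    rw [c.trans_source] at hx
    simp [hΦg, g, c.left_inv hx.1]

end SmoothChart

/-! ### The linear model of the moment map and the action at a point -/

section LinearSplitting

variable {E : Type*} [NormedAddCommGroup E] [NormedSpace ℝ E] [FiniteDimensional ℝ E]
  {EG : Type*} [NormedAddCommGroup EG] [NormedSpace ℝ EG] [FiniteDimensional ℝ EG]
  {F : Type*} [NormedAddCommGroup F] [NormedSpace ℝ F] [FiniteDimensional ℝ F]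

/-- The image of `κ` lies in the kernel of `D`, whose codimension is also dim EG. This is what makes
the subtraction in the dimension of `ReducedModel` a true one. -/
lemma two_mul_finrank_le {D : E →L[ℝ] F} (hD : Function.Surjective D) {κ : EG →L[ℝ] E}
    (hκ : Function.Injective κ) (hDκ : ∀ ξ, D (κ ξ) = 0)
    (hF : Module.finrank ℝ F = Module.finrank ℝ EG) :
    2 * Module.finrank ℝ EG ≤ Module.finrank ℝ E := by
  have h1 := LinearMap.finrank_range_add_finrank_ker (D : E →ₗ[ℝ] F)
  have h2 : Module.finrank ℝ EG ≤ Module.finrank ℝ (LinearMap.ker (D : E →ₗ[ℝ] F)) :=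
    LinearMap.finrank_le_finrank_of_injective
      (f := (κ : EG →ₗ[ℝ] E).codRestrict (LinearMap.ker (D : E →ₗ[ℝ] F)) (by simpa using hDκ))
      (fun x y hxy ↦ hκ (by simpa using congrArg Subtype.val hxy))
  rw [LinearMap.range_eq_top.2 hD, finrank_top] at h1
  omega

/-- For D = dν and κ the infinitesimal action at a point of `P`, this splits the tangent space into
normal, orbit and remaining directions. -/
lemma exists_equiv_of_surjective_of_injective {D : E →L[ℝ] F} (hD : Function.Surjective D)
    {κ : EG →L[ℝ] E} (hκ : Function.Injective κ) (hDκ : ∀ ξ, D (κ ξ) = 0)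
    (hF : Module.finrank ℝ F = Module.finrank ℝ EG) :
    ∃ A : E ≃L[ℝ] F × (EG × ReducedModel E EG),
      (∀ x, (A x).1 = D x) ∧ ∀ ξ, A (κ ξ) = (0, ξ, 0) := by
  obtain ⟨s, hs⟩ := (D : E →ₗ[ℝ] F).exists_rightInverse_of_surjective (LinearMap.range_eq_top.2 hD)
  have hs' : ∀ f, D (s f) = f := fun f ↦ LinearMap.congr_fun hs f
  let T : F × EG →ₗ[ℝ] E := s.coprod (κ : EG →ₗ[ℝ] E)
  have hT : Function.Injective T := by
    refine (injective_iff_map_eq_zero T).2 fun ⟨f, ξ⟩ h ↦ ?_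
    have h0 : s f + κ ξ = 0 := by simpa [T] using h
    have h1 : f = 0 := by simpa [hs', hDκ] using congrArg D h0
    subst h1
    have : ξ = 0 := hκ (by simpa using h0)
    rw [this]; rfl
  obtain ⟨C, hC⟩ := Submodule.exists_isCompl (LinearMap.range T)
  have hCd : Module.finrank ℝ C = Module.finrank ℝ (ReducedModel E EG) := by
    have h1 := Submodule.finrank_add_eq_of_isCompl hC
    rw [LinearMap.finrank_range_of_inj hT, Module.finrank_prod, hF] at h1
    rw [finrank_euclideanSpace_fin]
    omega
  let e : ReducedModel E EG ≃ₗ[ℝ] C := LinearEquiv.ofFinrankEq _ _ hCd.symm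
  let r : ReducedModel E EG →ₗ[ℝ] E := C.subtype ∘ₗ e.toLinearMap
  -- `r` identifies the reduced model with a complement of s(F) + κ(EG). Subtracting s(D(r v)) moves
  -- it into the kernel of `D`, so that `D` becomes the first coordinate.
  let B : F × (EG × ReducedModel E EG) →ₗ[ℝ] E :=
    s.coprod ((κ : EG →ₗ[ℝ] E).coprod (r - s ∘ₗ (D : E →ₗ[ℝ] F) ∘ₗ r))
  have hB : ∀ f ξ v, B (f, ξ, v) = s f + (κ ξ + (r v - s (D (r v)))) := fun f ξ v ↦ rfl
  have hDB : ∀ w, D (B w) = w.1 := fun ⟨f, ξ, v⟩ ↦ by simp [hB, hs', hDκ]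
  have hBi : Function.Injective B := by
    refine (injective_iff_map_eq_zero B).2 fun ⟨f, ξ, v⟩ h ↦ ?_
    obtain rfl : f = 0 := by simpa [h] using (hDB (f, ξ, v)).symm
    have h1 : r v = T (D (r v), -ξ) := by
      have h2 := hB 0 ξ v
      rw [h] at h2
      have h3 : T (D (r v), -ξ) = s (D (r v)) - κ ξ := by simp [T, sub_eq_add_neg]
      rw [h3, ← sub_eq_zero, h2]
      simp only [map_zero]
      abel
    have h2 : r v = 0 := by
      have : r v ∈ LinearMap.range T ⊓ C := ⟨h1 ▸ ⟨_, rfl⟩, (e v).2⟩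
      simpa [hC.inf_eq_bot] using this
    obtain rfl : v = 0 := by
      have : e v = 0 := Subtype.ext h2
      simpa using this
    have h4 := hT ((h1.symm.trans h2).trans T.map_zero.symm)
    obtain rfl : ξ = 0 := by simpa using congrArg Prod.snd h4
    rfl
  have hdim : Module.finrank ℝ (F × (EG × ReducedModel E EG)) = Module.finrank ℝ E := by
    have := two_mul_finrank_le hD hκ hDκ hF
    rw [Module.finrank_prod, Module.finrank_prod, hF, finrank_euclideanSpace_fin]
    omega
  let A : E ≃L[ℝ] F × (EG × ReducedModel E EG) :=
    (LinearEquiv.ofInjectiveOfFinrankEq B hBi hdim).symm.toContinuousLinearEquiv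
  have hAB : ∀ w, A (B w) = w := fun w ↦
    (LinearEquiv.ofInjectiveOfFinrankEq B hBi hdim).symm_apply_apply w
  have hBA : ∀ x, B (A x) = x := fun x ↦
    (LinearEquiv.ofInjectiveOfFinrankEq B hBi hdim).apply_symm_apply x
  refine ⟨A, fun x ↦ by rw [← hDB, hBA], fun ξ ↦ ?_⟩
  rw [← hAB (0, ξ, 0), hB]
  simp

end LinearSplitting

/-! ### Infinitesimal consequences of transversality -/

section MomentMap

variable {E : Type*} [NormedAddCommGroup E] [NormedSpace ℝ E] [FiniteDimensional ℝ E]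
  {M : Type*} [TopologicalSpace M] [ChartedSpace E M] [IsManifold 𝓘(ℝ, E) ∞ M]
  {EG : Type*} [NormedAddCommGroup EG] [NormedSpace ℝ EG] [FiniteDimensional ℝ EG]
  {G : Type*} [Group G] [TopologicalSpace G] [ChartedSpace EG G] [LieGroup 𝓘(ℝ, EG) ∞ G]
  [MulAction G M] [ContMDiffSMul 𝓘(ℝ, EG) 𝓘(ℝ, E) ∞ G M]

variable (G) in
lemma contMDiff_smul_pair : ContMDiff (𝓘(ℝ, EG).prod 𝓘(ℝ, E)) 𝓘(ℝ, E) ∞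
    (fun y : G × M ↦ y.1 • y.2) := contMDiff_smul

lemma contMDiff_smul_point (x : M) :
    ContMDiff 𝓘(ℝ, EG) 𝓘(ℝ, E) ∞ (fun a : G ↦ a • x) :=
  (contMDiff_smul_pair (E := E) (EG := EG) G).comp
    (contMDiff_id.prodMk contMDiff_const : ContMDiff 𝓘(ℝ, EG) (𝓘(ℝ, EG).prod 𝓘(ℝ, E)) ∞
      (fun a : G ↦ (a, x)))

include EG in
variable (EG) in
lemma contMDiff_const_smul_point (a : G) :
    ContMDiff 𝓘(ℝ, E) 𝓘(ℝ, E) ∞ (fun x : M ↦ a • x) :=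
  (contMDiff_smul_pair (E := E) (EG := EG) G).comp
    (contMDiff_const.prodMk contMDiff_id : ContMDiff 𝓘(ℝ, E) (𝓘(ℝ, EG).prod 𝓘(ℝ, E)) ∞
      (fun x : M ↦ (a, x)))

variable (G) in
/-- The infinitesimal action `ξ ↦ ξ_M(x)` as a linear map. -/
noncomputable def fundamentalMap (x : M) : EG →L[ℝ] TangentSpace 𝓘(ℝ, E) x :=
  mfderiv 𝓘(ℝ, EG) 𝓘(ℝ, E) (fun a : G ↦ a • x) (1 : G)

/-- The differential of the moment map as a linear map to `𝔤*`. -/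
noncomputable def momentDeriv (ν : M → (EG →L[ℝ] ℝ)) (x : M) :
    TangentSpace 𝓘(ℝ, E) x →L[ℝ] (EG →L[ℝ] ℝ) :=
  mfderiv 𝓘(ℝ, E) 𝓘(ℝ, EG →L[ℝ] ℝ) ν x

lemma finrank_dual_eq : Module.finrank ℝ (EG →L[ℝ] ℝ) = Module.finrank ℝ EG := by
  rw [← (LinearMap.toContinuousLinearMap (𝕜 := ℝ) (E := EG) (F' := ℝ)).finrank_eq]
  exact Subspace.dual_finrank_eq

namespace IsGMomentMap

variable {c : ComplexStructure E M} {ν : M → (EG →L[ℝ] ℝ)} (hν : IsGMomentMap G c ν)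
include hν

lemma injective_momentDeriv_J (x : M) :
    Function.Injective (fun ξ : EG ↦ momentDeriv ν x (c.J x (fundamentalMap G x ξ))) := by
  intro ξ η h
  by_contra hne
  refine hν.transversal x (ξ - η : EG) (fun h0 ↦ hne (sub_eq_zero.1 h0)) ?_
  have h1 : momentDeriv ν x (c.J x (fundamentalMap G x (ξ - η))) = 0 := by
    rw [map_sub, map_sub, map_sub]
    exact sub_eq_zero.2 h
  exact h1

/-- The isomorphism `ξ ↦ dν(J ξ_M(x))` from `𝔤` to `𝔤*`. -/
noncomputable def transversalEquiv (x : M) : EG ≃L[ℝ] (EG →L[ℝ] ℝ) :=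
  (LinearEquiv.ofInjectiveOfFinrankEq
    ((momentDeriv ν x ∘L c.J x ∘L fundamentalMap G x : EG →L[ℝ] (EG →L[ℝ] ℝ)) :
      EG →ₗ[ℝ] (EG →L[ℝ] ℝ)) (hν.injective_momentDeriv_J x)
      finrank_dual_eq.symm).toContinuousLinearEquiv

lemma transversalEquiv_apply (x : M) (ξ : EG) :
    hν.transversalEquiv x ξ = momentDeriv ν x (c.J x (fundamentalMap G x ξ)) := rfl

lemma injective_fundamentalMap (x : M) :
    Function.Injective (fundamentalMap (E := E) (EG := EG) G x) := fun ξ η h ↦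
  hν.injective_momentDeriv_J x (by simp only [h])

/-- The vectors J ξ_M(x) already map isomorphically onto 𝔤*. -/
lemma surjective_momentDeriv (x : M) : Function.Surjective (momentDeriv (E := E) ν x) := fun φ ↦
  ⟨_, (hν.transversalEquiv x).apply_symm_apply φ⟩

/-- The orbit of `p` stays in the level set, so ν is constant along it. -/
lemma momentDeriv_fundamentalMap {ζ : EG →L[ℝ] ℝ}
    (hinv : ∀ (a : G) (x : M), ν x = ζ → ν (a • x) = ζ) {p : M} (hp : ν p = ζ) (ξ : EG) :
    momentDeriv (E := E) ν p (fundamentalMap G p ξ) = 0 := by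
  have h1 : mfderiv 𝓘(ℝ, EG) 𝓘(ℝ, EG →L[ℝ] ℝ) (ν ∘ fun a : G ↦ a • p) 1
      = (mfderiv 𝓘(ℝ, E) 𝓘(ℝ, EG →L[ℝ] ℝ) ν ((1 : G) • p)).comp
        (mfderiv 𝓘(ℝ, EG) 𝓘(ℝ, E) (fun a : G ↦ a • p) 1) :=
    mfderiv_comp (1 : G) (hν.smooth.mdifferentiableAt (by simp))
      ((contMDiff_smul_point p).mdifferentiableAt (by simp))
  have h2 : (ν ∘ fun a : G ↦ a • p) = fun _ ↦ ζ := funext fun a ↦ hinv a p hp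
  rw [h2, mfderiv_const] at h1
  -- The chain rule gives the derivative at 1 • p; substitution moves it to `p`, every tangent space
  -- being the model space by definition.
  have h3 : ∀ q : M, q = p → ∀ v : E, (mfderiv 𝓘(ℝ, E) 𝓘(ℝ, EG →L[ℝ] ℝ) ν q : E →L[ℝ] _) v
      = (momentDeriv ν p : E →L[ℝ] _) v := by rintro q rfl v; rfl
  exact ((h3 _ (one_smul G p) _).symm.trans
    (congrArg (fun A : EG →L[ℝ] (EG →L[ℝ] ℝ) ↦ A ξ) h1).symm)

end IsGMomentMap

section AdaptedChart

variable [T2Space M] [CompactSpace G]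

/-- The function ν - ζ is completed by linear functions of a chart so that the derivative at `p` is
the linear splitting. The orbit directions are straightened only at `p`; `flowOut` does the rest. -/
lemma exists_flattening_chart {c : ComplexStructure E M} {ν : M → (EG →L[ℝ] ℝ)}
    (hν : IsGMomentMap G c ν) {ζ : EG →L[ℝ] ℝ}
    (hinv : ∀ (a : G) (x : M), ν x = ζ → ν (a • x) = ζ) {p : M} (hp : ν p = ζ) :
    ∃ Φ : OpenPartialHomeomorph M ((EG →L[ℝ] ℝ) × (EG × ReducedModel E EG)),
      IsSmoothChart E Φ ∧ p ∈ Φ.source ∧ Φ p = 0 ∧ (∀ x ∈ Φ.source, (Φ x).1 = ν x - ζ) ∧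
      ∀ ξ : EG, (mfderiv 𝓘(ℝ, E) 𝓘(ℝ, (EG →L[ℝ] ℝ) × (EG × ReducedModel E EG)) Φ p
        (fundamentalMap G p ξ) : (EG →L[ℝ] ℝ) × (EG × ReducedModel E EG)) = (0, ξ, 0) := by
  haveI : CompleteSpace E := FiniteDimensional.complete ℝ E
  obtain ⟨A, hA1, hA2⟩ := exists_equiv_of_surjective_of_injective (E := E) (EG := EG)
    (D := momentDeriv (E := E) ν p) (hν.surjective_momentDeriv p)
    (κ := fundamentalMap (E := E) G p) (hν.injective_fundamentalMap p)
    (hν.momentDeriv_fundamentalMap hinv hp) finrank_dual_eq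
  let φ : M → E := extChartAt 𝓘(ℝ, E) p
  let L : E →L[ℝ] EG × ReducedModel E EG :=
    (ContinuousLinearMap.snd ℝ (EG →L[ℝ] ℝ) (EG × ReducedModel E EG)) ∘L (A : E →L[ℝ] _)
  let f : M → (EG →L[ℝ] ℝ) × (EG × ReducedModel E EG) := fun x ↦ (ν x - ζ, L (φ x - φ p))
  have hφs : ContMDiffOn 𝓘(ℝ, E) 𝓘(ℝ, E) ∞ φ (chartAt E p).source := contMDiffOn_extChartAt
  have hf : ContMDiffOn 𝓘(ℝ, E) 𝓘(ℝ, (EG →L[ℝ] ℝ) × (EG × ReducedModel E EG)) ∞ f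
      (chartAt E p).source :=
    ContMDiffOn.prodMk_space (hν.smooth.contMDiffOn.sub contMDiffOn_const)
      (L.contMDiff.comp_contMDiffOn (hφs.sub contMDiffOn_const))
  have hφd : HasMFDerivAt 𝓘(ℝ, E) 𝓘(ℝ, E) φ p (ContinuousLinearMap.id ℝ E) := by
    have := (mdifferentiableAt_extChartAt (I := 𝓘(ℝ, E)) (mem_chart_source E p)).hasMFDerivAt
    rwa [mfderiv_extChartAt_self] at this
  have hfd : mfderiv 𝓘(ℝ, E) 𝓘(ℝ, (EG →L[ℝ] ℝ) × (EG × ReducedModel E EG)) f p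
      = (A : E →L[ℝ] (EG →L[ℝ] ℝ) × (EG × ReducedModel E EG)) := by
    have h1 : HasMFDerivAt 𝓘(ℝ, E) 𝓘(ℝ, EG →L[ℝ] ℝ) (fun x ↦ ν x - ζ) p (momentDeriv ν p) := by
      have h := (hν.smooth.mdifferentiableAt (x := p) (by simp)).hasMFDerivAt.sub
        (hasMFDerivAt_const ζ p)
      exact h.congr_mfderiv (sub_zero (momentDeriv ν p : E →L[ℝ] (EG →L[ℝ] ℝ)))
    have h2 : HasMFDerivAt 𝓘(ℝ, E) 𝓘(ℝ, EG × ReducedModel E EG) (fun x ↦ L (φ x - φ p)) p L := by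
      have h3 : HasFDerivAt (fun z ↦ L (z - φ p)) L (φ p) :=
        L.hasFDerivAt.comp (φ p) ((hasFDerivAt_id (φ p)).sub_const (φ p))
      exact h3.hasMFDerivAt.comp p hφd
    have h4 := ((ContinuousLinearMap.inl ℝ (EG →L[ℝ] ℝ) (EG × ReducedModel E EG)).hasMFDerivAt.comp
      p h1).add ((ContinuousLinearMap.inr ℝ (EG →L[ℝ] ℝ) (EG × ReducedModel E EG)).hasMFDerivAt.comp
      p h2)
    have h5 : f = (ContinuousLinearMap.inl ℝ (EG →L[ℝ] ℝ) (EG × ReducedModel E EG)) ∘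
        (fun x ↦ ν x - ζ) + (ContinuousLinearMap.inr ℝ (EG →L[ℝ] ℝ) (EG × ReducedModel E EG)) ∘
        (fun x ↦ L (φ x - φ p)) := by
      ext x <;> simp [f]
    rw [h5]
    refine h4.mfderiv.trans (ContinuousLinearMap.ext fun v ↦ Prod.ext ?_ ?_)
    · exact (add_zero _).trans (hA1 v).symm
    · exact zero_add _
  obtain ⟨Φ, hΦ, hpΦ, hsub, hΦf⟩ := exists_isSmoothChart_of_contMDiff (chartAt E p).open_source
    (mem_chart_source E p) hf A hfd
  refine ⟨Φ, hΦ, hpΦ, ?_, fun x hx ↦ by rw [hΦf x hx], fun ξ ↦ ?_⟩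
  · rw [hΦf p hpΦ]
    simp [f, hp]
  · have : Φ =ᶠ[𝓝 p] f := Filter.eventuallyEq_of_mem (Φ.open_source.mem_nhds hpΦ) hΦf
    rw [this.mfderiv_eq, hfd]
    exact hA2 ξ

end AdaptedChart
end MomentMap

/-! ### Adapted charts: slices for the free action on the level set -/

section AdaptedChart

variable {E : Type*} [NormedAddCommGroup E] [NormedSpace ℝ E]
  {M : Type*} [TopologicalSpace M] [ChartedSpace E M]
  {F U V : Type*} [NormedAddCommGroup F] [NormedSpace ℝ F] [NormedAddCommGroup U] [NormedSpace ℝ U]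
  [NormedAddCommGroup V] [NormedSpace ℝ V]
  {G : Type*} [Group G] [MulAction G M]

variable (E) in
/-- A smooth chart that is adapted to the invariant set `P`: in it `P` is the zero set of the first
coordinate, and two points of `P` are on the same orbit if and only if their third coordinates
agree. -/
structure IsAdaptedChart (P : SubMulAction G M) (Θ : OpenPartialHomeomorph M (F × (U × V))) : Prop
    extends IsSmoothChart E Θ where
  mem_iff : ∀ q ∈ Θ.source, q ∈ P ↔ (Θ q).1 = 0
  orbit_iff : ∀ q ∈ Θ.source, ∀ q' ∈ Θ.source, q ∈ P → q' ∈ P →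
    ((Θ q).2.2 = (Θ q').2.2 ↔ ∃ a : G, a • q = q')

end AdaptedChart

section Slice

variable {M : Type*} [TopologicalSpace M] [T2Space M]
  {G : Type*} [Group G] [TopologicalSpace G] [CompactSpace G] [MulAction G M] [ContinuousSMul G M]
  {V : Type*} [TopologicalSpace V] [Zero V]

/-- Near a point with trivial stabilizer, distinct points of a slice are on distinct orbits. -/
lemma eventually_eq_of_smul_eq {s : V → M} {p : M} (hs : ContinuousAt s 0) (hs0 : s 0 = p)
    (hfree : ∀ a : G, a • p = p → a = 1)
    (h1 : ∀ᶠ z in 𝓝 (((0, 0), 1) : (V × V) × G), z.2 • s z.1.1 = s z.1.2 → z.1.1 = z.1.2) :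
    ∀ᶠ v in 𝓝 ((0, 0) : V × V), ∀ a : G, a • s v.1 = s v.2 → v.1 = v.2 := by
  -- Since `G` is compact, it suffices to treat a neighbourhood of ((0,0), a) for each single `a`.
  -- The case a = 1 is the hypothesis; any other `a` moves `p`, hence separates nearby points of the
  -- slice from their images because `M` is Hausdorff.
  have := isCompact_univ (X := G).eventually_forall_of_forall_eventually (x₀ := ((0, 0) : V × V))
    (P := fun v a ↦ a • s v.1 = s v.2 → v.1 = v.2) fun a _ ↦ by
      by_cases ha : a = 1
      · exact ha ▸ h1
      · have h2 : a • p ≠ p := fun h ↦ ha (hfree a h)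
        have hc1 : ContinuousAt (fun z : (V × V) × G ↦ s z.1.1) ((0, 0), a) :=
          ContinuousAt.comp (f := fun z : (V × V) × G ↦ z.1.1) hs (by fun_prop)
        have hc2 : ContinuousAt (fun z : (V × V) × G ↦ s z.1.2) ((0, 0), a) :=
          ContinuousAt.comp (f := fun z : (V × V) × G ↦ z.1.2) hs (by fun_prop)
        have h3 : ∀ᶠ z in 𝓝 (((0, 0), a) : (V × V) × G), z.2 • s z.1.1 ≠ s z.1.2 :=
          ((continuousAt_snd.smul hc1).prodMk hc2).eventually_mem
            (isClosed_diagonal.isOpen_compl.mem_nhds (by simpa [hs0] using h2))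
        exact h3.mono fun z hz h ↦ absurd h hz
  simpa using this

end Slice

section Existence

variable {E : Type*} [NormedAddCommGroup E] [NormedSpace ℝ E] [FiniteDimensional ℝ E]
  {M : Type*} [TopologicalSpace M] [ChartedSpace E M] [IsManifold 𝓘(ℝ, E) ∞ M]
  {EG : Type*} [NormedAddCommGroup EG] [NormedSpace ℝ EG] [FiniteDimensional ℝ EG]
  {G : Type*} [Group G] [TopologicalSpace G] [ChartedSpace EG G] [LieGroup 𝓘(ℝ, EG) ∞ G]
  [MulAction G M] [ContMDiffSMul 𝓘(ℝ, EG) 𝓘(ℝ, E) ∞ G M]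
  {F V : Type*} [NormedAddCommGroup F] [NormedSpace ℝ F] [NormedAddCommGroup V] [NormedSpace ℝ V]
  [FiniteDimensional ℝ F] [FiniteDimensional ℝ V]

/-- The flow-out of a slice: from a chart `Φ` of `M` at `p` in which the fundamental fields at `p`
are the second coordinate directions, it produces a parametrization of `M` near `p` in which the
second coordinate parametrizes the action of `G`. -/
noncomputable def flowOut (G : Type*) [Group G] [TopologicalSpace G] [ChartedSpace EG G]
    [MulAction G M] (Φ : OpenPartialHomeomorph M (F × (EG × V))) (w : F × (EG × V)) : M :=
  (chartAt EG (1 : G)).symm w.2.1 • Φ.symm (w.1, (0, w.2.2))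

/-- The parameters at which `flowOut` is smooth. -/
def flowOutDomain (G : Type*) [Group G] [TopologicalSpace G] [ChartedSpace EG G]
    (Φ : OpenPartialHomeomorph M (F × (EG × V))) : Set (F × (EG × V)) :=
  {w | w.2.1 ∈ (chartAt EG (1 : G)).target ∧ (w.1, ((0 : EG), w.2.2)) ∈ Φ.target}

variable {Φ : OpenPartialHomeomorph M (F × (EG × V))}

lemma isOpen_flowOutDomain : IsOpen (flowOutDomain G Φ) :=
  ((chartAt EG (1 : G)).open_target.preimage (by fun_prop)).inter
    (Φ.open_target.preimage (by fun_prop))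

lemma contMDiffOn_flowOut (hΦ : IsSmoothChart E Φ) :
    ContMDiffOn 𝓘(ℝ, F × (EG × V)) 𝓘(ℝ, E) ∞ (flowOut G Φ) (flowOutDomain G Φ) := by
  haveI : IsManifold 𝓘(ℝ, EG) ∞ G := (inferInstance : ContMDiffMul 𝓘(ℝ, EG) ∞ G).toIsManifold
  have h1 : ContMDiffOn 𝓘(ℝ, F × (EG × V)) 𝓘(ℝ, EG) ∞
      (fun w : F × (EG × V) ↦ (chartAt EG (1 : G)).symm w.2.1) (flowOutDomain G Φ) :=
    (contMDiffOn_chart_symm (I := 𝓘(ℝ, EG)) (H := EG) (x := (1 : G))).comp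
      (t := (chartAt EG (1 : G)).target)
      (contMDiff_iff_contDiff.2 (by fun_prop : ContDiff ℝ ∞ fun w : F × (EG × V) ↦ w.2.1)
        ).contMDiffOn fun w hw ↦ hw.1
  have h2 : ContMDiffOn 𝓘(ℝ, F × (EG × V)) 𝓘(ℝ, E) ∞
      (fun w : F × (EG × V) ↦ Φ.symm (w.1, (0, w.2.2))) (flowOutDomain G Φ) :=
    hΦ.contMDiffOn_symm.comp (contMDiff_iff_contDiff.2 (by fun_prop : ContDiff ℝ ∞
      fun w : F × (EG × V) ↦ (w.1, ((0 : EG), w.2.2)))).contMDiffOn fun w hw ↦ hw.2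
  exact (contMDiff_smul_pair (E := E) (EG := EG) (M := M) G).comp_contMDiffOn (h1.prodMk h2)

/-- The derivative is determined on two complementary subspaces. With the group element fixed at 1,
`flowOut` is the inverse of `Φ` on the slice; with the slice point fixed at `p`, it is the orbit
map, whose velocities `hd` gives in the chart. -/
lemma hasFDerivAt_comp_flowOut (hΦ : IsSmoothChart E Φ) {p : M} (hp : p ∈ Φ.source) (hp0 : Φ p = 0)
    (hd : ∀ ξ : EG, (mfderiv 𝓘(ℝ, E) 𝓘(ℝ, F × (EG × V)) Φ p
        (fundamentalMap G p ξ) : F × (EG × V)) = (0, ξ, 0)) :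
    HasFDerivAt (Φ ∘ flowOut G Φ) (ContinuousLinearMap.id ℝ (F × (EG × V)))
      (0, (chartAt EG (1 : G) 1, 0)) := by
  haveI : IsManifold 𝓘(ℝ, EG) ∞ G := (inferInstance : ContMDiffMul 𝓘(ℝ, EG) ∞ G).toIsManifold
  set γ := chartAt EG (1 : G) with hγ
  have hγ1 : (1 : G) ∈ γ.source := mem_chart_source EG (1 : G)
  have hτ : Φ.symm 0 = p := by rw [← hp0, Φ.left_inv hp]
  have h0 : (0 : F × (EG × V)) ∈ Φ.target := hp0 ▸ Φ.map_source hp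
  set a₀ : F × (EG × V) := (0, (γ 1, 0)) with ha₀
  have hB0 : flowOut G Φ a₀ = p := by
    have : ((0 : F), ((0 : EG), (0 : V))) = 0 := rfl
    simp [flowOut, ← hγ, a₀, γ.left_inv hγ1, this, hτ]
  have hmem : a₀ ∈ flowOutDomain G Φ := ⟨γ.map_source hγ1, h0⟩
  have hdiff : DifferentiableAt ℝ (Φ ∘ flowOut G Φ) a₀ := by
    have h1 : ContMDiffAt 𝓘(ℝ, F × (EG × V)) 𝓘(ℝ, F × (EG × V)) ∞ (Φ ∘ flowOut G Φ) a₀ :=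
      (hΦ.contMDiffAt (by rw [hB0]; exact hp)).comp a₀
        ((contMDiffOn_flowOut hΦ).contMDiffAt (isOpen_flowOutDomain.mem_nhds hmem))
    exact h1.contDiffAt.differentiableAt (by simp)
  have hT := hdiff.hasFDerivAt
  set T := fderiv ℝ (Φ ∘ flowOut G Φ) a₀ with hTdef
  -- the directions of the slice
  let P₁ : F × (EG × V) →L[ℝ] F × (EG × V) :=
    (ContinuousLinearMap.fst ℝ F (EG × V)).prod ((0 : F × (EG × V) →L[ℝ] EG).prod
      ((ContinuousLinearMap.snd ℝ EG V) ∘L (ContinuousLinearMap.snd ℝ F (EG × V))))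
  have hP₁ : ∀ w, P₁ w = (w.1, (0, w.2.2)) := fun w ↦ rfl
  have e1 : T ∘L P₁ = P₁ := by
    have h1 : HasFDerivAt (fun w ↦ P₁ w + a₀) P₁ 0 := P₁.hasFDerivAt.add_const a₀
    have h2 : HasFDerivAt ((Φ ∘ flowOut G Φ) ∘ fun w ↦ P₁ w + a₀) (T ∘L P₁) 0 :=
      HasFDerivAt.comp 0 (by simpa using hT) h1
    refine h2.unique (P₁.hasFDerivAt.congr_of_eventuallyEq ?_)
    have h3 : ∀ᶠ w in 𝓝 (0 : F × (EG × V)), P₁ w ∈ Φ.target :=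
      P₁.continuous.continuousAt.eventually_mem (Φ.open_target.mem_nhds (by simpa using h0))
    filter_upwards [h3] with w hw
    have : flowOut G Φ (P₁ w + a₀) = Φ.symm (P₁ w) := by
      simp [flowOut, ← hγ, a₀, hP₁, γ.left_inv hγ1]
    simp only [Function.comp_apply, this, Φ.right_inv hw]
  -- the directions of the orbit
  let P₂ : EG →L[ℝ] F × (EG × V) :=
    (0 : EG →L[ℝ] F).prod ((ContinuousLinearMap.id ℝ EG).prod 0)
  have e2 : T ∘L P₂ = P₂ := by
    have h1 : HasFDerivAt (fun u ↦ P₂ u) P₂ (γ 1) := P₂.hasFDerivAt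
    have h2 : HasFDerivAt ((Φ ∘ flowOut G Φ) ∘ fun u ↦ P₂ u) (T ∘L P₂) (γ 1) :=
      HasFDerivAt.comp (γ 1) hT h1
    have h3 : MDifferentiableAt 𝓘(ℝ, EG) 𝓘(ℝ, E) (fun a : G ↦ a • p) 1 :=
      (contMDiff_smul_point p).mdifferentiableAt (by simp)
    have h4 : MDifferentiableAt 𝓘(ℝ, E) 𝓘(ℝ, F × (EG × V)) Φ ((1 : G) • p) := by
      rw [one_smul]
      exact (hΦ.contMDiffAt hp).mdifferentiableAt (by simp)
    have h5 := (h4.comp (1 : G) h3).mfderiv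
    have h6 := mfderiv_comp (1 : G) h4 h3
    rw [h5] at h6
    have h7 : writtenInExtChartAt 𝓘(ℝ, EG) 𝓘(ℝ, F × (EG × V)) 1 (Φ ∘ fun a : G ↦ a • p)
        = (Φ ∘ flowOut G Φ) ∘ fun u ↦ P₂ u := by
      ext u : 1
      have : ((0 : F), ((0 : EG), (0 : V))) = 0 := rfl
      simp [writtenInExtChartAt, flowOut, ← hγ, P₂, this, hτ, chartAt_self_eq]
    rw [h7] at h6
    simp only [modelWithCornersSelf_coe, Set.range_id, fderivWithin_univ] at h6
    have h8 : (extChartAt 𝓘(ℝ, EG) (1 : G)) 1 = γ 1 := by simp [← hγ]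
    rw [h8, h2.fderiv] at h6
    refine ContinuousLinearMap.ext fun ξ ↦ ?_
    refine (congrArg (fun A : EG →L[ℝ] F × (EG × V) ↦ A ξ) h6).trans ?_
    have h9 : ∀ q : M, q = p → ∀ v : E, (mfderiv 𝓘(ℝ, E) 𝓘(ℝ, F × (EG × V)) Φ q : E →L[ℝ] _) v
      = (mfderiv 𝓘(ℝ, E) 𝓘(ℝ, F × (EG × V)) Φ p : E →L[ℝ] _) v := by rintro q rfl v; rfl
    exact (h9 _ (one_smul G p) _).trans (hd ξ)
  refine hT.congr_fderiv (ContinuousLinearMap.ext fun w ↦ ?_)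
  have h1 : w = P₁ w + P₂ w.2.1 := by simp [hP₁, P₂]
  have h2 := congrArg (fun A ↦ A w) e1
  have h3 := congrArg (fun A ↦ A w.2.1) e2
  simp only [ContinuousLinearMap.comp_apply] at h2 h3
  rw [ContinuousLinearMap.id_apply]
  conv_lhs => rw [h1]
  rw [map_add, h2, h3, ← h1]

variable [T2Space M] [CompactSpace G] [T2Space G]

/-- The chart is the local inverse of the flow-out, whose coordinates are the value of ν - ζ at the
slice point, the group element, and the position on the slice. It is shrunk until slice points of
`P` with different positions are on different orbits. -/
theorem exists_isAdaptedChart {c : ComplexStructure E M} {ν : M → (EG →L[ℝ] ℝ)}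
    (hν : IsGMomentMap G c ν) {ζ : EG →L[ℝ] ℝ}
    (hinv : ∀ (a : G) (x : M), ν x = ζ → ν (a • x) = ζ)
    (hfree : ∀ (a : G) (x : M), ν x = ζ → a • x = x → a = 1) {p : M} (hp : ν p = ζ) :
    ∃ Θ : OpenPartialHomeomorph M ((EG →L[ℝ] ℝ) × (EG × ReducedModel E EG)),
      IsAdaptedChart E (level G ν ζ hinv) Θ ∧ p ∈ Θ.source := by
  haveI : IsManifold 𝓘(ℝ, EG) ∞ G := (inferInstance : ContMDiffMul 𝓘(ℝ, EG) ∞ G).toIsManifold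
  obtain ⟨Φ, hΦ, hpΦ, hp0, hΦν, hd⟩ := exists_flattening_chart hν hinv hp
  set γ := chartAt EG (1 : G) with hγ
  have hγ1 : (1 : G) ∈ γ.source := mem_chart_source EG (1 : G)
  let B := flowOut G Φ
  have hτ : Φ.symm 0 = p := by rw [← hp0, Φ.left_inv hpΦ]
  have h0 : (0 : (EG →L[ℝ] ℝ) × (EG × ReducedModel E EG)) ∈ Φ.target := hp0 ▸ Φ.map_source hpΦ
  let a₀ : (EG →L[ℝ] ℝ) × (EG × ReducedModel E EG) := (0, (γ 1, 0))
  have hB0 : B a₀ = p := by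
    have : ((0 : EG →L[ℝ] ℝ), ((0 : EG), (0 : ReducedModel E EG))) = 0 := rfl
    simp [B, flowOut, ← hγ, a₀, γ.left_inv hγ1, this, hτ]
  have hBs := contMDiffOn_flowOut (G := G) hΦ
  let S := flowOutDomain G Φ ∩ B ⁻¹' Φ.source
  have hS : IsOpen S := hBs.continuousOn.isOpen_inter_preimage isOpen_flowOutDomain Φ.open_source
  have haS : a₀ ∈ S := ⟨⟨γ.map_source hγ1, h0⟩, by rw [Set.mem_preimage, hB0]; exact hpΦ⟩
  obtain ⟨Ψ, hΨ, haΨ, hΨS, hΨB⟩ := exists_isSmoothChart_of_contDiffOn (f := Φ ∘ B) hS haS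
    (contMDiffOn_iff_contDiffOn.1 (hΦ.contMDiffOn.comp (hBs.mono Set.inter_subset_left)
      Set.inter_subset_right)) (ContinuousLinearEquiv.refl ℝ _)
    (hasFDerivAt_comp_flowOut hΦ hpΦ hp0 hd)
  -- the action on the slice
  let s : ReducedModel E EG → M := fun v ↦ Φ.symm (0, (0, v))
  have hs0 : s 0 = p := hτ
  have hBinj : Set.InjOn B Ψ.source := fun w hw w' hw' h ↦ Ψ.injOn hw hw' (by
    rw [hΨB, Function.comp_apply, h, Function.comp_apply])
  have hsc : ContinuousAt s 0 :=
    ContinuousAt.comp (f := fun v : ReducedModel E EG ↦ ((0 : EG →L[ℝ] ℝ), ((0 : EG), v)))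
      (Φ.symm.continuousAt h0) (by fun_prop)
  -- For `a` near 1, both a • s v = B(0, γ a, v) and s v' = B(0, γ 1, v') lie where `B` is
  -- injective.
  have hnear : ∀ᶠ z in 𝓝 (((0, 0), 1) : (ReducedModel E EG × ReducedModel E EG) × G),
      z.2 • s z.1.1 = s z.1.2 → z.1.1 = z.1.2 := by
    have hc1 : ContinuousAt (fun z : (ReducedModel E EG × ReducedModel E EG) × G ↦
        ((0 : EG →L[ℝ] ℝ), (γ z.2, z.1.1))) ((0, 0), 1) := by
      have : ContinuousAt γ (1 : G) := γ.continuousAt hγ1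
      have h : ContinuousAt (fun z : (ReducedModel E EG × ReducedModel E EG) × G ↦ γ z.2)
        ((0, 0), 1) := ContinuousAt.comp (f := Prod.snd) this continuousAt_snd
      fun_prop
    have hc2 : ContinuousAt (fun z : (ReducedModel E EG × ReducedModel E EG) × G ↦
        ((0 : EG →L[ℝ] ℝ), (γ 1, z.1.2))) ((0, 0), 1) := by fun_prop
    have hc3 : ∀ᶠ z in 𝓝 (((0, 0), 1) : (ReducedModel E EG × ReducedModel E EG) × G),
        z.2 ∈ γ.source := continuousAt_snd.eventually_mem (γ.open_source.mem_nhds hγ1)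
    filter_upwards [hc1.eventually_mem (Ψ.open_source.mem_nhds haΨ),
      hc2.eventually_mem (Ψ.open_source.mem_nhds haΨ), hc3] with z hz1 hz2 hz3 h
    have h1 : B (0, (γ z.2, z.1.1)) = B (0, (γ 1, z.1.2)) := by
      simp only [B, flowOut, ← hγ, γ.left_inv hz3, γ.left_inv hγ1, one_smul]
      exact h
    simpa using congrArg (fun w ↦ w.2.2) (hBinj hz1 hz2 h1)
  haveI : ContinuousSMul G M := ContMDiffSMul.continuousSMul (I := 𝓘(ℝ, EG)) (I' := 𝓘(ℝ, E)) ∞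
  have hslice := eventually_eq_of_smul_eq hsc hs0
    (fun a ↦ hfree a p hp) hnear
  rw [nhds_prod_eq] at hslice
  obtain ⟨O, hO, hOs⟩ := (Filter.eventually_prod_self_iff
    (r := fun v v' ↦ ∀ a : G, a • s v = s v' → v = v')).1 hslice
  obtain ⟨O', hO'O, hO', h0O'⟩ := mem_nhds_iff.1 hO
  -- `Ψ` is Φ ∘ B, so Φ followed by the inverse of `Ψ` is a local inverse of `B`.
  let Θ₀ := Φ.trans Ψ.symm
  have hΘ₀s : ∀ x ∈ Θ₀.source, B (Θ₀ x) = x ∧ Θ₀ x ∈ Ψ.source := by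
    intro x hx
    rw [Φ.trans_source] at hx
    have h1 : Ψ.symm (Φ x) ∈ Ψ.source := Ψ.map_target hx.2
    have h2 : Φ (B (Ψ.symm (Φ x))) = Φ x := by
      have := Ψ.right_inv hx.2
      rwa [hΨB] at this
    exact ⟨Φ.injOn (hΨS h1).2 hx.1 h2, h1⟩
  have hpΘ₀ : p ∈ Θ₀.source := by
    rw [Φ.trans_source]
    refine ⟨hpΦ, ?_⟩
    have := Ψ.map_source haΨ
    rwa [hΨB, Function.comp_apply, hB0] at this
  have hΘ₀p : Θ₀ p = a₀ := hBinj (hΘ₀s p hpΘ₀).2 haΨ (by rw [(hΘ₀s p hpΘ₀).1, hB0])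
  let O'' : Set M := Θ₀ ⁻¹' {w | w.2.2 ∈ O'}
  have hO'' : O'' ∈ 𝓝 p := by
    refine (Θ₀.continuousAt hpΘ₀).preimage_mem_nhds (IsOpen.mem_nhds ?_ ?_)
    · exact hO'.preimage (by fun_prop)
    · rw [hΘ₀p]; exact h0O'
  -- The first coordinate is ν - ζ at the slice point below `q`, and ν may vary along orbits outside
  -- the level set. Invariance of the level set still makes the two vanishing conditions equivalent.
  have hmem : ∀ q ∈ Θ₀.source, ν q = ζ ↔ (Θ₀ q).1 = 0 := by
    intro q hq
    obtain ⟨hBq, hqΨ⟩ := hΘ₀s q hq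
    have ht := (hΨS hqΨ).1.2
    have h1 := hΦν _ (Φ.map_target ht)
    rw [Φ.right_inv ht] at h1
    simp only at h1
    rw [h1, sub_eq_zero]
    conv_lhs => rw [← hBq]
    refine ⟨fun h ↦ ?_, fun h ↦ hinv _ _ h⟩
    have h2 := hinv ((chartAt EG (1 : G)).symm (Θ₀ q).2.1)⁻¹ _ h
    rwa [show B (Θ₀ q) = (chartAt EG (1 : G)).symm (Θ₀ q).2.1 •
      Φ.symm ((Θ₀ q).1, (0, (Θ₀ q).2.2)) from rfl, inv_smul_smul] at h2
  have hsmul : ∀ q ∈ Θ₀.source, ν q = ζ → γ.symm (Θ₀ q).2.1 • s (Θ₀ q).2.2 = q := by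
    intro q hq hqP
    have h1 := (hΘ₀s q hq).1
    rw [show B (Θ₀ q) = γ.symm (Θ₀ q).2.1 • Φ.symm ((Θ₀ q).1, (0, (Θ₀ q).2.2)) from rfl,
      (hmem q hq).1 hqP] at h1
    exact h1
  refine ⟨Θ₀.restr O'', ⟨(hΦ.trans hΨ.symm).restr O'', ?_, ?_⟩, ?_⟩
  · intro q hq
    rw [Θ₀.restr_source] at hq
    exact hmem q hq.1
  · intro q hq q' hq' hqP hqP'
    rw [Θ₀.restr_source] at hq hq'
    have e1 := hsmul q hq.1 hqP
    have e2 := hsmul q' hq'.1 hqP'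
    constructor
    · intro h
      -- Points with the same slice position s v are g • s v and g' • s v, so g' g⁻¹ carries one to
      -- the other.
      change (Θ₀ q).2.2 = (Θ₀ q').2.2 at h
      rw [← h] at e2
      refine ⟨γ.symm (Θ₀ q').2.1 * (γ.symm (Θ₀ q).2.1)⁻¹, ?_⟩
      nth_rewrite 2 [← e1]
      rw [mul_smul, inv_smul_smul, e2]
    · rintro ⟨a, ha⟩
      refine hOs _ (hO'O (interior_subset (s := O'') hq.2)) _
        (hO'O (interior_subset (s := O'') hq'.2))
        ((γ.symm (Θ₀ q').2.1)⁻¹ * a * γ.symm (Θ₀ q).2.1) ?_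
      change _ • s (Θ₀ q).2.2 = s (Θ₀ q').2.2
      rw [mul_smul, mul_smul, e1, ha, inv_smul_eq_iff, e2]
  · rw [Θ₀.restr_source]
    exact ⟨hpΘ₀, mem_interior_iff_mem_nhds.2 hO''⟩

end Existence

/-! ### Topology of the orbit space -/

section Quotient

variable {M : Type*} {G : Type*} [Group G] [MulAction G M] (P : SubMulAction G M)

lemma proj_eq_iff {q q' : P} : proj P q = proj P q' ↔ ∃ a : G, a • (q : M) = q' := by
  rw [proj, Quotient.eq, MulAction.orbitRel_apply, MulAction.mem_orbit_iff]
  constructor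
  · rintro ⟨a, ha⟩
    exact ⟨a⁻¹, by rw [← ha]; simp⟩
  · rintro ⟨a, ha⟩
    exact ⟨a⁻¹, Subtype.ext (by simp [← ha])⟩

variable [TopologicalSpace M] [TopologicalSpace G] [ContinuousSMul G M]

lemma continuousSMul_subMulAction : ContinuousSMul G P :=
  ⟨Continuous.subtype_mk (f := fun z : G × P ↦ z.1 • (z.2 : M)) (by fun_prop) _⟩

lemma isOpenQuotientMap_proj : IsOpenQuotientMap (proj P) :=
  haveI := continuousSMul_subMulAction P
  MulAction.isOpenQuotientMap_quotientMk

/-- The orbit relation is the projection of the closed set {a • q = q'} along the compact group,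
hence closed; an open quotient by a closed relation is Hausdorff. -/
lemma t2Space_quotient [T2Space M] [CompactSpace G] :
    T2Space (MulAction.orbitRel.Quotient G P) := by
  rw [t2Space_iff_of_isOpenQuotientMap (isOpenQuotientMap_proj P)]
  have h1 : IsClosed {z : G × (P × P) | z.1 • (z.2.1 : M) = z.2.2} :=
    isClosed_eq (by fun_prop) (by fun_prop)
  convert isClosedMap_snd_of_compactSpace _ h1 using 1
  ext ⟨q, q'⟩
  simp [proj_eq_iff]

lemma secondCountableTopology_quotient [SecondCountableTopology M] :
    SecondCountableTopology (MulAction.orbitRel.Quotient G P) :=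
  haveI := continuousSMul_subMulAction P
  haveI : SecondCountableTopology P := TopologicalSpace.Subtype.secondCountableTopology (P : Set M)
  ContinuousConstSMul.secondCountableTopology

end Quotient

/-! ### Charts of the level set and of the orbit space -/

section Charts

variable {E : Type*} [NormedAddCommGroup E] [NormedSpace ℝ E]
  {M : Type*} [TopologicalSpace M] [ChartedSpace E M]
  {F U V : Type*} [NormedAddCommGroup F] [NormedSpace ℝ F] [NormedAddCommGroup U] [NormedSpace ℝ U]
  [NormedAddCommGroup V] [NormedSpace ℝ V]
  {EP : Type*} [NormedAddCommGroup EP] [NormedSpace ℝ EP]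
  {G : Type*} [Group G] [TopologicalSpace G] [MulAction G M] [ContinuousSMul G M]
  {P : SubMulAction G M} {Θ : OpenPartialHomeomorph M (F × (U × V))}

namespace IsAdaptedChart

lemma symm_mem (hΘ : IsAdaptedChart E P Θ) {w : U × V} (hw : ((0 : F), w) ∈ Θ.target) :
    Θ.symm (0, w) ∈ P := by
  rw [hΘ.mem_iff _ (Θ.map_target hw), Θ.right_inv hw]

open Classical in
/-- The parametrization of `P` by an adapted chart, extended by a constant. -/
noncomputable def param (hΘ : IsAdaptedChart E P Θ) (p : P) (w : U × V) : P :=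
  if h : ((0 : F), w) ∈ Θ.target then ⟨Θ.symm (0, w), hΘ.symm_mem h⟩ else p

variable (hΘ : IsAdaptedChart E P Θ) (p : P)

lemma coe_param {w : U × V} (hw : ((0 : F), w) ∈ Θ.target) :
    (hΘ.param p w : M) = Θ.symm (0, w) := by
  rw [param, dif_pos hw]

lemma param_mem_source {w : U × V} (hw : ((0 : F), w) ∈ Θ.target) :
    (hΘ.param p w : M) ∈ Θ.source := by
  rw [coe_param hΘ p hw]
  exact Θ.map_target hw

lemma apply_param {w : U × V} (hw : ((0 : F), w) ∈ Θ.target) :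
    Θ (hΘ.param p w : M) = (0, w) := by
  rw [coe_param hΘ p hw, Θ.right_inv hw]

include hΘ in
lemma apply_eq {q : P} (hq : (q : M) ∈ Θ.source) : Θ q = (0, (Θ q).2) :=
  Prod.ext ((hΘ.mem_iff _ hq).1 q.2) rfl

include hΘ in
lemma mem_target {q : P} (hq : (q : M) ∈ Θ.source) : ((0 : F), (Θ q).2) ∈ Θ.target := by
  rw [← hΘ.apply_eq hq]
  exact Θ.map_source hq

lemma param_apply {q : P} (hq : (q : M) ∈ Θ.source) : hΘ.param p (Θ q).2 = q :=
  Subtype.ext (by rw [coe_param hΘ p (hΘ.mem_target hq), ← hΘ.apply_eq hq, Θ.left_inv hq])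

variable (Θ) in
lemma isOpen_paramDomain : IsOpen {w : U × V | ((0 : F), w) ∈ Θ.target} :=
  Θ.open_target.preimage (by fun_prop)

lemma continuousOn_param : ContinuousOn (hΘ.param p) {w | ((0 : F), w) ∈ Θ.target} := by
  rw [Topology.IsInducing.subtypeVal.continuousOn_iff]
  have h1 : ContinuousOn (fun w : U × V ↦ Θ.symm ((0 : F), w)) {w | ((0 : F), w) ∈ Θ.target} :=
    Θ.symm.continuousOn.comp (by fun_prop) fun w hw ↦ hw
  exact h1.congr fun w hw ↦ coe_param hΘ p hw

lemma continuousAt_param {w : U × V} (hw : ((0 : F), w) ∈ Θ.target) :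
    ContinuousAt (hΘ.param p) w :=
  (hΘ.continuousOn_param p).continuousAt ((isOpen_paramDomain Θ).mem_nhds hw)

/-- The chart of `P` induced by an adapted chart. -/
noncomputable def levelChart (l : (U × V) ≃L[ℝ] EP) : OpenPartialHomeomorph P EP where
  toFun q := l (Θ q).2
  invFun w := hΘ.param p (l.symm w)
  source := {q | (q : M) ∈ Θ.source}
  target := {w | ((0 : F), l.symm w) ∈ Θ.target}
  map_source' q hq := by
    simpa using hΘ.mem_target hq
  map_target' w hw := hΘ.param_mem_source p hw
  left_inv' q hq := by simpa using hΘ.param_apply p hq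
  right_inv' w hw := by simp [hΘ.apply_param p hw]
  open_source := Θ.open_source.preimage continuous_subtype_val
  open_target := (isOpen_paramDomain Θ).preimage l.symm.continuous
  continuousOn_toFun := l.continuous.comp_continuousOn (continuous_snd.comp_continuousOn
    (Θ.continuousOn.comp continuous_subtype_val.continuousOn fun q hq ↦ hq))
  continuousOn_invFun := (hΘ.continuousOn_param p).comp l.symm.continuous.continuousOn
    fun w hw ↦ hw

include hΘ in
lemma proj_eq_iff_of_mem {q q' : P} (hq : (q : M) ∈ Θ.source) (hq' : (q' : M) ∈ Θ.source) :
    proj P q = proj P q' ↔ (Θ q).2.2 = (Θ q').2.2 := by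
  rw [proj_eq_iff, hΘ.orbit_iff _ hq _ hq' q.2 q'.2]

open Classical in
/-- The coordinate on the orbit space given by an adapted chart. -/
noncomputable def orbitCoord (_ : IsAdaptedChart E P Θ) (y : MulAction.orbitRel.Quotient G P) : V :=
  if h : ∃ q : P, (q : M) ∈ Θ.source ∧ proj P q = y then (Θ h.choose).2.2 else 0

/-- The chosen representative is immaterial: representatives of one orbit in the domain share their
third coordinate. -/
lemma orbitCoord_proj {q : P} (hq : (q : M) ∈ Θ.source) :
    hΘ.orbitCoord (proj P q) = (Θ q).2.2 := by
  have h : ∃ q' : P, (q' : M) ∈ Θ.source ∧ proj P q' = proj P q := ⟨q, hq, rfl⟩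
  rw [orbitCoord, dif_pos h]
  exact (hΘ.proj_eq_iff_of_mem h.choose_spec.1 hq).1 h.choose_spec.2

open Classical in
/-- The inverse of the coordinate on the orbit space. -/
noncomputable def orbitParam (v : V) : MulAction.orbitRel.Quotient G P :=
  if h : ∃ u : U, ((0 : F), (u, v)) ∈ Θ.target then proj P (hΘ.param p (h.choose, v)) else proj P p

lemma orbitParam_eq {u : U} {v : V} (hu : ((0 : F), (u, v)) ∈ Θ.target) :
    hΘ.orbitParam p v = proj P (hΘ.param p (u, v)) := by
  have h : ∃ u : U, ((0 : F), (u, v)) ∈ Θ.target := ⟨u, hu⟩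
  rw [orbitParam, dif_pos h, hΘ.proj_eq_iff_of_mem (hΘ.param_mem_source p h.choose_spec)
    (hΘ.param_mem_source p hu), hΘ.apply_param p h.choose_spec, hΘ.apply_param p hu]

lemma orbitParam_orbitCoord {q : P} (hq : (q : M) ∈ Θ.source) :
    hΘ.orbitParam p (hΘ.orbitCoord (proj P q)) = proj P q := by
  rw [hΘ.orbitCoord_proj hq, hΘ.orbitParam_eq p (u := (Θ q).2.1) (hΘ.mem_target hq)]
  exact congrArg _ (hΘ.param_apply p hq)

/-- The chart of the orbit space induced by an adapted chart. -/
noncomputable def orbitChart :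
    OpenPartialHomeomorph (MulAction.orbitRel.Quotient G P) V where
  toFun := hΘ.orbitCoord
  invFun := hΘ.orbitParam p
  source := proj P '' {q | (q : M) ∈ Θ.source}
  target := {v | ∃ u : U, ((0 : F), (u, v)) ∈ Θ.target}
  map_source' y hy := by
    obtain ⟨q, hq, rfl⟩ := hy
    rw [hΘ.orbitCoord_proj hq]
    exact ⟨_, hΘ.mem_target hq⟩
  map_target' v hv := by
    obtain ⟨u, hu⟩ := hv
    rw [hΘ.orbitParam_eq p hu]
    exact ⟨_, hΘ.param_mem_source p hu, rfl⟩
  left_inv' y hy := by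
    obtain ⟨q, hq, rfl⟩ := hy
    exact hΘ.orbitParam_orbitCoord p hq
  right_inv' v hv := by
    obtain ⟨u, hu⟩ := hv
    rw [hΘ.orbitParam_eq p hu, hΘ.orbitCoord_proj (hΘ.param_mem_source p hu), hΘ.apply_param p hu]
  open_source := (isOpenQuotientMap_proj P).isOpenMap _
    (Θ.open_source.preimage continuous_subtype_val)
  open_target := by
    have : {v : V | ∃ u : U, ((0 : F), (u, v)) ∈ Θ.target}
        = Prod.snd '' {w : U × V | ((0 : F), w) ∈ Θ.target} := by ext; simp
    rw [this]
    exact isOpenMap_snd _ (isOpen_paramDomain Θ)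
  continuousOn_toFun := by
    rintro y ⟨q, hq, rfl⟩
    refine ContinuousAt.continuousWithinAt ?_
    have h1 : ContinuousAt (fun q : P ↦ (Θ q).2.2) q := by
      have : ContinuousAt (fun q : P ↦ Θ q) q :=
        ContinuousAt.comp (f := fun q : P ↦ (q : M)) (Θ.continuousAt hq) (by fun_prop)
      exact this.snd.snd
    have h2 : (fun q : P ↦ hΘ.orbitCoord (proj P q)) =ᶠ[𝓝 q] fun q ↦ (Θ q).2.2 := by
      filter_upwards [(Θ.open_source.preimage continuous_subtype_val).mem_nhds hq] with q' hq'
      exact hΘ.orbitCoord_proj hq'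
    have h3 : ContinuousAt (hΘ.orbitCoord ∘ proj P) q := h1.congr h2.symm
    -- As π is open, continuity at π q follows from continuity at `q` of the composite with π.
    have h4 := (isOpenQuotientMap_proj P).isOpenMap.nhds_le q
    exact (Filter.tendsto_map'_iff.2 h3).mono_left h4
  continuousOn_invFun := by
    rintro v ⟨u, hu⟩
    refine ContinuousAt.continuousWithinAt ?_
    -- The group coordinate chosen by `orbitParam` may jump with `v`, but any admissible value gives
    -- the same orbit, so `u` can be frozen nearby.
    have h1 : ContinuousAt (fun v ↦ proj P (hΘ.param p (u, v))) v :=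
      (isOpenQuotientMap_proj P).continuous.continuousAt.comp
        (ContinuousAt.comp (f := fun v : V ↦ (u, v)) (hΘ.continuousAt_param p hu) (by fun_prop))
    refine h1.congr ?_
    have h2 : IsOpen {v : V | ((0 : F), (u, v)) ∈ Θ.target} := Θ.open_target.preimage (by fun_prop)
    filter_upwards [h2.mem_nhds hu] with v' hv'
    exact (hΘ.orbitParam_eq p hv').symm

end IsAdaptedChart
end Charts

/-! ### A chart-free record of the reduction -/

section ReductionData

variable (E : Type*) [NormedAddCommGroup E] [NormedSpace ℝ E]
  {M : Type*} [TopologicalSpace M] [ChartedSpace E M]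
  (EP EN : Type*) [NormedAddCommGroup EP] [NormedSpace ℝ EP]
  [NormedAddCommGroup EN] [NormedSpace ℝ EN]
  {G : Type*} [Group G] [MulAction G M]

/-- The invariant set `P` is a submanifold of `M` and the orbit space is a quotient manifold:
locally there are a smooth retraction `ρ` onto `P` and a smooth map `m`, where `m x y` is the point
with the same coordinates as `x` in the directions normal to `P` and along the orbits, and with the
coordinates of `y` in the remaining ones. -/
structure IsReduction (P : SubMulAction G M) [ChartedSpace EP P]
    [ChartedSpace EN (MulAction.orbitRel.Quotient G P)] : Prop where
  contMDiff_coe : ContMDiff 𝓘(ℝ, EP) 𝓘(ℝ, E) ∞ (fun q : P ↦ (q : M))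
  contMDiff_proj : ContMDiff 𝓘(ℝ, EP) 𝓘(ℝ, EN) ∞ (proj P)
  exists_local (p : P) : ∃ (ρ : M → P) (m : M → MulAction.orbitRel.Quotient G P → M),
    (∀ᶠ x in 𝓝 (p : M), ContMDiffAt 𝓘(ℝ, E) 𝓘(ℝ, EP) ∞ ρ x) ∧
    (∀ᶠ q : P in 𝓝 p, ρ (q : M) = q) ∧
    (∀ᶠ z in 𝓝 ((p : M), proj P p),
      ContMDiffAt (𝓘(ℝ, E).prod 𝓘(ℝ, EN)) 𝓘(ℝ, E) ∞ (Function.uncurry m) z) ∧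
    (∀ᶠ x in 𝓝 (p : M), m x (proj P (ρ x)) = x) ∧
    ∀ᶠ z in 𝓝 (p, proj P p), ∃ q : P, (q : M) = m z.1 z.2 ∧ proj P q = z.2

end ReductionData

/-! ### The smooth structures defined by adapted charts -/

section Charts

variable {E : Type*} [NormedAddCommGroup E] [NormedSpace ℝ E]
  {M : Type*} [TopologicalSpace M] [ChartedSpace E M]
  {F U V : Type*} [NormedAddCommGroup F] [NormedSpace ℝ F] [NormedAddCommGroup U] [NormedSpace ℝ U]
  [NormedAddCommGroup V] [NormedSpace ℝ V]
  {EP : Type*} [NormedAddCommGroup EP] [NormedSpace ℝ EP]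
  {EG : Type*} [NormedAddCommGroup EG] [NormedSpace ℝ EG]
  {G : Type*} [Group G] [TopologicalSpace G] [ChartedSpace EG G] [MulAction G M]
  [ContinuousSMul G M]
  {P : SubMulAction G M} {Θ : P → OpenPartialHomeomorph M (F × (U × V))}
  (hΘ : ∀ p, IsAdaptedChart E P (Θ p)) (hmem : ∀ p : P, (p : M) ∈ (Θ p).source)
  (l : (U × V) ≃L[ℝ] EP)

/-- The manifold structure on `P` defined by a family of adapted charts. -/
@[reducible] noncomputable def levelChartedSpace : ChartedSpace EP P where
  atlas := Set.range fun p ↦ (hΘ p).levelChart p l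
  chartAt p := (hΘ p).levelChart p l
  mem_chart_source := hmem
  chart_mem_atlas p := ⟨p, rfl⟩

/-- The manifold structure on the orbit space defined by a family of adapted charts. -/
@[reducible] noncomputable def orbitChartedSpace :
    ChartedSpace V (MulAction.orbitRel.Quotient G P) where
  atlas := Set.range fun p ↦ (hΘ p).orbitChart p
  chartAt y := (hΘ y.out).orbitChart y.out
  mem_chart_source y := ⟨y.out, hmem _, Quotient.out_eq y⟩
  chart_mem_atlas y := ⟨y.out, rfl⟩

lemma isManifold_level :
    letI := levelChartedSpace hΘ hmem l
    IsManifold 𝓘(ℝ, EP) ∞ P := by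
  letI := levelChartedSpace hΘ hmem l
  refine isManifold_of_contDiffOn _ _ _ ?_
  rintro _ _ ⟨p, rfl⟩ ⟨p', rfl⟩
  rintro w ⟨hw, -⟩
  have h1 : ((0 : F), l.symm w) ∈ (Θ p).target := hw.1
  have h2 : ((hΘ p).param p (l.symm w) : M) ∈ (Θ p').source := hw.2
  rw [(hΘ p).coe_param p h1] at h2
  have h3 : ContDiffAt ℝ ∞ (fun w : EP ↦ l (Θ p' ((Θ p).symm ((0 : F), l.symm w))).2) w := by
    have e1 : ContMDiffAt 𝓘(ℝ, EP) 𝓘(ℝ, F × (U × V)) ∞ (fun w : EP ↦ ((0 : F), l.symm w)) w :=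
      contMDiffAt_iff_contDiffAt.2 (contDiffAt_const.prodMk l.symm.contDiff.contDiffAt)
    have e2 := ((hΘ p').contMDiffAt h2).comp w (((hΘ p).contMDiffAt_symm h1).comp w e1)
    exact l.contDiff.contDiffAt.comp w (contDiffAt_snd.comp w e2.contDiffAt)
  refine (h3.congr_of_eventuallyEq ?_).contDiffWithinAt
  have h4 : IsOpen {w : EP | ((0 : F), l.symm w) ∈ (Θ p).target} :=
    (IsAdaptedChart.isOpen_paramDomain (Θ p)).preimage l.symm.continuous
  filter_upwards [h4.mem_nhds h1] with w' hw'
  change l (Θ p' ((hΘ p).param p (l.symm w') : M)).2 = _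
  rw [(hΘ p).coe_param p hw']

/-- Domains that overlap in the orbit space may be disjoint in `M`. A single group element `a`
carries a representative into the second domain, and near it the transition map is the third
coordinate of Θ'(a • Θ⁻¹(0, u, v)) with `a` and `u` fixed. -/
lemma isManifold_orbit (hsmul : ∀ a : G, ContMDiff 𝓘(ℝ, E) 𝓘(ℝ, E) ∞ (fun x : M ↦ a • x)) :
    letI := orbitChartedSpace hΘ hmem
    IsManifold 𝓘(ℝ, V) ∞ (MulAction.orbitRel.Quotient G P) := by
  letI := orbitChartedSpace hΘ hmem
  refine isManifold_of_contDiffOn _ _ _ ?_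
  rintro _ _ ⟨p, rfl⟩ ⟨p', rfl⟩
  rintro v ⟨⟨⟨u, hu⟩, hv⟩, -⟩
  change ((0 : F), (u, v)) ∈ (Θ p).target at hu
  obtain ⟨q', hq', hqq'⟩ : (hΘ p).orbitParam p v ∈ proj P '' {q | (q : M) ∈ (Θ p').source} := hv
  rw [(hΘ p).orbitParam_eq p hu, eq_comm, proj_eq_iff] at hqq'
  obtain ⟨a, ha⟩ := hqq'
  rw [(hΘ p).coe_param p hu] at ha
  have h2 : a • (Θ p).symm ((0 : F), (u, v)) ∈ (Θ p').source := by rw [ha]; exact hq'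
  have e1 : ContMDiffAt 𝓘(ℝ, V) 𝓘(ℝ, F × (U × V)) ∞ (fun v : V ↦ ((0 : F), (u, v))) v :=
    contMDiffAt_iff_contDiffAt.2 (by fun_prop)
  have e2 := (hsmul a).contMDiffAt.comp v (((hΘ p).contMDiffAt_symm hu).comp v e1)
  have e3 : ContMDiffAt 𝓘(ℝ, V) 𝓘(ℝ, F × (U × V)) ∞
    (fun v : V ↦ Θ p' (a • (Θ p).symm ((0 : F), (u, v)))) v :=
    ((hΘ p').contMDiffAt h2).comp v e2
  have h3 : ContDiffAt ℝ ∞ (fun v : V ↦ (Θ p' (a • (Θ p).symm ((0 : F), (u, v)))).2.2) v :=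
    contDiffAt_snd.comp v (contDiffAt_snd.comp v e3.contDiffAt)
  refine (h3.congr_of_eventuallyEq ?_).contDiffWithinAt
  have h4 : IsOpen {v : V | ((0 : F), (u, v)) ∈ (Θ p).target} :=
    (Θ p).open_target.preimage (by fun_prop)
  filter_upwards [h4.mem_nhds hu,
    e2.continuousAt.eventually_mem ((Θ p').open_source.mem_nhds h2)] with v' hv' hv''
  have h5 : proj P ((hΘ p).param p (u, v')) = proj P (a • (hΘ p).param p (u, v')) :=
    (proj_eq_iff P).2 ⟨a, rfl⟩
  have h6 : ((a • (hΘ p).param p (u, v') : P) : M) = a • (Θ p).symm ((0 : F), (u, v')) := by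
    rw [SubMulAction.val_smul, (hΘ p).coe_param p hv']
  change (hΘ p').orbitCoord ((hΘ p).orbitParam p v') = _
  rw [(hΘ p).orbitParam_eq p hv', h5, (hΘ p').orbitCoord_proj (by rw [h6]; exact hv''), h6]

variable [IsManifold 𝓘(ℝ, E) ∞ M]

lemma mem_maximalAtlas_level (p : P) :
    letI := levelChartedSpace hΘ hmem l
    (hΘ p).levelChart p l ∈ IsManifold.maximalAtlas 𝓘(ℝ, EP) ∞ P := by
  letI := levelChartedSpace hΘ hmem l
  haveI := isManifold_level hΘ hmem l
  exact IsManifold.subset_maximalAtlas ⟨p, rfl⟩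

lemma mem_maximalAtlas_orbit
    (hsmul : ∀ a : G, ContMDiff 𝓘(ℝ, E) 𝓘(ℝ, E) ∞ (fun x : M ↦ a • x)) (p : P) :
    letI := orbitChartedSpace hΘ hmem
    (hΘ p).orbitChart p ∈ IsManifold.maximalAtlas 𝓘(ℝ, V) ∞ (MulAction.orbitRel.Quotient G P) := by
  letI := orbitChartedSpace hΘ hmem
  haveI := isManifold_orbit hΘ hmem hsmul
  exact IsManifold.subset_maximalAtlas ⟨p, rfl⟩

/-- In an adapted chart the inclusion reads w ↦ (0, w). `A` transports this to the model space of
`M`, where the copy `F'` of `F` is the complement. -/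
lemma isSmoothEmbedding_level (A : E ≃L[ℝ] F × (U × V)) :
    letI := levelChartedSpace hΘ hmem l
    Manifold.IsSmoothEmbedding 𝓘(ℝ, EP) 𝓘(ℝ, E) ∞ (fun q : P ↦ (q : M)) := by
  letI := levelChartedSpace hΘ hmem l
  haveI := isManifold_level hΘ hmem l
  refine ⟨?_, Topology.IsEmbedding.subtypeVal⟩
  let j : F →L[ℝ] E := (A.symm : F × (U × V) →L[ℝ] E) ∘L (ContinuousLinearMap.inl ℝ F (U × V))
  let pr : E →L[ℝ] F := (ContinuousLinearMap.fst ℝ F (U × V)) ∘L (A : E →L[ℝ] F × (U × V))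
  have hpj : ∀ f, pr (j f) = f := fun f ↦ by simp [pr, j]
  let F' : Submodule ℝ E := LinearMap.range (j : F →ₗ[ℝ] E)
  let e : F' ≃L[ℝ] F := ContinuousLinearEquiv.equivOfInverse (pr ∘L F'.subtypeL)
    (j.codRestrict F' fun f ↦ ⟨f, rfl⟩)
    (by rintro ⟨_, ⟨f, rfl⟩⟩; exact Subtype.ext (congrArg j (hpj f)))
    (fun f ↦ hpj f)
  let equiv : (EP × F') ≃L[ℝ] E :=
    ((l.symm.prodCongr e).trans (ContinuousLinearEquiv.prodComm ℝ (U × V) F)).trans A.symm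
  refine ⟨F', inferInstance, inferInstance, fun p ↦ ?_⟩
  let cod : OpenPartialHomeomorph M E :=
    (Θ p).trans A.symm.toHomeomorph.toOpenPartialHomeomorph
  have hcod : IsSmoothChart E cod := (hΘ p).toIsSmoothChart.trans
    ⟨A.symm.contDiff.contMDiff.contMDiffOn, A.contDiff.contMDiff.contMDiffOn⟩
  have hsource : cod.source = (Θ p).source := by simp [cod]
  refine Manifold.IsImmersionAtOfComplement.mk_of_charts equiv ((hΘ p).levelChart p l) cod
    (hmem p) (by rw [hsource]; exact hmem p) (mem_maximalAtlas_level hΘ hmem l p)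
    (cod.mem_maximalAtlas_of_contMDiffOn hcod.contMDiffOn hcod.contMDiffOn_symm) ?_ ?_
  · intro q hq
    rw [Set.mem_preimage, hsource]
    exact hq
  · intro w hw
    have hw' : ((0 : F), l.symm w) ∈ (Θ p).target := by
      simpa [OpenPartialHomeomorph.extend_target] using! hw
    change A.symm (Θ p ((hΘ p).param p (l.symm w) : M)) = equiv (w, 0)
    rw [(hΘ p).apply_param p hw']
    simp [equiv]

/-- In the charts coming from one adapted chart, π is (u, v) ↦ v. -/
lemma isSubmersion_proj (hsmul : ∀ a : G, ContMDiff 𝓘(ℝ, E) 𝓘(ℝ, E) ∞ (fun x : M ↦ a • x))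
    {EP : Type} [NormedAddCommGroup EP] [NormedSpace ℝ EP] (l : (U × V) ≃L[ℝ] EP)
    {U' : Type} [NormedAddCommGroup U'] [NormedSpace ℝ U'] (e : U ≃L[ℝ] U') :
    letI := levelChartedSpace hΘ hmem l
    letI := orbitChartedSpace hΘ hmem
    Manifold.IsSubmersion 𝓘(ℝ, EP) 𝓘(ℝ, V) ∞ (proj P) := by
  letI := levelChartedSpace hΘ hmem l
  letI := orbitChartedSpace hΘ hmem
  let equiv : EP ≃L[ℝ] V × U' := (l.symm.trans (ContinuousLinearEquiv.prodComm ℝ U V)).trans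
    ((ContinuousLinearEquiv.refl ℝ V).prodCongr e)
  refine ⟨U', inferInstance, inferInstance, fun p ↦ ?_⟩
  refine Manifold.IsSubmersionAtOfComplement.mk_of_charts equiv ((hΘ p).levelChart p l)
    ((hΘ p).orbitChart p) (hmem p) ⟨p, hmem p, rfl⟩ (mem_maximalAtlas_level hΘ hmem l p)
    (mem_maximalAtlas_orbit hΘ hmem hsmul p) (fun q hq ↦ ⟨q, hq, rfl⟩) ?_
  intro w hw
  have hw' : ((0 : F), l.symm w) ∈ (Θ p).target := by
    simpa [OpenPartialHomeomorph.extend_target] using! hw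
  change (hΘ p).orbitCoord (proj P ((hΘ p).param p (l.symm w))) = (l.symm w).2
  rw [(hΘ p).orbitCoord_proj ((hΘ p).param_mem_source p hw'), (hΘ p).apply_param p hw']

/-- The manifold structures defined by a family of adapted charts form a reduction. -/
theorem isReduction (hsmul : ∀ a : G, ContMDiff 𝓘(ℝ, E) 𝓘(ℝ, E) ∞ (fun x : M ↦ a • x)) :
    letI := levelChartedSpace hΘ hmem l
    letI := orbitChartedSpace hΘ hmem
    IsReduction E EP V P := by
  letI := levelChartedSpace hΘ hmem l
  letI := orbitChartedSpace hΘ hmem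
  haveI := isManifold_level hΘ hmem l
  haveI := isManifold_orbit hΘ hmem hsmul
  have hc : ∀ p : P, ContMDiffOn 𝓘(ℝ, EP) 𝓘(ℝ, EP) ∞ ((hΘ p).levelChart p l)
      ((hΘ p).levelChart p l).source := fun p ↦
    contMDiffOn_of_mem_maximalAtlas (mem_maximalAtlas_level hΘ hmem l p)
  have hc' : ∀ p : P, ContMDiffOn 𝓘(ℝ, EP) 𝓘(ℝ, EP) ∞ ((hΘ p).levelChart p l).symm
      ((hΘ p).levelChart p l).target := fun p ↦
    contMDiffOn_symm_of_mem_maximalAtlas (mem_maximalAtlas_level hΘ hmem l p)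
  have ho : ∀ p : P, ContMDiffOn 𝓘(ℝ, V) 𝓘(ℝ, V) ∞ ((hΘ p).orbitChart p)
      ((hΘ p).orbitChart p).source := fun p ↦
    contMDiffOn_of_mem_maximalAtlas (mem_maximalAtlas_orbit hΘ hmem hsmul p)
  have ho' : ∀ p : P, ContMDiffOn 𝓘(ℝ, V) 𝓘(ℝ, V) ∞ ((hΘ p).orbitChart p).symm
      ((hΘ p).orbitChart p).target := fun p ↦
    contMDiffOn_symm_of_mem_maximalAtlas (mem_maximalAtlas_orbit hΘ hmem hsmul p)
  refine ⟨fun p ↦ ?_, fun p ↦ ?_, fun p ↦ ?_⟩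
  · have h0 := (hΘ p).mem_target (hmem p)
    have h1 : ContMDiffAt 𝓘(ℝ, EP) 𝓘(ℝ, EP) ∞ ((hΘ p).levelChart p l) p :=
      (hc p).contMDiffAt (((hΘ p).levelChart p l).open_source.mem_nhds (hmem p))
    have h2 : ContMDiffAt 𝓘(ℝ, EP) 𝓘(ℝ, F × (U × V)) ∞
        (fun q : P ↦ ((0 : F), l.symm ((hΘ p).levelChart p l q))) p :=
      contMDiffAt_const.prodMk_space (l.symm.contDiff.contMDiff.contMDiffAt.comp p h1)
    have h3 : ((0 : F), l.symm ((hΘ p).levelChart p l p)) ∈ (Θ p).target := by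
      change ((0 : F), l.symm (l (Θ p p).2)) ∈ (Θ p).target
      rwa [l.symm_apply_apply]
    refine (((hΘ p).contMDiffAt_symm h3).comp p h2).congr_of_eventuallyEq ?_
    filter_upwards [((hΘ p).levelChart p l).open_source.mem_nhds (hmem p)] with q hq
    change (q : M) = (Θ p).symm ((0 : F), l.symm (l (Θ p q).2))
    rw [l.symm_apply_apply, ← (hΘ p).apply_eq hq, (Θ p).left_inv hq]
  · have h1 : ContMDiffAt 𝓘(ℝ, EP) 𝓘(ℝ, EP) ∞ ((hΘ p).levelChart p l) p :=
      (hc p).contMDiffAt (((hΘ p).levelChart p l).open_source.mem_nhds (hmem p))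
    have h2 : ContMDiffAt 𝓘(ℝ, EP) 𝓘(ℝ, V) ∞
        (fun q : P ↦ (l.symm ((hΘ p).levelChart p l q)).2) p :=
      (contMDiff_iff_contDiff.2 (contDiff_snd.comp l.symm.contDiff)).contMDiffAt.comp p h1
    have h3 : (l.symm ((hΘ p).levelChart p l p)).2 ∈ ((hΘ p).orbitChart p).target := by
      change (l.symm (l (Θ p p).2)).2 ∈ _
      rw [l.symm_apply_apply]
      exact ⟨_, (hΘ p).mem_target (hmem p)⟩
    refine (((ho' p).contMDiffAt (((hΘ p).orbitChart p).open_target.mem_nhds h3)).comp p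
      h2).congr_of_eventuallyEq ?_
    filter_upwards [((hΘ p).levelChart p l).open_source.mem_nhds (hmem p)] with q hq
    change proj P q = (hΘ p).orbitParam p (l.symm (l (Θ p q).2)).2
    rw [l.symm_apply_apply, ← (hΘ p).orbitCoord_proj hq, (hΘ p).orbitParam_orbitCoord p hq]
  -- `ρ` sets the coordinate normal to `P` to zero; `m` exchanges the slice coordinate for that of a
  -- given orbit.
  · let ρ : M → P := fun x ↦ (hΘ p).param p (Θ p x).2
    let m : M → MulAction.orbitRel.Quotient G P → M := fun x y ↦
      (Θ p).symm ((Θ p x).1, ((Θ p x).2.1, (hΘ p).orbitCoord y))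
    have hp0 := (hΘ p).mem_target (hmem p)
    have hΘc := (Θ p).continuousAt (hmem p)
    have hev1 : ∀ᶠ x in 𝓝 (p : M), x ∈ (Θ p).source ∧ ((0 : F), (Θ p x).2) ∈ (Θ p).target :=
      ((Θ p).open_source.eventually_mem (hmem p)).and
        ((continuousAt_const.prodMk hΘc.snd).eventually_mem ((Θ p).open_target.mem_nhds hp0))
    have hoc : ContinuousAt (hΘ p).orbitCoord (proj P p) :=
      ((hΘ p).orbitChart p).continuousAt ⟨p, hmem p, rfl⟩
    have hev2 : ∀ᶠ z in 𝓝 ((p : M), proj P p), z.1 ∈ (Θ p).source ∧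
        z.2 ∈ ((hΘ p).orbitChart p).source ∧
        ((Θ p z.1).1, ((Θ p z.1).2.1, (hΘ p).orbitCoord z.2)) ∈ (Θ p).target := by
      have h1 : ContinuousAt (fun z : M × MulAction.orbitRel.Quotient G P ↦ Θ p z.1)
          ((p : M), proj P p) := ContinuousAt.comp (f := Prod.fst) hΘc continuousAt_fst
      have h2 : ContinuousAt (fun z : M × MulAction.orbitRel.Quotient G P ↦
          (hΘ p).orbitCoord z.2) ((p : M), proj P p) :=
        ContinuousAt.comp (g := (hΘ p).orbitCoord) (f := Prod.snd) (x := ((p : M), proj P p))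
          hoc continuousAt_snd
      refine (continuousAt_fst.eventually_mem ((Θ p).open_source.mem_nhds (hmem p))).and
        ((continuousAt_snd.eventually_mem (((hΘ p).orbitChart p).open_source.mem_nhds
          ⟨p, hmem p, rfl⟩)).and ?_)
      refine (h1.fst.prodMk (h1.snd.fst.prodMk h2)).eventually_mem
        ((Θ p).open_target.mem_nhds ?_)
      simp only [(hΘ p).orbitCoord_proj (hmem p)]
      exact (Θ p).map_source (hmem p)
    refine ⟨ρ, m, ?_, ?_, ?_, ?_, ?_⟩
    · filter_upwards [hev1] with x hx
      have h1 : ContMDiffAt 𝓘(ℝ, E) 𝓘(ℝ, EP) ∞ (fun x ↦ l (Θ p x).2) x :=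
        (contMDiff_iff_contDiff.2 (l.contDiff.comp contDiff_snd)).contMDiffAt.comp x
          ((hΘ p).contMDiffAt hx.1)
      have h2 : l (Θ p x).2 ∈ ((hΘ p).levelChart p l).target := by
        change ((0 : F), l.symm (l (Θ p x).2)) ∈ (Θ p).target
        rw [l.symm_apply_apply]
        exact hx.2
      refine (((hc' p).contMDiffAt (((hΘ p).levelChart p l).open_target.mem_nhds h2)).comp x
        h1).congr_of_eventuallyEq (Filter.Eventually.of_forall fun x' ↦ ?_)
      change _ = (hΘ p).param p (l.symm (l (Θ p x').2))
      rw [l.symm_apply_apply]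
    · filter_upwards [((hΘ p).levelChart p l).open_source.mem_nhds (hmem p)] with q hq
      exact (hΘ p).param_apply p hq
    · filter_upwards [hev2] with z hz
      have h1 : ContMDiffAt (𝓘(ℝ, E).prod 𝓘(ℝ, V)) 𝓘(ℝ, F × (U × V)) ∞
          (fun z : M × MulAction.orbitRel.Quotient G P ↦ Θ p z.1) z :=
        ((hΘ p).contMDiffAt hz.1).comp z contMDiffAt_fst
      have h2 : ContMDiffAt (𝓘(ℝ, E).prod 𝓘(ℝ, V)) 𝓘(ℝ, V) ∞
          (fun z : M × MulAction.orbitRel.Quotient G P ↦ (hΘ p).orbitCoord z.2) z :=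
        ((ho p).contMDiffAt (((hΘ p).orbitChart p).open_source.mem_nhds hz.2.1)).comp z
          contMDiffAt_snd
      have h3 : ContMDiffAt (𝓘(ℝ, E).prod 𝓘(ℝ, V)) 𝓘(ℝ, F × (U × V)) ∞
          (fun z : M × MulAction.orbitRel.Quotient G P ↦
            ((Θ p z.1).1, ((Θ p z.1).2.1, (hΘ p).orbitCoord z.2))) z :=
        ContMDiffAt.prodMk_space ((contMDiff_iff_contDiff.2 contDiff_fst).contMDiffAt.comp z h1)
          (ContMDiffAt.prodMk_space ((contMDiff_iff_contDiff.2
            (contDiff_fst.comp contDiff_snd)).contMDiffAt.comp z h1) h2)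
      exact ((hΘ p).contMDiffAt_symm hz.2.2).comp z h3
    · filter_upwards [hev1] with x hx
      have h1 : Θ p ((hΘ p).param p (Θ p x).2 : M) = (0, (Θ p x).2) := (hΘ p).apply_param p hx.2
      change (Θ p).symm ((Θ p x).1, ((Θ p x).2.1, (hΘ p).orbitCoord (proj P (ρ x)))) = x
      rw [(hΘ p).orbitCoord_proj ((hΘ p).param_mem_source p hx.2), h1]
      exact (Θ p).left_inv hx.1
    · have hc0 : ContinuousAt (fun z : P × MulAction.orbitRel.Quotient G P ↦ ((z.1 : M), z.2))
        (p, proj P p) := by fun_prop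
      filter_upwards [hc0.eventually hev2] with z hz
      have h1 : (Θ p z.1).1 = 0 := ((hΘ p).mem_iff _ hz.1).1 z.1.2
      have h2 := hz.2.2
      rw [h1] at h2
      refine ⟨(hΘ p).param p ((Θ p z.1).2.1, (hΘ p).orbitCoord z.2), ?_, ?_⟩
      · rw [(hΘ p).coe_param p h2]
        change _ = (Θ p).symm ((Θ p z.1).1, _)
        rw [h1]
      · rw [← (hΘ p).orbitParam_eq p h2]
        exact ((hΘ p).orbitChart p).left_inv hz.2.1

end Charts

/-! ### Differentials of the inclusion and of the projection -/

section Derivatives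

variable (E : Type*) [NormedAddCommGroup E] [NormedSpace ℝ E]
  {M : Type*} [TopologicalSpace M] [ChartedSpace E M]
  {EP EN : Type*} [NormedAddCommGroup EP] [NormedSpace ℝ EP]
  [NormedAddCommGroup EN] [NormedSpace ℝ EN]
  {G : Type*} [Group G] [MulAction G M]
  {P : SubMulAction G M} [ChartedSpace EP P]
  [ChartedSpace EN (MulAction.orbitRel.Quotient G P)]

/-- The differential of the inclusion of `P` into `M`. -/
noncomputable def inclDeriv (p : P) :
    TangentSpace 𝓘(ℝ, EP) p →L[ℝ] TangentSpace 𝓘(ℝ, E) (p : M) :=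
  mfderiv 𝓘(ℝ, EP) 𝓘(ℝ, E) (fun q : P ↦ (q : M)) p

variable (EN) in
/-- The differential of the projection of `P` to the orbit space. -/
noncomputable def projDeriv (p : P) :
    TangentSpace 𝓘(ℝ, EP) p →L[ℝ] TangentSpace 𝓘(ℝ, EN) (proj P p) :=
  mfderiv 𝓘(ℝ, EP) 𝓘(ℝ, EN) (proj P) p

/-- `t` is tangent to `P` and projects to `A`. -/
def ProjectsTo (p : P) (t : TangentSpace 𝓘(ℝ, E) (p : M))
    (A : TangentSpace 𝓘(ℝ, EN) (proj P p)) : Prop :=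
  ∃ u : TangentSpace 𝓘(ℝ, EP) p, inclDeriv E p u = t ∧ projDeriv EN p u = A

variable {E}

lemma ProjectsTo.add {p : P} {t t' : TangentSpace 𝓘(ℝ, E) (p : M)}
    {A A' : TangentSpace 𝓘(ℝ, EN) (proj P p)} (h : ProjectsTo (EP := EP) E p t A)
    (h' : ProjectsTo (EP := EP) E p t' A') : ProjectsTo (EP := EP) E p (t + t') (A + A') := by
  obtain ⟨u, rfl, rfl⟩ := h
  obtain ⟨u', rfl, rfl⟩ := h'
  exact ⟨u + u', map_add _ _ _, map_add _ _ _⟩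

lemma ProjectsTo.sub {p : P} {t t' : TangentSpace 𝓘(ℝ, E) (p : M)}
    {A A' : TangentSpace 𝓘(ℝ, EN) (proj P p)} (h : ProjectsTo (EP := EP) E p t A)
    (h' : ProjectsTo (EP := EP) E p t' A') : ProjectsTo (EP := EP) E p (t - t') (A - A') := by
  obtain ⟨u, rfl, rfl⟩ := h
  obtain ⟨u', rfl, rfl⟩ := h'
  exact ⟨u - u', map_sub _ _ _, map_sub _ _ _⟩

variable (hR : IsReduction E EP EN P)
include hR

lemma IsReduction.mdifferentiableAt_coe (p : P) :
    MDifferentiableAt 𝓘(ℝ, EP) 𝓘(ℝ, E) (fun q : P ↦ (q : M)) p :=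
  hR.contMDiff_coe.mdifferentiableAt (by simp)

lemma IsReduction.mdifferentiableAt_proj (p : P) :
    MDifferentiableAt 𝓘(ℝ, EP) 𝓘(ℝ, EN) (proj P) p :=
  hR.contMDiff_proj.mdifferentiableAt (by simp)

lemma IsReduction.exists_retraction (p : P) : ∃ ρ : M → P,
    (∀ᶠ x in 𝓝 (p : M), ContMDiffAt 𝓘(ℝ, E) 𝓘(ℝ, EP) ∞ ρ x) ∧ ∀ᶠ q : P in 𝓝 p, ρ (q : M) = q := by
  obtain ⟨ρ, m, h1, h2, -⟩ := hR.exists_local p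
  exact ⟨ρ, h1, h2⟩

lemma mfderiv_retraction_inclDeriv {ρ : M → P} {q : P}
    (h1 : ContMDiffAt 𝓘(ℝ, E) 𝓘(ℝ, EP) ∞ ρ q) (h2 : ∀ᶠ q' : P in 𝓝 q, ρ (q' : M) = q')
    (u : TangentSpace 𝓘(ℝ, EP) q) :
    (mfderiv 𝓘(ℝ, E) 𝓘(ℝ, EP) ρ (q : M) (inclDeriv E q u) : EP) = u := by
  have h3 := mfderiv_comp q (h1.mdifferentiableAt (by simp)) (hR.mdifferentiableAt_coe q)
  have h4 : ρ ∘ (fun q : P ↦ (q : M)) =ᶠ[𝓝 q] id := h2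
  rw [h4.mfderiv_eq, mfderiv_id] at h3
  exact (congrArg (fun A : EP →L[ℝ] EP ↦ A u) h3).symm

lemma IsReduction.injective_inclDeriv (p : P) :
    Function.Injective (inclDeriv (EP := EP) E p) := by
  obtain ⟨ρ, h1, h2⟩ := hR.exists_retraction p
  intro u u' h
  rw [← mfderiv_retraction_inclDeriv hR h1.self_of_nhds h2 u, h,
    mfderiv_retraction_inclDeriv hR h1.self_of_nhds h2 u']

lemma ProjectsTo.eq {p : P} {t : TangentSpace 𝓘(ℝ, E) (p : M)}
    {A A' : TangentSpace 𝓘(ℝ, EN) (proj P p)} (h : ProjectsTo (EP := EP) E p t A)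
    (h' : ProjectsTo (EP := EP) E p t A') : A = A' := by
  obtain ⟨u, hu, rfl⟩ := h
  obtain ⟨u', hu', rfl⟩ := h'
  rw [hR.injective_inclDeriv p (hu.trans hu'.symm)]

/-- A map to `P` is smooth if it is smooth as a map to `M`. -/
lemma IsReduction.contMDiffAt_of_coe {EB : Type*} [NormedAddCommGroup EB] [NormedSpace ℝ EB]
    {HB : Type*} [TopologicalSpace HB] {IB : ModelWithCorners ℝ EB HB}
    {B : Type*} [TopologicalSpace B] [ChartedSpace HB B] {f : B → P} {x : B}
    (hf : ContMDiffAt IB 𝓘(ℝ, E) ∞ (fun y ↦ (f y : M)) x) :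
    ContMDiffAt IB 𝓘(ℝ, EP) ∞ f x := by
  obtain ⟨ρ, h1, h2⟩ := hR.exists_retraction (f x)
  have hfc : ContinuousAt f x := Topology.IsInducing.subtypeVal.continuousAt_iff.2 hf.continuousAt
  exact (h1.self_of_nhds.comp x hf).congr_of_eventuallyEq
    ((hfc.eventually h2).mono fun y hy ↦ hy.symm)

/-- Local sections of the projection through a point of `P`, with the data of a reduction. -/
lemma mfderiv_slice_projectsTo {m : M → MulAction.orbitRel.Quotient G P → M} {q : P}
    (h1 : ContMDiffAt (𝓘(ℝ, E).prod 𝓘(ℝ, EN)) 𝓘(ℝ, E) ∞ (Function.uncurry m)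
      ((q : M), proj P q)) (hq : m q (proj P q) = q)
    (h2 : ∀ᶠ y in 𝓝 (proj P q), ∃ q' : P, (q' : M) = m q y ∧ proj P q' = y)
    (A : TangentSpace 𝓘(ℝ, EN) (proj P q)) :
    ProjectsTo (EP := EP) E q
      (mfderiv 𝓘(ℝ, EN) 𝓘(ℝ, E) (m q) (proj P q) A : E) A := by
  have h3 : ContMDiffAt 𝓘(ℝ, EN) 𝓘(ℝ, E) ∞ (m q) (proj P q) :=
    h1.comp (proj P q) (contMDiffAt_const.prodMk contMDiffAt_id)
  classical
  -- Near π q the map m q takes values in `P` and is a local section of π through `q`;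
  -- differentiating it lifts `A`. The default value is only used away from π q.
  let σ : MulAction.orbitRel.Quotient G P → P := fun y ↦
    if h : ∃ q' : P, (q' : M) = m q y ∧ proj P q' = y then h.choose else q
  have hσ1 : ∀ᶠ y in 𝓝 (proj P q), (σ y : M) = m q y ∧ proj P (σ y) = y := by
    filter_upwards [h2] with y hy
    simp only [σ, dif_pos hy]
    exact hy.choose_spec
  have hσq : σ (proj P q) = q := Subtype.ext (hσ1.self_of_nhds.1.trans hq)
  have e1 : (fun y ↦ (σ y : M)) =ᶠ[𝓝 (proj P q)] m q := hσ1.mono fun y hy ↦ hy.1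
  have e2 : proj P ∘ σ =ᶠ[𝓝 (proj P q)] id := hσ1.mono fun y hy ↦ hy.2
  have hσ : ContMDiffAt 𝓘(ℝ, EN) 𝓘(ℝ, EP) ∞ σ (proj P q) :=
    hR.contMDiffAt_of_coe (h3.congr_of_eventuallyEq e1)
  have hσd := hσ.mdifferentiableAt (by simp)
  have f1 := mfderiv_comp (proj P q) (hR.mdifferentiableAt_coe _) hσd
  have f2 := mfderiv_comp (proj P q) (hR.mdifferentiableAt_proj _) hσd
  rw [e2.mfderiv_eq, mfderiv_id] at f2
  have f1' : mfderiv 𝓘(ℝ, EN) 𝓘(ℝ, E) ((fun q : P ↦ (q : M)) ∘ σ) (proj P q)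
      = (mfderiv 𝓘(ℝ, EN) 𝓘(ℝ, E) (m q) (proj P q) : EN →L[ℝ] E) := e1.mfderiv_eq
  rw [f1'] at f1
  have g1 : ∀ q' : P, q' = q → ∀ u : EP,
      (mfderiv 𝓘(ℝ, EP) 𝓘(ℝ, E) (fun q : P ↦ (q : M)) q' : EP →L[ℝ] E) u
        = (inclDeriv E q : EP →L[ℝ] E) u ∧
      (mfderiv 𝓘(ℝ, EP) 𝓘(ℝ, EN) (proj P) q' : EP →L[ℝ] EN) u
        = (projDeriv EN q : EP →L[ℝ] EN) u := by
    rintro q' rfl u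
    exact ⟨rfl, rfl⟩
  refine ⟨(mfderiv 𝓘(ℝ, EN) 𝓘(ℝ, EP) σ (proj P q) A : EP), ?_, ?_⟩
  · exact ((g1 _ hσq _).1.symm).trans
      (congrArg (fun T : EN →L[ℝ] E ↦ T A) f1).symm
  · exact ((g1 _ hσq _).2.symm).trans
      (congrArg (fun T : EN →L[ℝ] EN ↦ T A) f2).symm

end Derivatives

/-! ### Fundamental fields on the level set -/

section HorizontalLift

variable {E : Type*} [NormedAddCommGroup E] [NormedSpace ℝ E] [FiniteDimensional ℝ E]
  {M : Type*} [TopologicalSpace M] [ChartedSpace E M] [IsManifold 𝓘(ℝ, E) ∞ M]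
  {EG : Type*} [NormedAddCommGroup EG] [NormedSpace ℝ EG] [FiniteDimensional ℝ EG]
  {G : Type*} [Group G] [TopologicalSpace G] [ChartedSpace EG G] [LieGroup 𝓘(ℝ, EG) ∞ G]
  [MulAction G M] [ContMDiffSMul 𝓘(ℝ, EG) 𝓘(ℝ, E) ∞ G M]
  {EP EN : Type*} [NormedAddCommGroup EP] [NormedSpace ℝ EP] [FiniteDimensional ℝ EP]
  [NormedAddCommGroup EN] [NormedSpace ℝ EN] [FiniteDimensional ℝ EN]
  {c : ComplexStructure E M} {ν : M → (EG →L[ℝ] ℝ)} {ζ : EG →L[ℝ] ℝ}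
  {hinv : ∀ (a : G) (x : M), ν x = ζ → ν (a • x) = ζ}
  [ChartedSpace EP (level G ν ζ hinv)] [ChartedSpace EN (ReducedSpace G ν ζ hinv)]
  (hR : IsReduction E EP EN (level G ν ζ hinv))

/-- The fundamental fields on an invariant level set. -/
noncomputable def levelFundamentalMap (p : level G ν ζ hinv) :
    EG →L[ℝ] TangentSpace 𝓘(ℝ, EP) p :=
  mfderiv 𝓘(ℝ, EG) 𝓘(ℝ, EP) (fun a : G ↦ a • p) (1 : G)

include hR

lemma mdifferentiableAt_smul_level (p : level G ν ζ hinv) :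
    MDifferentiableAt 𝓘(ℝ, EG) 𝓘(ℝ, EP) (fun a : G ↦ a • p) (1 : G) :=
  (hR.contMDiffAt_of_coe (contMDiff_smul_point (E := E) (EG := EG) (p : M)
    (1 : G))).mdifferentiableAt (by simp)

lemma inclDeriv_levelFundamentalMap (p : level G ν ζ hinv) (ξ : EG) :
    inclDeriv (EP := EP) E p (levelFundamentalMap p ξ) = fundamentalMap G (p : M) ξ := by
  have h1 := mfderiv_comp (1 : G) (hR.mdifferentiableAt_coe ((1 : G) • p))
    (mdifferentiableAt_smul_level hR p)
  have h2 : ∀ q : level G ν ζ hinv, q = p → ∀ u : EP,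
      (mfderiv 𝓘(ℝ, EP) 𝓘(ℝ, E) (fun q : level G ν ζ hinv ↦ (q : M)) q : EP →L[ℝ] E) u
        = (inclDeriv E p : EP →L[ℝ] E) u := by
    rintro q rfl u; rfl
  exact ((h2 _ (one_smul G p) _).symm).trans (congrArg (fun T : EG →L[ℝ] E ↦ T ξ) h1).symm

lemma projDeriv_levelFundamentalMap (p : level G ν ζ hinv) (ξ : EG) :
    projDeriv EN p (levelFundamentalMap (EP := EP) p ξ) = 0 := by
  have h1 := mfderiv_comp (1 : G) (hR.mdifferentiableAt_proj ((1 : G) • p))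
    (mdifferentiableAt_smul_level hR p)
  have h2 : ∀ q : level G ν ζ hinv, q = p → ∀ u : EP,
      (mfderiv 𝓘(ℝ, EP) 𝓘(ℝ, EN) (proj (level G ν ζ hinv)) q : EP →L[ℝ] EN) u
        = (projDeriv EN p : EP →L[ℝ] EN) u := by
    rintro q rfl u; rfl
  have h3 : proj (level G ν ζ hinv) ∘ (fun a : G ↦ a • p) = fun _ ↦ proj (level G ν ζ hinv) p :=
    funext fun a ↦ (proj_eq_iff _).2 ⟨a⁻¹, by simp⟩
  rw [h3, mfderiv_const] at h1
  exact ((h2 _ (one_smul G p) _).symm).trans (congrArg (fun T : EG →L[ℝ] EN ↦ T ξ) h1).symm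

lemma momentDeriv_inclDeriv (hν : IsGMomentMap G c ν) (p : level G ν ζ hinv)
    (u : TangentSpace 𝓘(ℝ, EP) p) : momentDeriv ν (p : M) (inclDeriv E p u) = 0 := by
  have h1 := mfderiv_comp p (hν.smooth.mdifferentiableAt (by simp)) (hR.mdifferentiableAt_coe p)
  have h2 : ν ∘ (fun q : level G ν ζ hinv ↦ (q : M)) = fun _ ↦ ζ := funext fun q ↦ q.2
  rw [h2, mfderiv_const] at h1
  exact (congrArg (fun T : EP →L[ℝ] (EG →L[ℝ] ℝ) ↦ T u) h1).symm

end HorizontalLift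

/-! ### Projection along the orbits and its smoothness -/

section HorizontalProjection

variable {E : Type*} [NormedAddCommGroup E] [NormedSpace ℝ E] [FiniteDimensional ℝ E]
  {M : Type*} [TopologicalSpace M] [ChartedSpace E M] [IsManifold 𝓘(ℝ, E) ∞ M]
  {EG : Type*} [NormedAddCommGroup EG] [NormedSpace ℝ EG] [FiniteDimensional ℝ EG]
  {G : Type*} [Group G] [TopologicalSpace G] [ChartedSpace EG G] [LieGroup 𝓘(ℝ, EG) ∞ G]
  [MulAction G M] [ContMDiffSMul 𝓘(ℝ, EG) 𝓘(ℝ, E) ∞ G M]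
  {c : ComplexStructure E M} {ν : M → (EG →L[ℝ] ℝ)} (hν : IsGMomentMap G c ν)

/-- The projection of `T_x M` to the kernel of `J dν` along the fundamental fields. -/
noncomputable def horProj (x : M) : TangentSpace 𝓘(ℝ, E) x →L[ℝ] TangentSpace 𝓘(ℝ, E) x :=
  ContinuousLinearMap.id ℝ _ - fundamentalMap G x ∘L
    ((hν.transversalEquiv x).symm : (EG →L[ℝ] ℝ) →L[ℝ] EG) ∘L momentDeriv ν x ∘L c.J x

lemma horProj_apply (x : M) (v : TangentSpace 𝓘(ℝ, E) x) :
    horProj hν x v = v - fundamentalMap G x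
      ((hν.transversalEquiv x).symm (momentDeriv ν x (c.J x v))) := rfl

lemma momentDeriv_J_horProj (x : M) (v : TangentSpace 𝓘(ℝ, E) x) :
    momentDeriv ν x (c.J x (horProj hν x v)) = 0 := by
  rw [horProj_apply, map_sub, map_sub, ← hν.transversalEquiv_apply,
    ContinuousLinearEquiv.apply_symm_apply, sub_self]

section Smooth

variable {EB : Type*} [NormedAddCommGroup EB] [NormedSpace ℝ EB]
  {HB : Type*} [TopologicalSpace HB] {IB : ModelWithCorners ℝ EB HB}
  {B : Type*} [TopologicalSpace B] [ChartedSpace HB B] [IsManifold IB 1 B]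
  {b : B → M} {x : B}

omit [FiniteDimensional ℝ E] [IsManifold IB 1 B] in
lemma contMDiffAt_sub_along {V W : Π y, TangentSpace 𝓘(ℝ, E) (b y)}
    (hV : ContMDiffAt IB 𝓘(ℝ, E).tangent ∞ (fun y ↦ TotalSpace.mk' E (b y) (V y)) x)
    (hW : ContMDiffAt IB 𝓘(ℝ, E).tangent ∞ (fun y ↦ TotalSpace.mk' E (b y) (W y)) x) :
    ContMDiffAt IB 𝓘(ℝ, E).tangent ∞ (fun y ↦ TotalSpace.mk' E (b y) (V y - W y)) x := by
  rw [contMDiffAt_totalSpace] at hV hW ⊢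
  refine ⟨hV.1, (hV.2.sub hW.2).congr_of_eventuallyEq ?_⟩
  let e := trivializationAt E (TangentSpace 𝓘(ℝ, E) : M → Type _) (b x)
  filter_upwards [hV.1.continuousAt (e.open_baseSet.mem_nhds
    (FiberBundle.mem_baseSet_trivializationAt' (b x)))] with y hy
  exact (e.linear ℝ hy).map_sub (V y) (W y)

/-- The fundamental vector is the derivative at the constant point 1 of the smooth family of orbit
maps a ↦ a • b y. -/
lemma contMDiffAt_fundamentalMap (hb : ContMDiffAt IB 𝓘(ℝ, E) ∞ b x) {η : B → EG}
    (hη : ContMDiffAt IB 𝓘(ℝ, EG) ∞ η x) :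
    ContMDiffAt IB 𝓘(ℝ, E).tangent ∞
      (fun y ↦ TotalSpace.mk' E (b y) (fundamentalMap (E := E) (EG := EG) G (b y) (η y))) x := by
  haveI : IsManifold 𝓘(ℝ, EG) ∞ G := (inferInstance : ContMDiffMul 𝓘(ℝ, EG) ∞ G).toIsManifold
  have h1 : ContMDiffAt IB 𝓘(ℝ, EG).tangent ∞
      (fun y ↦ (TotalSpace.mk' EG (1 : G) (η y) : TangentBundle 𝓘(ℝ, EG) G)) x := by
    rw [contMDiffAt_totalSpace]
    refine ⟨contMDiffAt_const, ?_⟩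
    refine hη.congr_of_eventuallyEq (Filter.Eventually.of_forall fun y ↦ ?_)
    exact (tangentBundleCore 𝓘(ℝ, EG) G).coordChange_self (achart EG (1 : G)) 1
      (mem_chart_source EG (1 : G)) (η y)
  have h2 : ContMDiffAt (IB.prod 𝓘(ℝ, EG)) 𝓘(ℝ, E) ∞
      (Function.uncurry fun (y : B) (a : G) ↦ a • b y) (x, 1) :=
    ((contMDiff_smul_pair (E := E) (EG := EG) (M := M) G).contMDiffAt (x := (1, b x))).comp
      (x, (1 : G)) (contMDiffAt_snd.prodMk (hb.comp (x, (1 : G)) contMDiffAt_fst))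
  have h3 := contMDiffAt_mfderiv_family (b := fun _ ↦ (1 : G)) (f := fun (y : B) (a : G) ↦ a • b y)
    h2 h1
  refine h3.congr_of_eventuallyEq (Filter.Eventually.of_forall fun y ↦ ?_)
  have h4 : ∀ z : M, b y = z → ∀ v : E, (TotalSpace.mk' E (b y) v : TangentBundle 𝓘(ℝ, E) M)
    = TotalSpace.mk' E z v := by rintro z rfl v; rfl
  exact h4 _ (one_smul G (b y)).symm _

lemma contMDiffAt_momentDeriv (hν : IsGMomentMap G c ν) {V : Π y, TangentSpace 𝓘(ℝ, E) (b y)}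
    (hV : ContMDiffAt IB 𝓘(ℝ, E).tangent ∞ (fun y ↦ TotalSpace.mk' E (b y) (V y)) x) :
    ContMDiffAt IB 𝓘(ℝ, EG →L[ℝ] ℝ) ∞ (fun y ↦ momentDeriv ν (b y) (V y)) x :=
  contMDiffAt_mvfderiv_apply hν.smooth.contMDiffAt hV

lemma contMDiffAt_horProj {V : Π y, TangentSpace 𝓘(ℝ, E) (b y)}
    (hV : ContMDiffAt IB 𝓘(ℝ, E).tangent ∞ (fun y ↦ TotalSpace.mk' E (b y) (V y)) x) :
    ContMDiffAt IB 𝓘(ℝ, E).tangent ∞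
      (fun y ↦ TotalSpace.mk' E (b y) (horProj hν (b y) (V y))) x := by
  have hb : ContMDiffAt IB 𝓘(ℝ, E) ∞ b x := by
    simp only [contMDiffAt_totalSpace] at hV
    exact hV.1
  have h1 : ContMDiffAt IB 𝓘(ℝ, EG →L[ℝ] (EG →L[ℝ] ℝ)) ∞
      (fun y ↦ (hν.transversalEquiv (b y) : EG →L[ℝ] (EG →L[ℝ] ℝ))) x :=
    contMDiffAt_clm_of_apply fun ξ ↦ contMDiffAt_momentDeriv hν
      (c.contMDiffAt_J le_rfl (contMDiffAt_fundamentalMap hb contMDiffAt_const))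
  haveI : CompleteSpace EG := FiniteDimensional.complete ℝ EG
  have h2 : ContMDiffAt IB 𝓘(ℝ, (EG →L[ℝ] ℝ) →L[ℝ] EG) ∞
      (fun y ↦ ContinuousLinearMap.inverse
        (hν.transversalEquiv (b y) : EG →L[ℝ] (EG →L[ℝ] ℝ))) x :=
    (contDiffAt_map_inverse (𝕜 := ℝ) (n := ∞) (hν.transversalEquiv (b x))).contMDiffAt.comp x h1
  have h3 : ContMDiffAt IB 𝓘(ℝ, EG →L[ℝ] ℝ) ∞
      (fun y ↦ momentDeriv ν (b y) (c.J (b y) (V y))) x :=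
    contMDiffAt_momentDeriv hν (c.contMDiffAt_J le_rfl hV)
  have h4 : ContMDiffAt IB 𝓘(ℝ, EG) ∞ (fun y ↦ (hν.transversalEquiv (b y)).symm
      (momentDeriv ν (b y) (c.J (b y) (V y)))) x := by
    refine (h2.clm_apply h3).congr_of_eventuallyEq (Filter.Eventually.of_forall fun y ↦ ?_)
    simp only [ContinuousLinearMap.inverse_equiv]
    rfl
  have h5 := contMDiffAt_fundamentalMap (G := G) hb h4
  exact contMDiffAt_sub_along hV h5

end Smooth
end HorizontalProjection

/-! ### Horizontal lifts -/

section HorizontalLift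

variable {E : Type*} [NormedAddCommGroup E] [NormedSpace ℝ E] [FiniteDimensional ℝ E]
  {M : Type*} [TopologicalSpace M] [ChartedSpace E M] [IsManifold 𝓘(ℝ, E) ∞ M]
  {EG : Type*} [NormedAddCommGroup EG] [NormedSpace ℝ EG] [FiniteDimensional ℝ EG]
  {G : Type*} [Group G] [TopologicalSpace G] [ChartedSpace EG G] [LieGroup 𝓘(ℝ, EG) ∞ G]
  [MulAction G M] [ContMDiffSMul 𝓘(ℝ, EG) 𝓘(ℝ, E) ∞ G M]
  {EP EN : Type*} [NormedAddCommGroup EP] [NormedSpace ℝ EP] [FiniteDimensional ℝ EP]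
  [NormedAddCommGroup EN] [NormedSpace ℝ EN] [FiniteDimensional ℝ EN]
  {c : ComplexStructure E M} {ν : M → (EG →L[ℝ] ℝ)} (hν : IsGMomentMap G c ν) {ζ : EG →L[ℝ] ℝ}
  {hinv : ∀ (a : G) (x : M), ν x = ζ → ν (a • x) = ζ}
  [ChartedSpace EP (level G ν ζ hinv)] [ChartedSpace EN (ReducedSpace G ν ζ hinv)]
  (hR : IsReduction E EP EN (level G ν ζ hinv))
  {p : level G ν ζ hinv}

omit [FiniteDimensional ℝ E] [FiniteDimensional ℝ EG] [FiniteDimensional ℝ EP]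
  [FiniteDimensional ℝ EN] in
lemma isHorizontalLift_iff {A : TangentSpace 𝓘(ℝ, EN) (proj (level G ν ζ hinv) p)}
    {t : TangentSpace 𝓘(ℝ, E) (p : M)} :
    IsHorizontalLift (EP := EP) c ν (level G ν ζ hinv) p A t ↔
      (momentDeriv ν (p : M) t = 0 ∧ momentDeriv ν (p : M) (c.J (p : M) t) = 0) ∧
        ProjectsTo (EP := EP) E p t A := Iff.rfl

include hR

/-- `horProj` subtracts a fundamental vector, which is tangent to `P` and killed by dπ, so neither
tangency nor the projected vector changes. -/
lemma isHorizontalLift_horProj {A : TangentSpace 𝓘(ℝ, EN) (proj (level G ν ζ hinv) p)}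
    {t : TangentSpace 𝓘(ℝ, E) (p : M)} (h : ProjectsTo (EP := EP) E p t A) :
    IsHorizontalLift (EP := EP) c ν (level G ν ζ hinv) p A (horProj hν (p : M) t) := by
  obtain ⟨u, rfl, rfl⟩ := h
  have h1 : ProjectsTo (EP := EP) (EN := EN) E p (horProj hν (p : M) (inclDeriv E p u))
      (projDeriv EN p u) := by
    refine ⟨u - levelFundamentalMap p ((hν.transversalEquiv (p : M)).symm
      (momentDeriv ν (p : M) (c.J (p : M) (inclDeriv E p u)))), ?_, ?_⟩
    · rw [map_sub, inclDeriv_levelFundamentalMap hR, horProj_apply]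
    · rw [map_sub, projDeriv_levelFundamentalMap hR, sub_zero]
  refine isHorizontalLift_iff.2 ⟨⟨?_, momentDeriv_J_horProj hν _ _⟩, h1⟩
  obtain ⟨u', hu', -⟩ := h1
  rw [← hu']
  exact momentDeriv_inclDeriv hR hν p u'

lemma IsReduction.exists_projectsTo (A : TangentSpace 𝓘(ℝ, EN) (proj (level G ν ζ hinv) p)) :
    ∃ t, ProjectsTo (EP := EP) E p t A := by
  obtain ⟨ρ, m, h1, h2, h3, h4, h5⟩ := hR.exists_local p
  have h6 : m p (proj _ p) = p := by
    have := h4.self_of_nhds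
    rwa [h2.self_of_nhds] at this
  refine ⟨_, mfderiv_slice_projectsTo hR h3.self_of_nhds h6 ?_ A⟩
  rw [nhds_prod_eq] at h5
  exact h5.curry.self_of_nhds

lemma projDeriv_surjective (p : level G ν ζ hinv) :
    Function.Surjective (projDeriv (EP := EP) EN p) := fun A ↦ by
  obtain ⟨t, u, -, hu⟩ := hR.exists_projectsTo (p := p) A
  exact ⟨u, hu⟩

/-- The fundamental vectors lie in the kernel of dπ and fill it, both having dimension dim G. -/
lemma exists_eq_levelFundamentalMap (hν : IsGMomentMap G c ν)
    (hdim : Module.finrank ℝ EP = Module.finrank ℝ EN + Module.finrank ℝ EG)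
    {u : TangentSpace 𝓘(ℝ, EP) p} (hu : projDeriv EN p u = 0) :
    ∃ ξ : EG, levelFundamentalMap p ξ = u := by
  let T : EP →ₗ[ℝ] EN := (projDeriv (EP := EP) EN p).toLinearMap
  let S : EG →ₗ[ℝ] EP := (levelFundamentalMap (EP := EP) p).toLinearMap
  have hT : LinearMap.range T = ⊤ := LinearMap.range_eq_top.2 (projDeriv_surjective hR p)
  have hS : Function.Injective S := fun ξ η h ↦ hν.injective_fundamentalMap (p : M) (by
    rw [← inclDeriv_levelFundamentalMap hR, ← inclDeriv_levelFundamentalMap hR]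
    exact congrArg _ h)
  have h1 := LinearMap.finrank_range_add_finrank_ker T
  rw [hT, finrank_top] at h1
  have h2 : LinearMap.range S ≤ LinearMap.ker T := by
    rintro _ ⟨ξ, rfl⟩
    exact projDeriv_levelFundamentalMap hR p ξ
  have h3 : LinearMap.range S = LinearMap.ker T :=
    Submodule.eq_of_le_of_finrank_eq h2 (by rw [LinearMap.finrank_range_of_inj hS]; omega)
  have h4 : (u : EP) ∈ LinearMap.ker T := hu
  rw [← h3] at h4
  exact h4

/-- Two lifts differ by a fundamental vector ξ_M with dν(Jξ_M) = 0, and transversality gives ξ = 0.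
-/
lemma IsHorizontalLift.unique (hν : IsGMomentMap G c ν)
    (hdim : Module.finrank ℝ EP = Module.finrank ℝ EN + Module.finrank ℝ EG)
    {A : TangentSpace 𝓘(ℝ, EN) (proj (level G ν ζ hinv) p)} {t t' : TangentSpace 𝓘(ℝ, E) (p : M)}
    (h : IsHorizontalLift (EP := EP) c ν (level G ν ζ hinv) p A t)
    (h' : IsHorizontalLift (EP := EP) c ν (level G ν ζ hinv) p A t') : t = t' := by
  obtain ⟨⟨-, h1⟩, u, rfl, h2⟩ := isHorizontalLift_iff.1 h
  obtain ⟨⟨-, h1'⟩, u', rfl, h2'⟩ := isHorizontalLift_iff.1 h'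
  obtain ⟨ξ, hξ⟩ := exists_eq_levelFundamentalMap hR hν hdim (u := u - u')
    (by rw [map_sub, h2, h2', sub_self])
  have h3 : hν.transversalEquiv (p : M) ξ = 0 := by
    rw [hν.transversalEquiv_apply, ← inclDeriv_levelFundamentalMap (EP := EP) hR, hξ, map_sub,
      map_sub, map_sub, h1, h1', sub_self]
  have h4 : ξ = 0 := by simpa using h3
  rw [h4, map_zero] at hξ
  rw [sub_eq_zero.1 hξ.symm]

theorem existsUnique_isHorizontalLift (hν : IsGMomentMap G c ν)
    (hdim : Module.finrank ℝ EP = Module.finrank ℝ EN + Module.finrank ℝ EG)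
    (A : TangentSpace 𝓘(ℝ, EN) (proj (level G ν ζ hinv) p)) :
    ∃! t, IsHorizontalLift (EP := EP) c ν (level G ν ζ hinv) p A t := by
  obtain ⟨t, ht⟩ := hR.exists_projectsTo A
  exact ⟨_, isHorizontalLift_horProj hν hR ht,
    fun t' ht' ↦ ht'.unique hR hν hdim (isHorizontalLift_horProj hν hR ht)⟩

/-- The image of a horizontal lift under an element of the group is a horizontal lift. -/
lemma IsHorizontalLift.smul (hν : IsGMomentMap G c ν)
    (hhol : ∀ (a : G) (x : M) (v : TangentSpace 𝓘(ℝ, E) x),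
      mfderiv 𝓘(ℝ, E) 𝓘(ℝ, E) (fun y : M ↦ a • y) x (c.J x v)
        = c.J (a • x) (mfderiv 𝓘(ℝ, E) 𝓘(ℝ, E) (fun y : M ↦ a • y) x v)) (a : G)
    {A : TangentSpace 𝓘(ℝ, EN) (proj (level G ν ζ hinv) p)} {t : TangentSpace 𝓘(ℝ, E) (p : M)}
    (h : IsHorizontalLift (EP := EP) c ν (level G ν ζ hinv) p A t) :
    IsHorizontalLift (EP := EP) c ν (level G ν ζ hinv) (a • p) (A : EN)
      (mfderiv 𝓘(ℝ, E) 𝓘(ℝ, E) (fun y : M ↦ a • y) (p : M) t) := by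
  obtain ⟨⟨h1, h2⟩, u, rfl, rfl⟩ := isHorizontalLift_iff.1 h
  have ha := (contMDiff_const_smul_point (E := E) (M := M) EG a).mdifferentiableAt
    (x := (p : M)) (by simp)
  -- The coadjoint action of `a`. Since ν ∘ a = C ∘ ν with `C` linear, the differential of `a` maps
  -- the kernel of dν into the kernel of dν.
  let C : (EG →L[ℝ] ℝ) →L[ℝ] (EG →L[ℝ] ℝ) := ContinuousLinearMap.precomp ℝ
    (mfderiv 𝓘(ℝ, EG) 𝓘(ℝ, EG) (fun b : G ↦ a⁻¹ * b * a⁻¹⁻¹) (1 : G) : EG →L[ℝ] EG)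
  have hC : ν ∘ (fun y : M ↦ a • y) = C ∘ ν := by
    ext x ξ
    exact hν.equivariant a x ξ
  have hD : ∀ v : TangentSpace 𝓘(ℝ, E) (p : M), momentDeriv ν (p : M) v = 0 →
      momentDeriv ν (a • (p : M)) (mfderiv 𝓘(ℝ, E) 𝓘(ℝ, E) (fun y : M ↦ a • y) (p : M) v) = 0 := by
    intro v hv
    have hνd : ∀ x, MDifferentiableAt 𝓘(ℝ, E) 𝓘(ℝ, EG →L[ℝ] ℝ) ν x := fun x ↦
      hν.smooth.mdifferentiableAt (by simp)
    have f1 := mfderiv_comp (p : M) (hνd (a • (p : M))) ha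
    have f2 := mfderiv_comp (p : M) C.mdifferentiableAt (hνd (p : M))
    rw [hC, f2] at f1
    have f3 := congrArg (fun T : E →L[ℝ] (EG →L[ℝ] ℝ) ↦ T v) f1
    refine f3.symm.trans ?_
    refine (congrArg (mfderiv 𝓘(ℝ, EG →L[ℝ] ℝ) 𝓘(ℝ, EG →L[ℝ] ℝ) C (ν p)) hv).trans
      (ContinuousLinearMap.map_zero _)
  refine isHorizontalLift_iff.2 ⟨⟨hD _ h1, ?_⟩, ?_⟩
  · have := hD _ h2
    rw [hhol] at this
    exact this
  · have hs : MDifferentiableAt 𝓘(ℝ, EP) 𝓘(ℝ, EP) (fun q : level G ν ζ hinv ↦ a • q) p :=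
      (hR.contMDiffAt_of_coe (((contMDiff_const_smul_point (E := E) (M := M) EG a).contMDiffAt
        (x := (p : M))).comp p (hR.contMDiff_coe p))).mdifferentiableAt (by simp)
    refine ⟨mfderiv 𝓘(ℝ, EP) 𝓘(ℝ, EP) (fun q : level G ν ζ hinv ↦ a • q) p u, ?_, ?_⟩
    · have f1 := mfderiv_comp p (hR.mdifferentiableAt_coe (a • p)) hs
      have f2 := mfderiv_comp p ha (hR.mdifferentiableAt_coe p)
      exact (congrArg (fun T : EP →L[ℝ] E ↦ T u) f1).symm.trans
        (congrArg (fun T : EP →L[ℝ] E ↦ T u) f2)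
    · have f1 := mfderiv_comp p (hR.mdifferentiableAt_proj (a • p)) hs
      have f2 : proj (level G ν ζ hinv) ∘ (fun q ↦ a • q) = proj (level G ν ζ hinv) :=
        funext fun q ↦ (proj_eq_iff _).2 ⟨a⁻¹, by simp⟩
      rw [f2] at f1
      exact (congrArg (fun T : EP →L[ℝ] EN ↦ T u) f1).symm

end HorizontalLift

/-- If c > 0 is the minimum of the form on the unit sphere, then B(v,v) ≥ c‖v‖². This boundedness is
part of the data of a bundled Riemannian metric. -/
lemma isVonNBounded_of_pos {F : Type*} [NormedAddCommGroup F] [NormedSpace ℝ F]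
    [FiniteDimensional ℝ F] (B : F →L[ℝ] F →L[ℝ] ℝ) (hB : ∀ v, v ≠ 0 → 0 < B v v) :
    Bornology.IsVonNBounded ℝ {v : F | B v v < 1} := by
  haveI : ProperSpace F := FiniteDimensional.proper ℝ F
  rw [NormedSpace.isVonNBounded_iff]
  rcases subsingleton_or_nontrivial F with hF | hF
  · exact (Set.toFinite _).isBounded
  have hcont : Continuous fun v : F ↦ B v v := by fun_prop
  obtain ⟨v₀, hv₀, hmin⟩ := (isCompact_sphere (0 : F) 1).exists_isMinOn
    (NormedSpace.sphere_nonempty.2 zero_le_one) hcont.continuousOn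
  have hc : 0 < B v₀ v₀ := hB v₀ (by rintro rfl; simp at hv₀)
  refine isBounded_iff_forall_norm_le.2 ⟨(B v₀ v₀)⁻¹ + 1, fun v hv ↦ ?_⟩
  by_contra! hlt
  have hpos : 0 < ‖v‖ := lt_trans (by positivity) hlt
  have h1 : B v₀ v₀ ≤ B (‖v‖⁻¹ • v) (‖v‖⁻¹ • v) := hmin (by
    simp [norm_smul, hpos.ne'])
  simp only [map_smul, smul_apply, smul_eq_mul] at h1
  have h2 : B v₀ v₀ * (‖v‖ * ‖v‖) ≤ B v v := by
    calc B v₀ v₀ * (‖v‖ * ‖v‖) ≤ (‖v‖⁻¹ * (‖v‖⁻¹ * B v v)) * (‖v‖ * ‖v‖) := by gcongr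
      _ = B v v := by field_simp
  have h3 : 1 ≤ ‖v‖ := le_trans (by linarith [inv_pos.2 hc]) hlt.le
  have h4 : 1 ≤ B v₀ v₀ * ‖v‖ := by
    calc (1 : ℝ) = B v₀ v₀ * (B v₀ v₀)⁻¹ := (mul_inv_cancel₀ hc.ne').symm
      _ ≤ B v₀ v₀ * ‖v‖ := by gcongr; linarith
  have h5 : B v v < 1 := hv
  nlinarith

/-! ### The induced complex structure at a point of the level set -/

section HorizontalLift

variable {E : Type*} [NormedAddCommGroup E] [NormedSpace ℝ E] [FiniteDimensional ℝ E]
  {M : Type*} [TopologicalSpace M] [ChartedSpace E M] [IsManifold 𝓘(ℝ, E) ∞ M]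
  {EG : Type*} [NormedAddCommGroup EG] [NormedSpace ℝ EG] [FiniteDimensional ℝ EG]
  {G : Type*} [Group G] [TopologicalSpace G] [ChartedSpace EG G] [LieGroup 𝓘(ℝ, EG) ∞ G]
  [MulAction G M] [ContMDiffSMul 𝓘(ℝ, EG) 𝓘(ℝ, E) ∞ G M]
  {EP EN : Type*} [NormedAddCommGroup EP] [NormedSpace ℝ EP] [FiniteDimensional ℝ EP]
  [NormedAddCommGroup EN] [NormedSpace ℝ EN] [FiniteDimensional ℝ EN]
  {c : ComplexStructure E M} {ν : M → (EG →L[ℝ] ℝ)} (hν : IsGMomentMap G c ν) {ζ : EG →L[ℝ] ℝ}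
  {hinv : ∀ (a : G) (x : M), ν x = ζ → ν (a • x) = ζ}
  [ChartedSpace EP (level G ν ζ hinv)] [ChartedSpace EN (ReducedSpace G ν ζ hinv)]
  (hR : IsReduction E EP EN (level G ν ζ hinv))
  (hdim : Module.finrank ℝ EP = Module.finrank ℝ EN + Module.finrank ℝ EG)
  (hdimP : Module.finrank ℝ E = Module.finrank ℝ EP + Module.finrank ℝ EG)
  {p : level G ν ζ hinv}

lemma IsHorizontalLift.add {A B : TangentSpace 𝓘(ℝ, EN) (proj (level G ν ζ hinv) p)}
    {s t : TangentSpace 𝓘(ℝ, E) (p : M)}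
    (hA : IsHorizontalLift (EP := EP) c ν (level G ν ζ hinv) p A s)
    (hB : IsHorizontalLift (EP := EP) c ν (level G ν ζ hinv) p B t) :
    IsHorizontalLift (EP := EP) c ν (level G ν ζ hinv) p (A + B) (s + t) := by
  rw [isHorizontalLift_iff] at *
  refine ⟨⟨?_, ?_⟩, hA.2.add hB.2⟩
  · rw [map_add, hA.1.1, hB.1.1, add_zero]
  · rw [map_add, map_add, hA.1.2, hB.1.2, add_zero]

lemma IsHorizontalLift.const_smul (r : ℝ)
    {A : TangentSpace 𝓘(ℝ, EN) (proj (level G ν ζ hinv) p)} {s : TangentSpace 𝓘(ℝ, E) (p : M)}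
    (hA : IsHorizontalLift (EP := EP) c ν (level G ν ζ hinv) p A s) :
    IsHorizontalLift (EP := EP) c ν (level G ν ζ hinv) p (r • A) (r • s) := by
  rw [isHorizontalLift_iff] at *
  obtain ⟨⟨h1, h2⟩, u, hu, hu'⟩ := hA
  refine ⟨⟨?_, ?_⟩, r • u, ?_, ?_⟩
  · rw [map_smul, h1, smul_zero]
  · rw [map_smul, map_smul, h2, smul_zero]
  · rw [map_smul, hu]
  · rw [map_smul, hu']

/-- The horizontal lift to `T_p M` of tangent vectors of the orbit space at `π p`. -/
noncomputable def horLift (p : level G ν ζ hinv) : EN →L[ℝ] E :=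
  LinearMap.toContinuousLinearMap
    { toFun := fun A ↦ (existsUnique_isHorizontalLift hR hν hdim (p := p) A).choose
      map_add' := fun A B ↦ by
        have h : ∀ C : EN, IsHorizontalLift (EP := EP) c ν (level G ν ζ hinv) p C
          (existsUnique_isHorizontalLift hR hν hdim (p := p) C).choose := fun C ↦
            (existsUnique_isHorizontalLift hR hν hdim (p := p) C).choose_spec.1
        exact (h (A + B)).unique hR hν hdim ((h A).add (h B))
      map_smul' := fun r A ↦ by
        have h : ∀ C : EN, IsHorizontalLift (EP := EP) c ν (level G ν ζ hinv) p C
          (existsUnique_isHorizontalLift hR hν hdim (p := p) C).choose := fun C ↦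
            (existsUnique_isHorizontalLift hR hν hdim (p := p) C).choose_spec.1
        exact (h (r • A)).unique hR hν hdim ((h A).const_smul r) }

lemma isHorizontalLift_horLift (p : level G ν ζ hinv) (A : EN) :
    IsHorizontalLift (EP := EP) c ν (level G ν ζ hinv) p A (horLift hν hR hdim p A) :=
  (existsUnique_isHorizontalLift hR hν hdim (p := p) A).choose_spec.1

lemma IsHorizontalLift.eq_horLift {A : EN} {s : TangentSpace 𝓘(ℝ, E) (p : M)}
    (h : IsHorizontalLift (EP := EP) c ν (level G ν ζ hinv) p A s) :
    s = horLift hν hR hdim p A :=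
  h.unique hR hν hdim (isHorizontalLift_horLift hν hR hdim p A)

lemma injective_horLift (p : level G ν ζ hinv) : Function.Injective (horLift hν hR hdim p) :=
  fun A B hAB ↦ by
    have h1 := (isHorizontalLift_iff.1 (isHorizontalLift_horLift hν hR hdim p A)).2
    have h2 := (isHorizontalLift_iff.1 (isHorizontalLift_horLift hν hR hdim p B)).2
    rw [hAB] at h1
    exact ProjectsTo.eq hR h1 h2

-- T_pP lies in the kernel of dν, and both have dimension dim M - dim G.
include hν hR hdimP in
lemma exists_inclDeriv_eq {t : TangentSpace 𝓘(ℝ, E) (p : M)} (ht : momentDeriv ν (p : M) t = 0) :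
    ∃ u, inclDeriv (EP := EP) E p u = t := by
  let T : E →ₗ[ℝ] (EG →L[ℝ] ℝ) := (momentDeriv (E := E) ν (p : M)).toLinearMap
  let S : EP →ₗ[ℝ] E := (inclDeriv (EP := EP) E p).toLinearMap
  have hT : LinearMap.range T = ⊤ := LinearMap.range_eq_top.2 (hν.surjective_momentDeriv (p : M))
  have hS : Function.Injective S := hR.injective_inclDeriv p
  have h1 := LinearMap.finrank_range_add_finrank_ker T
  rw [hT, finrank_top, finrank_dual_eq] at h1
  have h2 : LinearMap.range S ≤ LinearMap.ker T := by
    rintro _ ⟨u, rfl⟩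
    exact momentDeriv_inclDeriv hR hν p u
  have h3 : LinearMap.range S = LinearMap.ker T :=
    Submodule.eq_of_le_of_finrank_eq h2 (by rw [LinearMap.finrank_range_of_inj hS]; omega)
  have h4 : (t : E) ∈ LinearMap.ker T := ht
  rw [← h3] at h4
  exact h4

/-- The derivative at `p` of the projection to the orbit space, extended to a neighbourhood of `p`
by a retraction. -/
noncomputable def pushDown (p : level G ν ζ hinv) : E →L[ℝ] EN :=
  (projDeriv (EP := EP) EN p : EP →L[ℝ] EN) ∘L
    (mfderiv 𝓘(ℝ, E) 𝓘(ℝ, EP) (hR.exists_retraction p).choose (p : M) : E →L[ℝ] EP)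

lemma ProjectsTo.pushDown_eq {A : TangentSpace 𝓘(ℝ, EN) (proj (level G ν ζ hinv) p)}
    {t : TangentSpace 𝓘(ℝ, E) (p : M)} (h : ProjectsTo (EP := EP) E p t A) :
    pushDown hR p t = A := by
  obtain ⟨u, rfl, rfl⟩ := h
  obtain ⟨h1, h2⟩ := (hR.exists_retraction p).choose_spec
  exact congrArg (projDeriv (EP := EP) EN p : EP →L[ℝ] EN)
    (mfderiv_retraction_inclDeriv hR h1.self_of_nhds h2 u)

/-- The complex structure of the orbit space at `π p`. -/
noncomputable def reducedJAt (p : level G ν ζ hinv) : EN →L[ℝ] EN :=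
  pushDown hR p ∘L ContinuousLinearMap.comp (M₂ := E) (M₃ := E) (c.J (p : M)) (horLift hν hR hdim p)

-- J exchanges the equations dν(t) = 0 and dν(Jt) = 0 up to sign. In particular Jt is tangent to
-- `P`, so it projects to some vector of `N`, which is the value of `reducedJAt`.
include hdimP in
lemma IsHorizontalLift.J {A : EN} {s : TangentSpace 𝓘(ℝ, E) (p : M)}
    (h : IsHorizontalLift (EP := EP) c ν (level G ν ζ hinv) p A s) :
    IsHorizontalLift (EP := EP) c ν (level G ν ζ hinv) p (reducedJAt hν hR hdim p A)
      (c.J (p : M) s) := by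
  have h0 := h.eq_horLift hν hR hdim
  obtain ⟨⟨h1, h2⟩, -⟩ := isHorizontalLift_iff.1 h
  refine isHorizontalLift_iff.2 ⟨⟨h2, ?_⟩, ?_⟩
  · rw [c.J_J, map_neg, h1, neg_zero]
  · obtain ⟨u, hu⟩ := exists_inclDeriv_eq hν hR hdimP h2
    have h3 : ProjectsTo (EP := EP) E p (c.J (p : M) s) (projDeriv EN p u) := ⟨u, hu, rfl⟩
    have h4 : reducedJAt hν hR hdim p A = projDeriv EN p u := by
      rw [← h3.pushDown_eq hR, h0]
      rfl
    rw [h4]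
    exact h3

section Action

variable (hhol : ∀ (a : G) (x : M) (v : TangentSpace 𝓘(ℝ, E) x),
      mfderiv 𝓘(ℝ, E) 𝓘(ℝ, E) (fun y : M ↦ a • y) x (c.J x v)
        = c.J (a • x) (mfderiv 𝓘(ℝ, E) 𝓘(ℝ, E) (fun y : M ↦ a • y) x v))
include hhol

lemma horLift_smul (a : G) (A : EN) : horLift hν hR hdim (a • p) A =
    (mfderiv 𝓘(ℝ, E) 𝓘(ℝ, E) (fun y : M ↦ a • y) (p : M) : E →L[ℝ] E) (horLift hν hR hdim p A) :=
  (((isHorizontalLift_horLift hν hR hdim p A).smul hR hν hhol a).eq_horLift hν hR hdim).symm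

-- The lift at a • p is the image under `a` of the lift at `p`, and `a` is holomorphic; so the
-- operator depends only on the orbit.
include hdimP in
lemma reducedJAt_smul (a : G) :
    reducedJAt hν hR hdim (a • p) = reducedJAt hν hR hdim p := by
  ext A
  have h1 := ((isHorizontalLift_horLift hν hR hdim p A).J hν hR hdim hdimP).smul hR hν hhol a
  have h2 := (isHorizontalLift_horLift hν hR hdim (a • p) A).J hν hR hdim hdimP
  refine injective_horLift hν hR hdim (a • p) ?_
  rw [← h1.eq_horLift hν hR hdim, ← h2.eq_horLift hν hR hdim]
  exact (congrArg (c.J (a • (p : M)) : E →L[ℝ] E) (horLift_smul hν hR hdim hhol a A)).trans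
    (hhol a (p : M) _).symm

end Action
end HorizontalLift

/-! ### The induced metric at a point of the level set -/

section Metric

variable {E : Type*} [NormedAddCommGroup E] [NormedSpace ℝ E] [FiniteDimensional ℝ E]
  {M : Type*} [TopologicalSpace M] [ChartedSpace E M] [IsManifold 𝓘(ℝ, E) ∞ M]
  {EG : Type*} [NormedAddCommGroup EG] [NormedSpace ℝ EG] [FiniteDimensional ℝ EG]
  {G : Type*} [Group G] [TopologicalSpace G] [ChartedSpace EG G] [LieGroup 𝓘(ℝ, EG) ∞ G]
  [MulAction G M] [ContMDiffSMul 𝓘(ℝ, EG) 𝓘(ℝ, E) ∞ G M]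
  {EP EN : Type*} [NormedAddCommGroup EP] [NormedSpace ℝ EP] [FiniteDimensional ℝ EP]
  [NormedAddCommGroup EN] [NormedSpace ℝ EN] [FiniteDimensional ℝ EN]
  {h : HermitianStructure E M} {ν : M → (EG →L[ℝ] ℝ)}
  (hν : IsGMomentMap G h.toComplexStructure ν) {ζ : EG →L[ℝ] ℝ}
  {hinv : ∀ (a : G) (x : M), ν x = ζ → ν (a • x) = ζ}
  [ChartedSpace EP (level G ν ζ hinv)] [ChartedSpace EN (ReducedSpace G ν ζ hinv)]
  (hR : IsReduction E EP EN (level G ν ζ hinv))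
  (hdim : Module.finrank ℝ EP = Module.finrank ℝ EN + Module.finrank ℝ EG)
  (hdimP : Module.finrank ℝ E = Module.finrank ℝ EP + Module.finrank ℝ EG)
  (hG : ActsByComplexIsometries G h)
  {p : level G ν ζ hinv}

/-- The metric of the orbit space at `π p`. -/
noncomputable def reducedInnerAt (p : level G ν ζ hinv) : EN →L[ℝ] EN →L[ℝ] ℝ :=
  ContinuousLinearMap.bilinearComp (E := E) (F := E) (h.metric.inner (p : M)) (horLift hν hR hdim p)
    (horLift hν hR hdim p)

lemma reducedInnerAt_apply (p : level G ν ζ hinv) (A B : EN) :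
    reducedInnerAt hν hR hdim p A B
      = h.metric.inner (p : M) (horLift hν hR hdim p A) (horLift hν hR hdim p B) := rfl

include hG in
lemma reducedInnerAt_smul (a : G) :
    reducedInnerAt hν hR hdim (a • p) = reducedInnerAt hν hR hdim p := by
  ext A B
  rw [reducedInnerAt_apply, reducedInnerAt_apply, horLift_smul hν hR hdim hG.holomorphic,
    horLift_smul hν hR hdim hG.holomorphic]
  exact hG.isometry a (p : M) _ _

lemma reducedInnerAt_pos (p : level G ν ζ hinv) (A : EN) (hA : A ≠ 0) :
    0 < reducedInnerAt hν hR hdim p A A :=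
  h.metric.pos (p : M) _ fun h0 ↦ hA (injective_horLift hν hR hdim p (h0.trans (map_zero _).symm))

include hdimP in
lemma horLift_reducedJAt (p : level G ν ζ hinv) (A : EN) :
    horLift hν hR hdim p (reducedJAt hν hR hdim p A)
      = (h.J (p : M) : E →L[ℝ] E) (horLift hν hR hdim p A) :=
  (((isHorizontalLift_horLift hν hR hdim p A).J hν hR hdim hdimP).eq_horLift hν hR hdim).symm

include hdimP in
lemma reducedInnerAt_J (p : level G ν ζ hinv) (A B : EN) :
    reducedInnerAt hν hR hdim p (reducedJAt hν hR hdim p A) (reducedJAt hν hR hdim p B)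
      = reducedInnerAt hν hR hdim p A B := by
  rw [reducedInnerAt_apply, horLift_reducedJAt hν hR hdim hdimP,
    horLift_reducedJAt hν hR hdim hdimP]
  exact h.hermitian (p : M) _ _

include hdimP in
lemma reducedJAt_reducedJAt (p : level G ν ζ hinv) (A : EN) :
    reducedJAt hν hR hdim p (reducedJAt hν hR hdim p A) = -A := by
  refine injective_horLift hν hR hdim p ?_
  rw [horLift_reducedJAt hν hR hdim hdimP, horLift_reducedJAt hν hR hdim hdimP, map_neg]
  exact h.J_J (p : M) _

end Metric

/-! ### Descent to the orbit space and smoothness -/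

section Reduced

variable {E : Type*} [NormedAddCommGroup E] [NormedSpace ℝ E] [FiniteDimensional ℝ E]
  {M : Type*} [TopologicalSpace M] [ChartedSpace E M] [IsManifold 𝓘(ℝ, E) ∞ M]
  {EG : Type*} [NormedAddCommGroup EG] [NormedSpace ℝ EG] [FiniteDimensional ℝ EG]
  {G : Type*} [Group G] [TopologicalSpace G] [ChartedSpace EG G] [LieGroup 𝓘(ℝ, EG) ∞ G]
  [MulAction G M] [ContMDiffSMul 𝓘(ℝ, EG) 𝓘(ℝ, E) ∞ G M]
  {EP EN : Type*} [NormedAddCommGroup EP] [NormedSpace ℝ EP] [FiniteDimensional ℝ EP]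
  [NormedAddCommGroup EN] [NormedSpace ℝ EN] [FiniteDimensional ℝ EN]
  {h : HermitianStructure E M} {ν : M → (EG →L[ℝ] ℝ)}
  (hν : IsGMomentMap G h.toComplexStructure ν) {ζ : EG →L[ℝ] ℝ}
  {hinv : ∀ (a : G) (x : M), ν x = ζ → ν (a • x) = ζ}
  [ChartedSpace EP (level G ν ζ hinv)] [ChartedSpace EN (ReducedSpace G ν ζ hinv)]
  [IsManifold 𝓘(ℝ, EP) ∞ (level G ν ζ hinv)] [IsManifold 𝓘(ℝ, EN) ∞ (ReducedSpace G ν ζ hinv)]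
  (hR : IsReduction E EP EN (level G ν ζ hinv))
  (hdim : Module.finrank ℝ EP = Module.finrank ℝ EN + Module.finrank ℝ EG)
  (hdimP : Module.finrank ℝ E = Module.finrank ℝ EP + Module.finrank ℝ EG)
  (hG : ActsByComplexIsometries G h)

section LocalLift

include hR in
lemma ProjectsTo.mfderiv_eq {p : level G ν ζ hinv}
    {A : TangentSpace 𝓘(ℝ, EN) (proj (level G ν ζ hinv) p)} {t : TangentSpace 𝓘(ℝ, E) (p : M)}
    (hA : ProjectsTo (EP := EP) E p t A) {φ : M → ReducedSpace G ν ζ hinv}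
    (hφ : MDifferentiableAt 𝓘(ℝ, E) 𝓘(ℝ, EN) φ (p : M))
    (hφ' : ∀ᶠ q : level G ν ζ hinv in 𝓝 p, φ (q : M) = proj (level G ν ζ hinv) q) :
    (mfderiv 𝓘(ℝ, E) 𝓘(ℝ, EN) φ (p : M) t : EN) = A := by
  obtain ⟨u, rfl, rfl⟩ := hA
  have h1 := mfderiv_comp p hφ (hR.mdifferentiableAt_coe p)
  have h2 : φ ∘ (fun q : level G ν ζ hinv ↦ (q : M)) =ᶠ[𝓝 p] proj (level G ν ζ hinv) := hφ'
  have h3 : (mfderiv 𝓘(ℝ, EP) 𝓘(ℝ, EN) (φ ∘ (fun q : level G ν ζ hinv ↦ (q : M))) p : EP →L[ℝ] EN)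
    = mfderiv 𝓘(ℝ, EP) 𝓘(ℝ, EN) (proj (level G ν ζ hinv)) p := h2.mfderiv_eq
  exact (congrArg (fun T : EP →L[ℝ] EN ↦ T u) (h3.symm.trans h1)).symm

/-- A smooth extension of the projection to a neighbourhood of `p` in `M`, and a smooth family of
local sections, in terms of which horizontal lifts are given near `p`. -/
lemma exists_local_horLift (p : level G ν ζ hinv) :
    ∃ (φ : M → ReducedSpace G ν ζ hinv) (m : M → ReducedSpace G ν ζ hinv → M),
      (∀ᶠ x in 𝓝 (p : M), ContMDiffAt 𝓘(ℝ, E) 𝓘(ℝ, EN) ∞ φ x) ∧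
      (∀ᶠ q : level G ν ζ hinv in 𝓝 p, φ (q : M) = proj (level G ν ζ hinv) q) ∧
      (∀ᶠ z in 𝓝 ((p : M), proj (level G ν ζ hinv) p),
        ContMDiffAt (𝓘(ℝ, E).prod 𝓘(ℝ, EN)) 𝓘(ℝ, E) ∞ (Function.uncurry m) z) ∧
      (∀ᶠ x in 𝓝 (p : M), m x (φ x) = x) ∧
      (∀ᶠ z in 𝓝 (p, proj (level G ν ζ hinv) p), ∃ q : level G ν ζ hinv,
        (q : M) = m z.1 z.2 ∧ proj (level G ν ζ hinv) q = z.2) ∧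
      ∀ᶠ q : level G ν ζ hinv in 𝓝 p, ∀ A : EN, horLift hν hR hdim q A
        = horProj hν (q : M) (mfderiv 𝓘(ℝ, EN) 𝓘(ℝ, E) (m q) (proj (level G ν ζ hinv) q) A) := by
  obtain ⟨ρ, m, h1, h2, h3, h4, h5⟩ := hR.exists_local p
  -- π is extended off `P` by the retraction. At q in `P` near p, the section m q supplies a lift,
  -- which `horProj` makes horizontal.
  refine ⟨proj (level G ν ζ hinv) ∘ ρ, m, ?_, ?_, h3, h4, h5, ?_⟩
  · filter_upwards [h1] with x hx
    exact (hR.contMDiff_proj (ρ x)).comp x hx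
  · filter_upwards [h2] with q hq
    simp [hq]
  have hπ : Continuous (proj (level G ν ζ hinv)) := hR.contMDiff_proj.continuous
  have c1 : ContinuousAt (fun q : level G ν ζ hinv ↦ ((q : M), proj (level G ν ζ hinv) q)) p :=
    (continuous_subtype_val.prodMk hπ).continuousAt
  have c2 : ContinuousAt (fun q : level G ν ζ hinv ↦ (q, proj (level G ν ζ hinv) q)) p :=
    (continuous_id.prodMk hπ).continuousAt
  filter_upwards [h2, c1.eventually h3, continuous_subtype_val.continuousAt.eventually h4,
    c2.eventually (eventually_eventually_nhds.2 h5)] with q hq2 hq3 hq4 hq5 A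
  rw [hq2] at hq4
  rw [nhds_prod_eq] at hq5
  exact ((isHorizontalLift_horProj hν hR (mfderiv_slice_projectsTo hR hq3 hq4
    hq5.curry.self_of_nhds A)).eq_horLift hν hR hdim).symm

/-- A local section of the projection along which horizontal lifts of smooth fields are smooth. -/
lemma exists_section_horLift (p : level G ν ζ hinv) :
    ∃ σ : ReducedSpace G ν ζ hinv → level G ν ζ hinv,
      σ (proj (level G ν ζ hinv) p) = p ∧
      (∀ᶠ y in 𝓝 (proj (level G ν ζ hinv) p), proj (level G ν ζ hinv) (σ y) = y) ∧
      ContMDiffAt 𝓘(ℝ, EN) 𝓘(ℝ, E) ∞ (fun y ↦ (σ y : M)) (proj (level G ν ζ hinv) p) ∧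
      ∀ W : Π y : ReducedSpace G ν ζ hinv, TangentSpace 𝓘(ℝ, EN) y,
        CMDiffAt ∞ (T% W) (proj (level G ν ζ hinv) p) →
        ContMDiffAt 𝓘(ℝ, EN) 𝓘(ℝ, E).tangent ∞ (fun y ↦ (TotalSpace.mk' E (σ y : M)
          (horLift hν hR hdim (σ y) (W y)) : TangentBundle 𝓘(ℝ, E) M))
          (proj (level G ν ζ hinv) p) := by
  obtain ⟨φ, m, h1, h2, h3, h4, h5, h6⟩ := exists_local_horLift hν hR hdim p
  have hmp : m p (proj _ p) = p := by
    have := h4.self_of_nhds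
    rwa [h2.self_of_nhds] at this
  classical
  let σ : ReducedSpace G ν ζ hinv → level G ν ζ hinv := fun y ↦
    if h : ∃ q : level G ν ζ hinv, (q : M) = m p y ∧ proj (level G ν ζ hinv) q = y
    then h.choose else p
  have hσ1 : ∀ᶠ y in 𝓝 (proj (level G ν ζ hinv) p),
      (σ y : M) = m p y ∧ proj (level G ν ζ hinv) (σ y) = y := by
    rw [nhds_prod_eq] at h5
    filter_upwards [h5.curry.self_of_nhds] with y hy
    simp only [σ, dif_pos hy]
    exact hy.choose_spec
  have hσp : σ (proj (level G ν ζ hinv) p) = p := Subtype.ext (hσ1.self_of_nhds.1.trans hmp)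
  have hmpd : ContMDiffAt 𝓘(ℝ, EN) 𝓘(ℝ, E) ∞ (m p) (proj (level G ν ζ hinv) p) :=
    h3.self_of_nhds.comp _ (contMDiffAt_const.prodMk contMDiffAt_id)
  have hσ : ContMDiffAt 𝓘(ℝ, EN) 𝓘(ℝ, E) ∞ (fun y ↦ (σ y : M)) (proj (level G ν ζ hinv) p) :=
    hmpd.congr_of_eventuallyEq (hσ1.mono fun y hy ↦ hy.1)
  have hσc : ContinuousAt σ (proj (level G ν ζ hinv) p) :=
    Topology.IsInducing.subtypeVal.continuousAt_iff.2 hσ.continuousAt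
  refine ⟨σ, hσp, hσ1.mono fun y hy ↦ hy.2, hσ, fun W hW ↦ ?_⟩
  have h3' : ContMDiffAt (𝓘(ℝ, EN).prod 𝓘(ℝ, EN)) 𝓘(ℝ, E) ∞
      (Function.uncurry fun y : ReducedSpace G ν ζ hinv ↦ m (σ y))
      (proj (level G ν ζ hinv) p, proj (level G ν ζ hinv) p) := by
    have q1 : ContMDiffAt (𝓘(ℝ, EN).prod 𝓘(ℝ, EN)) 𝓘(ℝ, E) ∞
        (fun z : ReducedSpace G ν ζ hinv × ReducedSpace G ν ζ hinv ↦ (σ z.1 : M))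
        (proj (level G ν ζ hinv) p, proj (level G ν ζ hinv) p) :=
      ContMDiffAt.comp (I' := 𝓘(ℝ, EN)) (g := fun y ↦ (σ y : M)) (f := Prod.fst) _ hσ
        contMDiffAt_fst
    have q2 : ContMDiffAt (𝓘(ℝ, E).prod 𝓘(ℝ, EN)) 𝓘(ℝ, E) ∞ (Function.uncurry m)
        ((σ (proj (level G ν ζ hinv) p) : M), proj (level G ν ζ hinv) p) := by
      rw [hσp]
      exact h3.self_of_nhds
    exact ContMDiffAt.comp (I' := 𝓘(ℝ, E).prod 𝓘(ℝ, EN)) (g := Function.uncurry m)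
      (f := fun z : ReducedSpace G ν ζ hinv × ReducedSpace G ν ζ hinv ↦ ((σ z.1 : M), z.2)) _ q2
      (q1.prodMk contMDiffAt_snd)
  -- A smooth but not yet horizontal lift: at σ y it is the derivative of the slice map m (σ y) at y
  -- applied to W y.
  have t1 := contMDiffAt_mfderiv_family (b := id) (X := W) h3' hW
  have e0 : ∀ᶠ q : level G ν ζ hinv in 𝓝 (σ (proj (level G ν ζ hinv) p)),
      φ (q : M) = proj (level G ν ζ hinv) q ∧ m q (φ q) = q ∧
      ∀ A : EN, horLift hν hR hdim q A = horProj hν (q : M)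
        (mfderiv 𝓘(ℝ, EN) 𝓘(ℝ, E) (m q) (proj (level G ν ζ hinv) q) A) := by
    rw [hσp]
    exact h2.and ((continuous_subtype_val.continuousAt.eventually h4).and h6)
  have e1 := hσc.eventually e0
  have k1 : ∀ (x z : M), x = z → ∀ v : E, (TotalSpace.mk' E x v : TangentBundle 𝓘(ℝ, E) M)
    = TotalSpace.mk' E z v := by rintro x z rfl v; rfl
  have k2 : ∀ (f : ReducedSpace G ν ζ hinv → M) (y y' : ReducedSpace G ν ζ hinv), y = y' →
      ∀ A : EN, (mfderiv 𝓘(ℝ, EN) 𝓘(ℝ, E) f y A : E) = mfderiv 𝓘(ℝ, EN) 𝓘(ℝ, E) f y' A := by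
    rintro f y y' rfl A; rfl
  have t2 : ContMDiffAt 𝓘(ℝ, EN) 𝓘(ℝ, E).tangent ∞ (fun y ↦ (TotalSpace.mk' E (σ y : M)
      (mfderiv 𝓘(ℝ, EN) 𝓘(ℝ, E) (m (σ y)) y (W y) : E) : TangentBundle 𝓘(ℝ, E) M))
      (proj (level G ν ζ hinv) p) := by
    refine t1.congr_of_eventuallyEq ?_
    filter_upwards [e1, hσ1] with y hy hy'
    refine k1 _ _ ?_ _
    rw [hy.1, hy'.2] at hy
    exact hy.2.1.symm
  refine (contMDiffAt_horProj hν (b := fun y ↦ (σ y : M)) t2).congr_of_eventuallyEq ?_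
  filter_upwards [e1, hσ1] with y hy hy'
  refine congrArg (fun v : E ↦ (TotalSpace.mk' E (σ y : M) v : TangentBundle 𝓘(ℝ, E) M)) ?_
  exact (hy.2.2 (W y)).trans (congrArg (horProj hν (σ y : M) : E →L[ℝ] E) (k2 _ _ _ hy'.2 _))

end LocalLift

/-- The complex structure of the reduced space. -/
noncomputable def reducedJ (y : ReducedSpace G ν ζ hinv) :
    TangentSpace 𝓘(ℝ, EN) y →L[ℝ] TangentSpace 𝓘(ℝ, EN) y :=
  (show EN →L[ℝ] EN from reducedJAt hν hR hdim (Quotient.out y : level G ν ζ hinv))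

/-- The metric of the reduced space. -/
noncomputable def reducedInner (y : ReducedSpace G ν ζ hinv) :
    TangentSpace 𝓘(ℝ, EN) y →L[ℝ] TangentSpace 𝓘(ℝ, EN) y →L[ℝ] ℝ :=
  (show EN →L[ℝ] EN →L[ℝ] ℝ from reducedInnerAt hν hR hdim (Quotient.out y : level G ν ζ hinv))

lemma exists_smul_out_eq (p : level G ν ζ hinv) :
    ∃ a : G, a • (Quotient.out (proj (level G ν ζ hinv) p) : level G ν ζ hinv) = p := by
  obtain ⟨a, ha⟩ := (proj_eq_iff (level G ν ζ hinv)).1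
    (Quotient.out_eq (proj (level G ν ζ hinv) p))
  exact ⟨a, Subtype.ext ha⟩

-- Independence of the representative picked by `Quotient.out`: it is some a⁻¹ • p, and the operator
-- is constant on orbits.
include hdimP hG in
lemma reducedJ_proj (p : level G ν ζ hinv) :
    (reducedJ hν hR hdim (proj (level G ν ζ hinv) p) : EN →L[ℝ] EN) = reducedJAt hν hR hdim p := by
  obtain ⟨a, ha⟩ := exists_smul_out_eq p
  conv_rhs => rw [← ha, reducedJAt_smul hν hR hdim hdimP hG.holomorphic]
  rfl

include hG in
lemma reducedInner_proj (p : level G ν ζ hinv) :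
    (reducedInner hν hR hdim (proj (level G ν ζ hinv) p) : EN →L[ℝ] EN →L[ℝ] ℝ)
      = reducedInnerAt hν hR hdim p := by
  obtain ⟨a, ha⟩ := exists_smul_out_eq p
  conv_rhs => rw [← ha, reducedInnerAt_smul hν hR hdim hG]
  rfl

-- Near π p one has ĴW = dφ(J W^u) along a local section σ, where φ is a smooth extension of π; each
-- factor is smooth.
include hdimP hG in
lemma contMDiff_reducedJ : ContMDiff 𝓘(ℝ, EN) (𝓘(ℝ, EN).prod 𝓘(ℝ, EN →L[ℝ] EN)) ∞
    (fun y ↦ TotalSpace.mk' (EN →L[ℝ] EN) (E := fun y : ReducedSpace G ν ζ hinv ↦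
      TangentSpace 𝓘(ℝ, EN) y →L[ℝ] TangentSpace 𝓘(ℝ, EN) y) y (reducedJ hν hR hdim y)) := by
  intro y₀
  obtain ⟨p, rfl⟩ : ∃ p, proj (level G ν ζ hinv) p = y₀ := Quotient.exists_rep y₀
  refine contMDiffAt_hom_of_apply fun w ↦ ?_
  obtain ⟨φ, -, h1, h2, -⟩ := exists_local_horLift hν hR hdim p
  obtain ⟨σ, hσp, hσ, hσd, hlift⟩ := exists_section_horLift hν hR hdim p
  have hσc : ContinuousAt σ (proj (level G ν ζ hinv) p) :=
    Topology.IsInducing.subtypeVal.continuousAt_iff.2 hσd.continuousAt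
  have t1 := h.contMDiffAt_J (b := fun y ↦ (σ y : M)) le_rfl
    (hlift _ (contMDiffAt_symm_trivializationAt (proj (level G ν ζ hinv) p) w))
  have hφ : ContMDiffAt 𝓘(ℝ, E) 𝓘(ℝ, EN) ∞ φ (σ (proj (level G ν ζ hinv) p) : M) := by
    rw [hσp]
    exact h1.self_of_nhds
  have t2 := contMDiffAt_mfderiv_apply (b := fun y ↦ (σ y : M)) hφ t1
  refine t2.congr_of_eventuallyEq ?_
  have e0 : ∀ᶠ q : level G ν ζ hinv in 𝓝 (σ (proj (level G ν ζ hinv) p)),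
      ContMDiffAt 𝓘(ℝ, E) 𝓘(ℝ, EN) ∞ φ (q : M) ∧
      ∀ᶠ q' : level G ν ζ hinv in 𝓝 q, φ (q' : M) = proj (level G ν ζ hinv) q' := by
    rw [hσp]
    exact (continuous_subtype_val.continuousAt.eventually h1).and (eventually_eventually_nhds.2 h2)
  have k1 : ∀ (x z : ReducedSpace G ν ζ hinv), x = z → ∀ v v' : EN, v = v' →
      (TotalSpace.mk' EN x v : TangentBundle 𝓘(ℝ, EN) (ReducedSpace G ν ζ hinv))
        = TotalSpace.mk' EN z v' := by
    rintro x z rfl v v' rfl; rfl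
  filter_upwards [hσ, hσc.eventually e0] with y hy hy'
  refine k1 _ _ (hy.symm.trans hy'.2.self_of_nhds.symm) _ _ ?_
  have h4 := (isHorizontalLift_iff.1 ((isHorizontalLift_horLift hν hR hdim (σ y)
    ((trivializationAt EN (TangentSpace 𝓘(ℝ, EN)) (proj (level G ν ζ hinv) p)).symm y w)).J
      hν hR hdim hdimP)).2
  refine Eq.trans ?_ (h4.mfderiv_eq hR (hy'.1.mdifferentiableAt (by simp)) hy'.2).symm
  have h5 := reducedJ_proj hν hR hdim hdimP hG (σ y)
  rw [← h5]
  have k2 : ∀ z : ReducedSpace G ν ζ hinv, z = y → ∀ v : EN,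
      (reducedJ hν hR hdim y v : EN) = (reducedJ hν hR hdim z : EN →L[ℝ] EN) v := by
    rintro z rfl v; rfl
  exact k2 _ hy _

include hG in
lemma contMDiff_reducedInner : ContMDiff 𝓘(ℝ, EN) (𝓘(ℝ, EN).prod 𝓘(ℝ, EN →L[ℝ] EN →L[ℝ] ℝ)) ∞
    (fun y ↦ TotalSpace.mk' (EN →L[ℝ] EN →L[ℝ] ℝ) (E := fun y : ReducedSpace G ν ζ hinv ↦
      TangentSpace 𝓘(ℝ, EN) y →L[ℝ] TangentSpace 𝓘(ℝ, EN) y →L[ℝ] ℝ) y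
      (reducedInner hν hR hdim y)) := by
  intro y₀
  obtain ⟨p, rfl⟩ : ∃ p, proj (level G ν ζ hinv) p = y₀ := Quotient.exists_rep y₀
  refine contMDiffAt_hom_of_apply fun w ↦ ?_
  refine contMDiffAt_hom_of_apply (V' := Bundle.Trivial (ReducedSpace G ν ζ hinv) ℝ)
    fun w' ↦ ?_
  obtain ⟨σ, hσp, hσ, hσd, hlift⟩ := exists_section_horLift hν hR hdim p
  have t1 := h.contMDiffAt_inner (b := fun y ↦ (σ y : M)) le_rfl
    (hlift _ (contMDiffAt_symm_trivializationAt (proj (level G ν ζ hinv) p) w))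
    (hlift _ (contMDiffAt_symm_trivializationAt (proj (level G ν ζ hinv) p) w'))
  rw [contMDiffAt_section]
  refine t1.congr_of_eventuallyEq ?_
  filter_upwards [hσ] with y hy
  have h5 := reducedInner_proj hν hR hdim hG (σ y)
  have k2 : ∀ z : ReducedSpace G ν ζ hinv, z = y → ∀ v v' : EN,
      reducedInner hν hR hdim y v v' = (reducedInner hν hR hdim z : EN →L[ℝ] EN →L[ℝ] ℝ) v v' := by
    rintro z rfl v v'; rfl
  refine (k2 _ hy _ _).trans ?_
  rw [h5]
  rfl

end Reduced

/-! ### Lifts of fields differentiable at a point -/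

section Along

variable {EB : Type*} [NormedAddCommGroup EB] [NormedSpace ℝ EB]
  {HB : Type*} [TopologicalSpace HB] {IB : ModelWithCorners ℝ EB HB}
  {B : Type*} [TopologicalSpace B] [ChartedSpace HB B] [IsManifold IB 1 B]
  {E : Type*} [NormedAddCommGroup E] [NormedSpace ℝ E]
  {M : Type*} [TopologicalSpace M] [ChartedSpace E M] [IsManifold 𝓘(ℝ, E) ∞ M]
  {E' : Type*} [NormedAddCommGroup E'] [NormedSpace ℝ E']
  {M' : Type*} [TopologicalSpace M'] [ChartedSpace E' M'] [IsManifold 𝓘(ℝ, E') ∞ M']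

/-- Integrability has to be verified for fields that are merely differentiable at one point, so the
smooth version does not suffice. -/
lemma mdifferentiableAt_mfderiv_family {b : B → M} {f : B → M → M'} {x : B}
    {X : Π y, TangentSpace 𝓘(ℝ, E) (b y)}
    (hf : ContMDiffAt (IB.prod 𝓘(ℝ, E)) 𝓘(ℝ, E') ∞ (Function.uncurry f) (x, b x))
    (hb : ContMDiffAt IB 𝓘(ℝ, E) ∞ b x)
    (hX : MDifferentiableAt IB 𝓘(ℝ, E).tangent (fun y ↦ TotalSpace.mk' E (b y) (X y)) x) :
    MDifferentiableAt IB 𝓘(ℝ, E').tangent (fun y ↦ TotalSpace.mk' E' (f y (b y))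
      (mfderiv 𝓘(ℝ, E) 𝓘(ℝ, E') (f y) (b y) (X y))) x := by
  have h1 := (ContMDiffAt.mfderiv (m := ∞) f b hf hb (by simp)).mdifferentiableAt (by simp)
  refine MDifferentiableAt.clm_apply_of_inCoordinates (b₂ := fun y ↦ f y (b y)) h1 hX ?_
  exact (hf.comp x (contMDiffAt_id.prodMk hb)).mdifferentiableAt (by simp)

variable [FiniteDimensional ℝ E]
  {EG : Type*} [NormedAddCommGroup EG] [NormedSpace ℝ EG] [FiniteDimensional ℝ EG]
  {G : Type*} [Group G] [TopologicalSpace G] [ChartedSpace EG G] [LieGroup 𝓘(ℝ, EG) ∞ G]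
  [MulAction G M] [ContMDiffSMul 𝓘(ℝ, EG) 𝓘(ℝ, E) ∞ G M]
  {c : ComplexStructure E M} {ν : M → (EG →L[ℝ] ℝ)}

lemma mdifferentiableAt_horProj (hν : IsGMomentMap G c ν) {x : M}
    {X : Π y : M, TangentSpace 𝓘(ℝ, E) y} (hX : MDiffAt (T% X) x) :
    MDiffAt (T% (fun y ↦ horProj hν y (X y))) x := by
  have h1 : ContMDiffAt 𝓘(ℝ, E) (𝓘(ℝ, E).prod 𝓘(ℝ, E →L[ℝ] E)) ∞
      (fun y ↦ TotalSpace.mk' (E →L[ℝ] E)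
        (E := fun y : M ↦ TangentSpace 𝓘(ℝ, E) y →L[ℝ] TangentSpace 𝓘(ℝ, E) y) y
        (horProj hν y)) x :=
    contMDiffAt_hom_of_apply fun w ↦ contMDiffAt_horProj hν (b := id)
      (contMDiffAt_symm_trivializationAt x w)
  exact MDifferentiableAt.clm_bundle_apply (b := id) (F₁ := E) (F₂ := E)
    (h1.mdifferentiableAt (by simp)) hX

end Along

/-! ### Integrability and the reduced Hermitian structure -/

section Reduced

variable {E : Type*} [NormedAddCommGroup E] [NormedSpace ℝ E] [FiniteDimensional ℝ E]
  {M : Type*} [TopologicalSpace M] [ChartedSpace E M] [IsManifold 𝓘(ℝ, E) ∞ M]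
  {EG : Type*} [NormedAddCommGroup EG] [NormedSpace ℝ EG] [FiniteDimensional ℝ EG]
  {G : Type*} [Group G] [TopologicalSpace G] [ChartedSpace EG G] [LieGroup 𝓘(ℝ, EG) ∞ G]
  [MulAction G M] [ContMDiffSMul 𝓘(ℝ, EG) 𝓘(ℝ, E) ∞ G M]
  {EP EN : Type*} [NormedAddCommGroup EP] [NormedSpace ℝ EP] [FiniteDimensional ℝ EP]
  [NormedAddCommGroup EN] [NormedSpace ℝ EN] [FiniteDimensional ℝ EN]
  {h : HermitianStructure E M} {ν : M → (EG →L[ℝ] ℝ)}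
  (hν : IsGMomentMap G h.toComplexStructure ν) {ζ : EG →L[ℝ] ℝ}
  {hinv : ∀ (a : G) (x : M), ν x = ζ → ν (a • x) = ζ}
  [ChartedSpace EP (level G ν ζ hinv)] [ChartedSpace EN (ReducedSpace G ν ζ hinv)]
  [IsManifold 𝓘(ℝ, EP) ∞ (level G ν ζ hinv)] [IsManifold 𝓘(ℝ, EN) ∞ (ReducedSpace G ν ζ hinv)]
  (hR : IsReduction E EP EN (level G ν ζ hinv))
  (hdim : Module.finrank ℝ EP = Module.finrank ℝ EN + Module.finrank ℝ EG)
  (hdimP : Module.finrank ℝ E = Module.finrank ℝ EP + Module.finrank ℝ EG)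
  (hG : ActsByComplexIsometries G h)

include hR in
/-- A field on `M` which is tangent to the level set and projects to a field on the orbit space
restricts to a field on the level set. -/
lemma exists_related_field {p : level G ν ζ hinv} {X : Π x : M, TangentSpace 𝓘(ℝ, E) x}
    {A : Π y : ReducedSpace G ν ζ hinv, TangentSpace 𝓘(ℝ, EN) y}
    (hX : MDiffAt (T% X) (p : M)) (hXA : ∀ᶠ q : level G ν ζ hinv in 𝓝 p,
      ProjectsTo (EP := EP) E q (X (q : M)) (A (proj (level G ν ζ hinv) q))) :
    ∃ V : Π q : level G ν ζ hinv, TangentSpace 𝓘(ℝ, EP) q, MDiffAt (T% V) p ∧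
      ∀ᶠ q : level G ν ζ hinv in 𝓝 p, inclDeriv E q (V q) = X (q : M) ∧
        projDeriv EN q (V q) = A (proj (level G ν ζ hinv) q) := by
  obtain ⟨ρ, h1, h2⟩ := hR.exists_retraction p
  let V : Π q : level G ν ζ hinv, TangentSpace 𝓘(ℝ, EP) q := fun q ↦
    (show EP from mfderiv 𝓘(ℝ, E) 𝓘(ℝ, EP) ρ (q : M) (X (q : M)))
  refine ⟨V, ?_, ?_⟩
  · have t1 := mdifferentiableAt_mfderiv_family (b := fun q : level G ν ζ hinv ↦ (q : M))
      (f := fun _ ↦ ρ) (X := fun q ↦ X (q : M)) (x := p)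
      (ContMDiffAt.comp (I' := 𝓘(ℝ, E)) (g := ρ) (f := Prod.snd) _ h1.self_of_nhds contMDiffAt_snd)
      hR.contMDiff_coe.contMDiffAt
      (MDifferentiableAt.comp (I' := 𝓘(ℝ, E)) p hX (hR.mdifferentiableAt_coe p))
    refine t1.congr_of_eventuallyEq ?_
    have k1 : ∀ (q q' : level G ν ζ hinv), q = q' → ∀ v : EP,
        (TotalSpace.mk' EP q v : TangentBundle 𝓘(ℝ, EP) (level G ν ζ hinv))
          = TotalSpace.mk' EP q' v := by rintro q q' rfl v; rfl
    filter_upwards [h2] with q hq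
    exact k1 _ _ hq.symm _
  · filter_upwards [hXA, eventually_eventually_nhds.2 h2,
      continuous_subtype_val.continuousAt.eventually h1] with q hq hq2 hq1
    obtain ⟨u, hu, hu'⟩ := hq
    have h3 : V q = u := by
      refine Eq.trans ?_ (mfderiv_retraction_inclDeriv hR hq1 hq2 u)
      exact congrArg (mfderiv 𝓘(ℝ, E) 𝓘(ℝ, EP) ρ (q : M) : E →L[ℝ] EP) hu.symm
    rw [h3]
    exact ⟨hu, hu'⟩

-- The restriction of X to `P` is related to X by the inclusion and to A by π, and likewise for Y
-- and B; brackets respect both relations.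
include hR in
lemma projectsTo_mlieBracket {p : level G ν ζ hinv} {X Y : Π x : M, TangentSpace 𝓘(ℝ, E) x}
    {A B : Π y : ReducedSpace G ν ζ hinv, TangentSpace 𝓘(ℝ, EN) y}
    (hX : MDiffAt (T% X) (p : M)) (hY : MDiffAt (T% Y) (p : M))
    (hA : MDiffAt (T% A) (proj (level G ν ζ hinv) p))
    (hB : MDiffAt (T% B) (proj (level G ν ζ hinv) p))
    (hXA : ∀ᶠ q : level G ν ζ hinv in 𝓝 p,
      ProjectsTo (EP := EP) E q (X (q : M)) (A (proj (level G ν ζ hinv) q)))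
    (hYB : ∀ᶠ q : level G ν ζ hinv in 𝓝 p,
      ProjectsTo (EP := EP) E q (Y (q : M)) (B (proj (level G ν ζ hinv) q))) :
    ProjectsTo (EP := EP) E p (VectorField.mlieBracket 𝓘(ℝ, E) X Y (p : M))
      (VectorField.mlieBracket 𝓘(ℝ, EN) A B (proj (level G ν ζ hinv) p)) := by
  haveI : CompleteSpace E := FiniteDimensional.complete ℝ E
  haveI : CompleteSpace EP := FiniteDimensional.complete ℝ EP
  haveI : CompleteSpace EN := FiniteDimensional.complete ℝ EN
  obtain ⟨V, hV, hV'⟩ := exists_related_field hR hX hXA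
  obtain ⟨W, hW, hW'⟩ := exists_related_field hR hY hYB
  refine ⟨VectorField.mlieBracket 𝓘(ℝ, EP) V W p, ?_, ?_⟩
  · exact mfderiv_mlieBracket_of_related (hR.contMDiff_coe.contMDiffAt.of_le
      ENat.LEInfty.out) hV hW hX hY (hV'.mono fun q hq ↦ hq.1) (hW'.mono fun q hq ↦ hq.1)
  · exact mfderiv_mlieBracket_of_related (hR.contMDiff_proj.contMDiffAt.of_le
      ENat.LEInfty.out) hV hW hA hB (hV'.mono fun q hq ↦ hq.2) (hW'.mono fun q hq ↦ hq.2)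

/-- A field on the orbit space has, near every point of the level set, a horizontal lift which
extends to `M`. -/
lemma exists_field_horLift {p : level G ν ζ hinv}
    {A : Π y : ReducedSpace G ν ζ hinv, TangentSpace 𝓘(ℝ, EN) y}
    (hA : MDiffAt (T% A) (proj (level G ν ζ hinv) p)) :
    ∃ X : Π x : M, TangentSpace 𝓘(ℝ, E) x, MDiffAt (T% X) (p : M) ∧
      ∀ᶠ q : level G ν ζ hinv in 𝓝 p,
        X (q : M) = horLift hν hR hdim q (A (proj (level G ν ζ hinv) q)) := by
  obtain ⟨φ, m, h1, h2, h3, h4, h5, h6⟩ := exists_local_horLift hν hR hdim p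
  have hφp : φ (p : M) = proj (level G ν ζ hinv) p := h2.self_of_nhds
  let Z : Π x : M, TangentSpace 𝓘(ℝ, E) x := fun x ↦
    (show E from mfderiv 𝓘(ℝ, EN) 𝓘(ℝ, E) (m x) (φ x) (A (φ x)))
  have hm : ContMDiffAt (𝓘(ℝ, E).prod 𝓘(ℝ, EN)) 𝓘(ℝ, E) ∞ (Function.uncurry m)
      ((p : M), φ (p : M)) := by
    rw [hφp]
    exact h3.self_of_nhds
  have hAφ : MDifferentiableAt 𝓘(ℝ, E) 𝓘(ℝ, EN).tangent
      (fun x ↦ (TotalSpace.mk' EN (φ x) (A (φ x)) :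
        TangentBundle 𝓘(ℝ, EN) (ReducedSpace G ν ζ hinv))) (p : M) := by
    have hA' : MDiffAt (T% A) (φ (p : M)) := by rwa [hφp]
    exact MDifferentiableAt.comp (I' := 𝓘(ℝ, EN)) (p : M) hA'
      (h1.self_of_nhds.mdifferentiableAt (by simp))
  have t1 := mdifferentiableAt_mfderiv_family (b := φ) (f := m) hm h1.self_of_nhds hAφ
  have hZ : MDiffAt (T% Z) (p : M) := by
    refine t1.congr_of_eventuallyEq ?_
    have k1 : ∀ (x z : M), x = z → ∀ v : E, (TotalSpace.mk' E x v : TangentBundle 𝓘(ℝ, E) M)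
      = TotalSpace.mk' E z v := by rintro x z rfl v; rfl
    filter_upwards [h4] with x hx
    exact k1 _ _ hx.symm _
  refine ⟨_, mdifferentiableAt_horProj hν hZ, ?_⟩
  filter_upwards [h2, h6] with q hq hq'
  refine Eq.trans ?_ (hq' _).symm
  have k2 : ∀ y y' : ReducedSpace G ν ζ hinv, y = y' →
      (mfderiv 𝓘(ℝ, EN) 𝓘(ℝ, E) (m q) y (A y) : E)
        = mfderiv 𝓘(ℝ, EN) 𝓘(ℝ, E) (m q) y' (A y') := by rintro y y' rfl; rfl
  exact congrArg (horProj hν (q : M) : E →L[ℝ] E) (k2 _ _ hq)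

-- Brackets of horizontal fields need not be horizontal, but D = [JX,Y] + [X,JY] is: D is tangent to
-- `P`, and so is JD, being [JX,JY] - [X,Y]. Hence JD projects both to Ĵ of the image of D and to
-- the corresponding difference of brackets on `N`.
include hdimP hG in
lemma integrable_reducedJ (A B : Π y : ReducedSpace G ν ζ hinv, TangentSpace 𝓘(ℝ, EN) y)
    (y : ReducedSpace G ν ζ hinv) (hA : MDiffAt (T% A) y) (hB : MDiffAt (T% B) y) :
    VectorField.mlieBracket 𝓘(ℝ, EN) (fun z ↦ reducedJ hν hR hdim z (A z))
        (fun z ↦ reducedJ hν hR hdim z (B z)) y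
      - VectorField.mlieBracket 𝓘(ℝ, EN) A B y
      - reducedJ hν hR hdim y (VectorField.mlieBracket 𝓘(ℝ, EN)
            (fun z ↦ reducedJ hν hR hdim z (A z)) B y
          + VectorField.mlieBracket 𝓘(ℝ, EN) A (fun z ↦ reducedJ hν hR hdim z (B z)) y) = 0 := by
  obtain ⟨p, rfl⟩ : ∃ p, proj (level G ν ζ hinv) p = y := Quotient.exists_rep y
  obtain ⟨X, hX, hXA⟩ := exists_field_horLift hν hR hdim hA
  obtain ⟨Y, hY, hYB⟩ := exists_field_horLift hν hR hdim hB
  have hJA : ∀ A : Π y : ReducedSpace G ν ζ hinv, TangentSpace 𝓘(ℝ, EN) y,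
      MDiffAt (T% A) (proj (level G ν ζ hinv) p) →
      MDiffAt (T% (fun z ↦ reducedJ hν hR hdim z (A z))) (proj (level G ν ζ hinv) p) :=
    fun A hA ↦ MDifferentiableAt.clm_bundle_apply (b := id) (F₁ := EN) (F₂ := EN)
      ((contMDiff_reducedJ hν hR hdim hdimP hG).mdifferentiableAt (by simp)) hA
  have hJX : ∀ X : Π x : M, TangentSpace 𝓘(ℝ, E) x, MDiffAt (T% X) (p : M) →
      MDiffAt (T% (fun x ↦ h.J x (X x))) (p : M) :=
    fun X hX ↦ h.mdifferentiableAt_J (b := id) hX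
  have hP : ∀ (X : Π x : M, TangentSpace 𝓘(ℝ, E) x)
      (A : Π y : ReducedSpace G ν ζ hinv, TangentSpace 𝓘(ℝ, EN) y),
      (∀ᶠ q : level G ν ζ hinv in 𝓝 p,
        X (q : M) = horLift hν hR hdim q (A (proj (level G ν ζ hinv) q))) →
      (∀ᶠ q : level G ν ζ hinv in 𝓝 p,
        ProjectsTo (EP := EP) E q (X (q : M)) (A (proj (level G ν ζ hinv) q))) ∧
      ∀ᶠ q : level G ν ζ hinv in 𝓝 p, ProjectsTo (EP := EP) E q (h.J (q : M) (X (q : M)))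
        (reducedJ hν hR hdim _ (A (proj (level G ν ζ hinv) q))) := by
    intro X A hXA
    constructor
    · filter_upwards [hXA] with q hq
      rw [hq]
      exact (isHorizontalLift_iff.1 (isHorizontalLift_horLift hν hR hdim q _)).2
    · filter_upwards [hXA] with q hq
      have h1 := (isHorizontalLift_iff.1 ((isHorizontalLift_horLift hν hR hdim q
        (A (proj (level G ν ζ hinv) q))).J hν hR hdim hdimP)).2
      rw [← reducedJ_proj hν hR hdim hdimP hG q] at h1
      rw [hq]
      exact h1
  obtain ⟨hXA', hJXA⟩ := hP X A hXA
  obtain ⟨hYB', hJYB⟩ := hP Y B hYB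
  have b1 := projectsTo_mlieBracket hR (hJX X hX) hY (hJA A hA) hB hJXA hYB'
  have b2 := projectsTo_mlieBracket hR hX (hJX Y hY) hA (hJA B hB) hXA' hJYB
  have b3 := projectsTo_mlieBracket hR (hJX X hX) (hJX Y hY) (hJA A hA) (hJA B hB) hJXA hJYB
  have b4 := projectsTo_mlieBracket hR hX hY hA hB hXA' hYB'
  have hC := b3.sub b4
  have hD := b1.add b2
  have hint := sub_eq_zero.1 (h.integrable X Y (p : M) hX hY)
  rw [hint] at hC
  -- After the rewriting with `hint`, `hC` says that JD is tangent to `P`; this is the second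
  -- equation of horizontality for D.
  have hhor : IsHorizontalLift (EP := EP) h.toComplexStructure ν (level G ν ζ hinv) p _ _ :=
    isHorizontalLift_iff.2 ⟨⟨by
      obtain ⟨u, hu, -⟩ := hD
      rw [← hu]
      exact momentDeriv_inclDeriv hR hν p u, by
      obtain ⟨u, hu, -⟩ := hC
      rw [← hu]
      exact momentDeriv_inclDeriv hR hν p u⟩, hD⟩
  have h1 := (isHorizontalLift_iff.1 (hhor.J hν hR hdim hdimP)).2
  rw [← reducedJ_proj hν hR hdim hdimP hG p] at h1
  exact sub_eq_zero.2 (ProjectsTo.eq hR hC h1)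

/-- The Hermitian structure of the reduced space. -/
noncomputable def reducedHermitian : HermitianStructure EN (ReducedSpace G ν ζ hinv) where
  J := reducedJ hν hR hdim
  contMDiff_J := contMDiff_reducedJ hν hR hdim hdimP hG
  J_J _ := reducedJAt_reducedJAt hν hR hdim hdimP _
  integrable := integrable_reducedJ hν hR hdim hdimP hG
  metric :=
    { inner := reducedInner hν hR hdim
      symm := fun _ _ _ ↦ h.metric.symm _ _ _
      pos := fun _ ↦ reducedInnerAt_pos hν hR hdim _
      isVonNBounded := fun y ↦ isVonNBounded_of_pos (F := EN) _
        (reducedInnerAt_pos hν hR hdim (Quotient.out y : level G ν ζ hinv))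
      contMDiff := contMDiff_reducedInner hν hR hdim hG }
  hermitian _ := reducedInnerAt_J hν hR hdim hdimP _

theorem isInduced_reducedHermitian : IsInduced (EP := EP) h ν (level G ν ζ hinv)
    (reducedHermitian hν hR hdim hdimP hG) where
  complex p A s hA := by
    have h1 := hA.J hν hR hdim hdimP
    rw [← reducedJ_proj hν hR hdim hdimP hG p] at h1
    exact h1
  metric p A B s t hA hB := by
    rw [hA.eq_horLift hν hR hdim, hB.eq_horLift hν hR hdim]
    exact congrArg (fun T : EN →L[ℝ] EN →L[ℝ] ℝ ↦ T A B) (reducedInner_proj hν hR hdim hG p)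

-- π is onto, lifts exist at every point, and a tangent vector of `P` determines its projection, so
-- the two formulas fix J and the metric pointwise.
include hν hR hdim in
theorem IsInduced.unique {k k' : HermitianStructure EN (ReducedSpace G ν ζ hinv)}
    (hk : IsInduced (EP := EP) h ν (level G ν ζ hinv) k)
    (hk' : IsInduced (EP := EP) h ν (level G ν ζ hinv) k') : k = k' := by
  have hlift := fun (p : level G ν ζ hinv) (A : EN) ↦ isHorizontalLift_horLift hν hR hdim p A
  have hJ : k.J = k'.J := by
    funext y
    obtain ⟨p, rfl⟩ : ∃ p, proj (level G ν ζ hinv) p = y := Quotient.exists_rep y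
    ext A
    exact ProjectsTo.eq hR (isHorizontalLift_iff.1 (hk.complex p A _ (hlift p A))).2
      (isHorizontalLift_iff.1 (hk'.complex p A _ (hlift p A))).2
  have hg : k.metric.inner = k'.metric.inner := by
    funext y
    obtain ⟨p, rfl⟩ : ∃ p, proj (level G ν ζ hinv) p = y := Quotient.exists_rep y
    ext A B
    exact (hk.metric p A B _ _ (hlift p A) (hlift p B)).trans
      (hk'.metric p A B _ _ (hlift p A) (hlift p B)).symm
  obtain ⟨⟨J, _, _, _⟩, ⟨g, _, _, _, _⟩, _⟩ := k
  obtain ⟨⟨J', _, _, _⟩, ⟨g', _, _, _, _⟩, _⟩ := k'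
  obtain rfl : J = J' := hJ
  obtain rfl : g = g' := hg
  rfl

end Reduced

/-! ### The empty level set -/

section Empty

variable {E : Type*} [NormedAddCommGroup E] [NormedSpace ℝ E] [FiniteDimensional ℝ E]
  {M : Type*} [TopologicalSpace M] [ChartedSpace E M] [IsManifold 𝓘(ℝ, E) ∞ M] [IsEmpty M]

/-- The Hermitian structure on the empty manifold. -/
noncomputable def HermitianStructure.ofIsEmpty : HermitianStructure E M where
  J x := isEmptyElim x
  contMDiff_J x := isEmptyElim x
  J_J x := isEmptyElim x
  integrable _ _ x := isEmptyElim x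
  metric :=
    { inner := fun x ↦ isEmptyElim x
      symm := fun x ↦ isEmptyElim x
      pos := fun x ↦ isEmptyElim x
      isVonNBounded := fun x ↦ isEmptyElim x
      contMDiff := fun x ↦ isEmptyElim x }
  hermitian x := isEmptyElim x

lemma HermitianStructure.eq_of_isEmpty (k k' : HermitianStructure E M) : k = k' := by
  have hJ : k.J = k'.J := funext fun x ↦ isEmptyElim x
  have hg : k.metric.inner = k'.metric.inner := funext fun x ↦ isEmptyElim x
  obtain ⟨⟨J, _, _, _⟩, ⟨g, _, _, _, _⟩, _⟩ := k
  obtain ⟨⟨J', _, _, _⟩, ⟨g', _, _, _, _⟩, _⟩ := k'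
  obtain rfl : J = J' := hJ
  obtain rfl : g = g' := hg
  rfl

end Empty

end KT

/-! ### The reduction theorem -/

theorem mainTheorem2
    {E : Type*} [NormedAddCommGroup E] [NormedSpace ℝ E] [FiniteDimensional ℝ E]
    {M : Type*} [TopologicalSpace M] [T2Space M] [SecondCountableTopology M]
    [ChartedSpace E M] [IsManifold 𝓘(ℝ, E) ∞ M]
    {EG : Type*} [NormedAddCommGroup EG] [NormedSpace ℝ EG] [FiniteDimensional ℝ EG]
    {G : Type*} [Group G] [TopologicalSpace G] [T2Space G] [CompactSpace G]
    [ChartedSpace EG G] [LieGroup 𝓘(ℝ, EG) ∞ G]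
    [MulAction G M] [ContMDiffSMul 𝓘(ℝ, EG) 𝓘(ℝ, E) ∞ G M]
    (K : KT.KTStructure E M)
    (hG : KT.ActsByComplexIsometries G K.toHermitianStructure)
    (ν : M → (EG →L[ℝ] ℝ)) (hν : KT.IsGMomentMap G K.toComplexStructure ν)
    (ζ : EG →L[ℝ] ℝ)
    (hinv : ∀ (a : G) (x : M), ν x = ζ → ν (a • x) = ζ)
    (hfree : ∀ (a : G) (x : M), ν x = ζ → a • x = x → a = 1) :
    T2Space (KT.ReducedSpace G ν ζ hinv) ∧
    SecondCountableTopology (KT.ReducedSpace G ν ζ hinv) ∧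
    ∃ (_ : ChartedSpace (KT.LevelModel E EG) (KT.level G ν ζ hinv))
      (_ : ChartedSpace (KT.ReducedModel E EG) (KT.ReducedSpace G ν ζ hinv))
      (_ : IsManifold 𝓘(ℝ, KT.LevelModel E EG) ∞ (KT.level G ν ζ hinv))
      (_ : IsManifold 𝓘(ℝ, KT.ReducedModel E EG) ∞ (KT.ReducedSpace G ν ζ hinv)),
      -- `P = ν⁻¹(ζ)` is an embedded submanifold of `M` and `π : P → N` is a submersion
      Manifold.IsSmoothEmbedding 𝓘(ℝ, KT.LevelModel E EG) 𝓘(ℝ, E) ∞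
        (fun q : KT.level G ν ζ hinv ↦ (q : M)) ∧
      Manifold.IsSubmersion 𝓘(ℝ, KT.LevelModel E EG) 𝓘(ℝ, KT.ReducedModel E EG) ∞
        (KT.proj (KT.level G ν ζ hinv)) ∧
      -- every tangent vector of `N` has exactly one horizontal lift at each point above
      (∀ (p : KT.level G ν ζ hinv)
        (A : TangentSpace 𝓘(ℝ, KT.ReducedModel E EG) (KT.proj (KT.level G ν ζ hinv) p)),
        ∃! t : TangentSpace 𝓘(ℝ, E) (p : M),
          KT.IsHorizontalLift (EP := KT.LevelModel E EG) K.toComplexStructure ν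
            (KT.level G ν ζ hinv) p A t) ∧
      -- `N` has a KT structure whose complex structure and metric are induced from `M`
      ∃ k : KT.KTStructure (KT.ReducedModel E EG) (KT.ReducedSpace G ν ζ hinv),
        KT.IsInduced (EP := KT.LevelModel E EG) K.toHermitianStructure ν
          (KT.level G ν ζ hinv) k.toHermitianStructure ∧
        -- it is unique
        ∀ k' : KT.KTStructure (KT.ReducedModel E EG) (KT.ReducedSpace G ν ζ hinv),
          KT.IsInduced (EP := KT.LevelModel E EG) K.toHermitianStructure ν
            (KT.level G ν ζ hinv) k'.toHermitianStructure →
          k'.toHermitianStructure = k.toHermitianStructure ∧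
          KT.SameConnection k'.conn k.conn := by
  haveI : ContinuousSMul G M :=
    ContMDiffSMul.continuousSMul (I := 𝓘(ℝ, EG)) (I' := 𝓘(ℝ, E)) ∞
  refine ⟨KT.t2Space_quotient _, KT.secondCountableTopology_quotient _, ?_⟩
  -- The bound 2 dim G ≤ dim M is derived at a point of the level set. If there is none, the
  -- subtractions in the model dimensions may be truncated, and every claim holds vacuously.
  rcases isEmpty_or_nonempty (KT.level G ν ζ hinv) with hP | ⟨⟨p₀⟩⟩
  · haveI : IsEmpty (KT.ReducedSpace G ν ζ hinv) := ⟨fun y ↦ hP.elim y.out⟩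
    refine ⟨ChartedSpace.empty _ _, ChartedSpace.empty _ _, ?_⟩
    letI : ChartedSpace (KT.LevelModel E EG) (KT.level G ν ζ hinv) := ChartedSpace.empty _ _
    letI : ChartedSpace (KT.ReducedModel E EG) (KT.ReducedSpace G ν ζ hinv) :=
      ChartedSpace.empty _ _
    haveI : IsManifold 𝓘(ℝ, KT.ReducedModel E EG) ∞ (KT.ReducedSpace G ν ζ hinv) :=
      IsManifold.empty _
    refine ⟨IsManifold.empty _, IsManifold.empty _, ⟨⟨E, inferInstance, inferInstance, fun p ↦
      isEmptyElim p⟩, Topology.IsEmbedding.subtypeVal⟩, ⟨Unit, inferInstance, inferInstance,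
      fun p ↦ isEmptyElim p⟩, fun p ↦ isEmptyElim p,
      ⟨KT.HermitianStructure.ofIsEmpty, KT.HermitianStructure.bismut _,
        KT.HermitianStructure.isKTConnection_bismut _⟩, ⟨fun p ↦ isEmptyElim p,
        fun p ↦ isEmptyElim p⟩, fun k' _ ↦ ⟨KT.HermitianStructure.eq_of_isEmpty _ _,
        fun _ y ↦ isEmptyElim y⟩⟩
  have hle : 2 * Module.finrank ℝ EG ≤ Module.finrank ℝ E :=
    KT.two_mul_finrank_le (E := E) (hν.surjective_momentDeriv (p₀ : M))
      (hν.injective_fundamentalMap (p₀ : M))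
      (hν.momentDeriv_fundamentalMap hinv p₀.2) KT.finrank_dual_eq
  have hdim : Module.finrank ℝ (KT.LevelModel E EG)
      = Module.finrank ℝ (KT.ReducedModel E EG) + Module.finrank ℝ EG := by
    rw [finrank_euclideanSpace_fin, finrank_euclideanSpace_fin]
    omega
  have hdimP : Module.finrank ℝ E
      = Module.finrank ℝ (KT.LevelModel E EG) + Module.finrank ℝ EG := by
    rw [finrank_euclideanSpace_fin]
    omega
  let l : (EG × KT.ReducedModel E EG) ≃L[ℝ] KT.LevelModel E EG :=
    ContinuousLinearEquiv.ofFinrankEq (by rw [Module.finrank_prod, hdim, add_comm])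
  let A : E ≃L[ℝ] (EG →L[ℝ] ℝ) × (EG × KT.ReducedModel E EG) :=
    ContinuousLinearEquiv.ofFinrankEq (by
      rw [Module.finrank_prod, Module.finrank_prod, KT.finrank_dual_eq]
      omega)
  let e : EG ≃L[ℝ] EuclideanSpace ℝ (Fin (Module.finrank ℝ EG)) :=
    ContinuousLinearEquiv.ofFinrankEq finrank_euclideanSpace_fin.symm
  choose Θ hΘ hmem using fun p : KT.level G ν ζ hinv ↦
    KT.exists_isAdaptedChart hν hinv hfree (p := (p : M)) p.2
  have hsmul : ∀ a : G, ContMDiff 𝓘(ℝ, E) 𝓘(ℝ, E) ∞ (fun x : M ↦ a • x) := fun a ↦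
    KT.contMDiff_const_smul_point EG a
  letI := KT.levelChartedSpace hΘ hmem l
  letI := KT.orbitChartedSpace hΘ hmem
  haveI := KT.isManifold_level hΘ hmem l
  haveI := KT.isManifold_orbit hΘ hmem hsmul
  have hR := KT.isReduction hΘ hmem l hsmul
  let k := KT.reducedHermitian hν hR hdim hdimP hG
  have hk := KT.isInduced_reducedHermitian hν hR hdim hdimP hG
  refine ⟨KT.levelChartedSpace hΘ hmem l, KT.orbitChartedSpace hΘ hmem,
    KT.isManifold_level hΘ hmem l, KT.isManifold_orbit hΘ hmem hsmul,
    KT.isSmoothEmbedding_level hΘ hmem l A, KT.isSubmersion_proj hΘ hmem hsmul l e,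
    fun p B ↦ KT.existsUnique_isHorizontalLift hR hν hdim B,
    ⟨k, k.bismut, KT.HermitianStructure.isKTConnection_bismut k⟩, hk, fun k' hk' ↦ ?_⟩
  have h1 := KT.IsInduced.unique hν hR hdim hk' hk
  -- Once the Hermitian structures agree, both connections are KT connections of the same structure.
  refine ⟨h1, KT.HermitianStructure.sameConnection_of_isKTConnection k'.isKTConnection ?_⟩
  rw [h1]
  exact KT.HermitianStructure.isKTConnection_bismut k
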